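/- Let $n\ge 4$ and $\lambda>n-1$. Let $\mathrm D_n^{\mathrm{IV}}=\{z\in\mathbb C^n : |z|<1,\ 2|z|^2<1+|z^\top z|^2\}$, and let $v_\lambda$ be the probability measure on $\mathrm D_n^{\mathrm{IV}}$ proportional to $(1-2|z|^2+|z^\top z|^2)^{\lambda-n}\,dz$, with $dz$ Lebesgue measure. Let $\mathcal A^2_\lambda(\mathrm D_n^{\mathrm{IV}})\subset L^2(v_\lambda)$ be the weighted Bergman space of square-integrable holomorphic functions. Identify $\mathrm{SO}(2)$ with the unit circle, and let $\mathrm{SO}(n)\times\mathrm{SO}(2)$ act on $\mathcal A^2_\lambda(\mathrm D_n^{\mathrm{IV}})$ by the unitary representation $(\pi_\lambda(A,t)f)(z)=f(\bar t A^{-1}z)$. Embed $\mathrm{SO}(n-1)$ in $\mathrm{SO}(n)$ as the upper left corner, $A\mapsto \mathrm{diag}(A,1)$. For $r\in\mathbb N$ let $\mathcal H^r(\mathbb C^{n-1})$ be the space of complex polynomials $p$ in $n-1$ variables, homogeneous of degree $r$, with $\sum_j \partial^2 p/\partial z_j^2=0$, on which $\mathrm{SO}(n-1)$ acts by $(A\cdot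 p)(z)=p(A^{-1}z)$. For $m\in\mathbb N$ let $\mathbb C_m$ be the one-dimensional $\mathrm{SO}(2)$-module with character $t\mapsto t^{-m}$. Let $\lfloor k\rfloor_2\in\{0,1\}$ denote the parity of $k$, and let $kV$ denote the direct sum of $k$ copies of $V$. Then the outer tensor products $\mathcal H^r(\mathbb C^{n-1})\otimes\mathbb C_m$ with $0\le r\le m$ are irreducible, finite-dimensional and pairwise non-isomorphic $\mathrm{SO}(n-1)\times\mathrm{SO}(2)$-modules, and the isotypic decomposition of $\pi_\lambda|_{\mathrm{SO}(n-1)\times\mathrm{SO}(2)}$ is given by the isomorphism of $\mathrm{SO}(n-1)\times\mathrm{SO}(2)$-modules (Hilbert direct sum) $$\mathcal A^2_\lambda(\mathrm D_n^{\mathrm{IV}})\simeq\bigoplus_{m=0}^\infty\bigoplus_{r=0}^m\Big(\Big\lfloor\frac m2\Big\rfloor-\Big\lfloor\frac{r+\lfloor m+1\rfloor_2}2\Big\rfloor+1\Big)\,\mathcal H^r(\mathbb C^{n-1})\otimes\mathbb C_m .$$ That is, $\mathcal A^2_\lambda(\mathrm D_n^{\mathrm{IV}})$ is the Hilbert direct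 sum of its isotypic components (the sums of all irreducible closed invariant subspaces of a given isomorphism type), these are of the types $\mathcal H^r(\mathbb C^{n-1})\otimes\mathbb C_m$ with $0\le r\le m$, and the component of type $(r,m)$ is isomorphic to the stated non-zero number of copies of $\mathcal H^r(\mathbb C^{n-1})\otimes\mathbb C_m$. In particular, this decomposition is not multiplicity-free: some isotypic component is not irreducible. -/

import Mathlib

open MeasureTheory
open scoped DirectSum TensorProduct ENNReal

namespace CartanIV

noncomputable section

/-! ## The domain, the weighted measures and the weighted Bergman spaces -/

/-- `|z|²` for `z ∈ ℂⁿ` (Euclidean norm). -/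
def normSq {n : ℕ} (z : Fin n → ℂ) : ℝ := ∑ i, ‖z i‖ ^ 2

/-- `zᵀ z = z₁² + ⋯ + zₙ²`. -/
def quad {n : ℕ} (z : Fin n → ℂ) : ℂ := ∑ i, z i ^ 2

/-- The Cartan domain of type IV: `|z| < 1` and `2 |z|² < 1 + |zᵀ z|²`. -/
def domain (n : ℕ) : Set (Fin n → ℂ) :=
  {z | normSq z < 1 ∧ 2 * normSq z < 1 + ‖quad z‖ ^ 2}

/-- `Δ(z) = 1 - 2 |z|² + |zᵀ z|²`, which is positive on the domain. -/
def jordanDelta {n : ℕ} (z : Fin n → ℂ) : ℝ := 1 - 2 * normSq z + ‖quad z‖ ^ 2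

/-- The measure `Δ(z)^(lam - n) dz` on the domain (`dz` is Lebesgue measure on `ℂⁿ`). -/
def preMeasure (n : ℕ) (lam : ℝ) : Measure (Fin n → ℂ) :=
  (volume.restrict (domain n)).withDensity
    (fun z => ENNReal.ofReal (jordanDelta z ^ (lam - (n : ℝ))))

/-- The measure `v_lam`: the previous measure normalized to have total mass one. -/
def weightedMeasure (n : ℕ) (lam : ℝ) : Measure (Fin n → ℂ) :=
  (preMeasure n lam Set.univ)⁻¹ • preMeasure n lam

/-- The weighted Bergman space: the elements of `L²(v_lam)` represented by a function that is
holomorphic on the domain. It carries the inner product of `L²(v_lam)`. -/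
def bergman (n : ℕ) (lam : ℝ) : Submodule ℂ (Lp ℂ 2 (weightedMeasure n lam)) where
  carrier := {f | ∃ F : (Fin n → ℂ) → ℂ, DifferentiableOn ℂ F (domain n) ∧
    f =ᵐ[weightedMeasure n lam] F}
  zero_mem' := ⟨0, differentiableOn_const 0, Lp.coeFn_zero ℂ 2 _⟩
  add_mem' := by
    rintro f g ⟨F, hF, hfF⟩ ⟨G, hG, hgG⟩
    exact ⟨F + G, hF.add hG, (Lp.coeFn_add f g).trans (hfF.add hgG)⟩
  smul_mem' := by
    rintro c f ⟨F, hF, hfF⟩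
    exact ⟨c • F, hF.const_smul c, (Lp.coeFn_smul c f).trans (hfF.const_smul c)⟩

/-! ## The groups and their action on the domain -/

/-- The compact group `SO(n)`. -/
abbrev SO (n : ℕ) := Matrix.specialOrthogonalGroup (Fin n) ℝ

lemma SO.transpose_mul {n : ℕ} (A : SO n) :
    (A : Matrix (Fin n) (Fin n) ℝ).transpose * (A : Matrix (Fin n) (Fin n) ℝ) = 1 :=
  (Matrix.mem_orthogonalGroup_iff' _ _).1 (Matrix.mem_specialOrthogonalGroup_iff.1 A.2).1

lemma SO.mul_transpose {n : ℕ} (A : SO n) :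
    (A : Matrix (Fin n) (Fin n) ℝ) * (A : Matrix (Fin n) (Fin n) ℝ).transpose = 1 :=
  (Matrix.mem_orthogonalGroup_iff _ _).1 (Matrix.mem_specialOrthogonalGroup_iff.1 A.2).1

/-- A real rotation matrix, with entries regarded as complex numbers. -/
def SO.toComplex {n : ℕ} : SO n →* Matrix (Fin n) (Fin n) ℂ :=
  (Complex.ofRealHom.mapMatrix : Matrix (Fin n) (Fin n) ℝ →+* Matrix (Fin n) (Fin n) ℂ).toMonoidHom.comp
    (Submonoid.subtype _)

lemma SO.toComplex_apply {n : ℕ} (A : SO n) (i j : Fin n) :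
    SO.toComplex A i j = ((A : Matrix (Fin n) (Fin n) ℝ) i j : ℂ) := rfl

lemma SO.toComplex_transpose_mul {n : ℕ} (A : SO n) :
    (SO.toComplex A).transpose * SO.toComplex A = 1 := by
  have h := congrArg (Complex.ofRealHom.mapMatrix :
    Matrix (Fin n) (Fin n) ℝ →+* Matrix (Fin n) (Fin n) ℂ) (SO.transpose_mul A)
  rw [map_mul, map_one] at h
  exact h

lemma SO.toComplex_mul_transpose {n : ℕ} (A : SO n) :
    SO.toComplex A * (SO.toComplex A).transpose = 1 := by
  have h := congrArg (Complex.ofRealHom.mapMatrix :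
    Matrix (Fin n) (Fin n) ℝ →+* Matrix (Fin n) (Fin n) ℂ) (SO.mul_transpose A)
  rw [map_mul, map_one] at h
  exact h

lemma SO.toComplex_conjTranspose {n : ℕ} (A : SO n) :
    (SO.toComplex A).conjTranspose = (SO.toComplex A).transpose := by
  ext i j
  simp [Matrix.conjTranspose_apply, SO.toComplex_apply]

/-- The linear action `(A, t) · z = t A z` of `SO(n) × SO(2)` on `ℂⁿ`, where `SO(2)` is identified
with the unit circle. -/
def act (n : ℕ) : SO n × Circle →* Module.End ℂ (Fin n → ℂ) where
  toFun g := (g.2 : ℂ) • Matrix.toLin' (SO.toComplex g.1)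
  map_one' := by
    refine LinearMap.ext fun z => ?_
    simp
  map_mul' g h := by
    refine LinearMap.ext fun z => ?_
    simp [smul_smul, mul_comm]

lemma act_apply {n : ℕ} (g : SO n × Circle) (z : Fin n → ℂ) :
    act n g z = (g.2 : ℂ) • (SO.toComplex g.1).mulVec z := by
  simp [act]

lemma normSq_eq {n : ℕ} (z : Fin n → ℂ) : ((normSq z : ℝ) : ℂ) = star z ⬝ᵥ z := by
  simp [normSq, dotProduct, Complex.conj_mul']

lemma quad_eq {n : ℕ} (z : Fin n → ℂ) : quad z = z ⬝ᵥ z := by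
  simp [quad, dotProduct, sq]

lemma normSq_act {n : ℕ} (g : SO n × Circle) (z : Fin n → ℂ) :
    normSq (act n g z) = normSq z := by
  have h : ((normSq (act n g z) : ℝ) : ℂ) = ((normSq z : ℝ) : ℂ) := by
    rw [normSq_eq, normSq_eq, act_apply, star_smul, smul_dotProduct, dotProduct_smul,
      Matrix.star_mulVec, ← Matrix.dotProduct_mulVec, Matrix.mulVec_mulVec,
      SO.toComplex_conjTranspose, SO.toComplex_transpose_mul, Matrix.one_mulVec, smul_smul]
    have : star (g.2 : ℂ) * (g.2 : ℂ) = 1 := by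
      rw [Complex.star_def, Complex.conj_mul', Circle.norm_coe]; simp
    rw [this, one_smul]
  exact_mod_cast h

lemma quad_act {n : ℕ} (g : SO n × Circle) (z : Fin n → ℂ) :
    quad (act n g z) = (g.2 : ℂ) ^ 2 * quad z := by
  have h : (SO.toComplex g.1).mulVec z ⬝ᵥ (SO.toComplex g.1).mulVec z = z ⬝ᵥ z := by
    rw [Matrix.dotProduct_mulVec, Matrix.vecMul_mulVec, ← Matrix.dotProduct_mulVec,
      SO.toComplex_transpose_mul, Matrix.one_mulVec]
  rw [quad_eq, quad_eq, act_apply, smul_dotProduct, dotProduct_smul, h, smul_smul, sq, smul_eq_mul]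

lemma norm_quad_act {n : ℕ} (g : SO n × Circle) (z : Fin n → ℂ) :
    ‖quad (act n g z)‖ = ‖quad z‖ := by
  simp [quad_act, Circle.norm_coe]

lemma act_mem_domain {n : ℕ} (g : SO n × Circle) {z : Fin n → ℂ} :
    act n g z ∈ domain n ↔ z ∈ domain n := by
  simp [domain, normSq_act, norm_quad_act]

lemma jordanDelta_act {n : ℕ} (g : SO n × Circle) (z : Fin n → ℂ) :
    jordanDelta (act n g z) = jordanDelta z := by
  simp [jordanDelta, normSq_act, norm_quad_act]

lemma act_inv_act {n : ℕ} (g : SO n × Circle) (z : Fin n → ℂ) :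
    act n g⁻¹ (act n g z) = z := by
  rw [← Module.End.mul_apply, ← map_mul, inv_mul_cancel, map_one, Module.End.one_apply]

lemma act_act_inv {n : ℕ} (g : SO n × Circle) (z : Fin n → ℂ) :
    act n g (act n g⁻¹ z) = z := by
  rw [← Module.End.mul_apply, ← map_mul, mul_inv_cancel, map_one, Module.End.one_apply]

lemma continuous_act {n : ℕ} (g : SO n × Circle) : Continuous (act n g) :=
  LinearMap.continuous_of_finiteDimensional _

lemma continuous_normSq {n : ℕ} : Continuous (normSq (n := n)) := by
  unfold normSq; fun_prop

lemma continuous_quad {n : ℕ} : Continuous (quad (n := n)) := by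
  unfold quad; fun_prop

lemma continuous_jordanDelta {n : ℕ} : Continuous (jordanDelta (n := n)) := by
  unfold jordanDelta
  exact (continuous_const.sub (continuous_const.mul continuous_normSq)).add
    (continuous_quad.norm.pow 2)

lemma isOpen_domain (n : ℕ) : IsOpen (domain n) :=
  (isOpen_lt continuous_normSq continuous_const).inter
    (isOpen_lt (continuous_const.mul continuous_normSq)
      (continuous_const.add (continuous_quad.norm.pow 2)))

lemma measurePreserving_act_volume {n : ℕ} (g : SO n × Circle) :
    MeasurePreserving (act n g) volume volume := by
  set L : (Fin n → ℂ) →ₗ[ℝ] (Fin n → ℂ) := (act n g).restrictScalars ℝ with hL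
  have hdom : L '' domain n = domain n := by
    ext z
    constructor
    · rintro ⟨w, hw, rfl⟩
      exact (act_mem_domain g).2 hw
    · intro hz
      exact ⟨act n g⁻¹ z, (act_mem_domain g⁻¹).2 hz, act_act_inv g z⟩
  have hpos : volume (domain n) ≠ 0 := by
    refine ((isOpen_domain n).measure_pos volume ⟨0, ?_⟩).ne'
    simp [domain, normSq, quad]
  have hfin : volume (domain n) ≠ ∞ := by
    have hsub : domain n ⊆ Metric.closedBall 0 1 := by
      intro z hz
      rw [mem_closedBall_zero_iff, pi_norm_le_iff_of_nonneg zero_le_one]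
      intro i
      have h1 : ‖z i‖ ^ 2 ≤ normSq z :=
        Finset.single_le_sum (f := fun i => ‖z i‖ ^ 2) (fun j _ => by positivity) (Finset.mem_univ i)
      have h2 := hz.1
      nlinarith [norm_nonneg (z i)]
    exact ((measure_mono hsub).trans_lt (isCompact_closedBall _ _).measure_lt_top).ne
  have hdet := Measure.addHaar_image_linearMap volume L (domain n)
  rw [hdom] at hdet
  have hdet1 : ENNReal.ofReal |LinearMap.det L| = 1 := by
    have h2 : ENNReal.ofReal |LinearMap.det L| * volume (domain n) = 1 * volume (domain n) := by
      rw [one_mul]; exact hdet.symm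
    exact (ENNReal.mul_left_inj hpos hfin).1 h2
  have hdet2 : |LinearMap.det L| = 1 := by simpa using hdet1
  have hne : LinearMap.det L ≠ 0 := by
    intro h; simp [h] at hdet2
  refine ⟨(continuous_act g).measurable, ?_⟩
  have := Measure.map_linearMap_addHaar_eq_smul_addHaar (μ := (volume : Measure (Fin n → ℂ))) hne
  rw [abs_inv, hdet2, inv_one, ENNReal.ofReal_one, one_smul] at this
  exact this

lemma measurePreserving_act {n : ℕ} (lam : ℝ) (g : SO n × Circle) :
    MeasurePreserving (act n g) (weightedMeasure n lam) (weightedMeasure n lam) := by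
  have hpre : MeasurePreserving (act n g) (preMeasure n lam) (preMeasure n lam) := by
    have hD : MeasurableSet (domain n) := (isOpen_domain n).measurableSet
    have hmeas : Measurable
        (fun z : Fin n → ℂ => ENNReal.ofReal (jordanDelta z ^ (lam - (n : ℝ)))) :=
      (continuous_jordanDelta.measurable.pow_const _).ennreal_ofReal
    refine ⟨(continuous_act g).measurable, ?_⟩
    ext s hs
    have hs' : MeasurableSet (act n g ⁻¹' s) := (continuous_act g).measurable hs
    rw [Measure.map_apply (continuous_act g).measurable hs, preMeasure,
      withDensity_apply _ hs', withDensity_apply _ hs, Measure.restrict_restrict hs',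
      Measure.restrict_restrict hs,
      ← (measurePreserving_act_volume g).setLIntegral_comp_preimage (hs.inter hD) hmeas]
    have hset : act n g ⁻¹' (s ∩ domain n) = act n g ⁻¹' s ∩ domain n := by
      ext z; simp [act_mem_domain]
    rw [hset]
    simp only [jordanDelta_act]
  exact hpre.smul_measure _

/-- The representation `π_lam` of `SO(n) × SO(2)` on the Bergman space:
`(π_lam(A, t) f)(z) = f(t⁻¹ A⁻¹ z)`. -/
def bergmanRep (n : ℕ) (lam : ℝ) : Representation ℂ (SO n × Circle) (bergman n lam) where
  toFun g := ((Lp.compMeasurePreservingₗ ℂ (act n g⁻¹) (measurePreserving_act lam g⁻¹)).restrict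
    (p := bergman n lam) (q := bergman n lam) (by
      rintro f ⟨F, hF, hfF⟩
      refine ⟨F ∘ act n g⁻¹, ?_, ?_⟩
      · refine hF.comp ?_ (fun z hz => (act_mem_domain g⁻¹).2 hz)
        exact (LinearMap.toContinuousLinearMap (act n g⁻¹)).differentiable.differentiableOn
      · exact (Lp.coeFn_compMeasurePreserving f (measurePreserving_act lam g⁻¹)).trans
          ((measurePreserving_act lam g⁻¹).quasiMeasurePreserving.ae_eq_comp hfF)))
  map_one' := by
    refine LinearMap.ext fun f => Subtype.ext ?_
    refine Lp.ext ((Lp.coeFn_compMeasurePreserving f.1 (measurePreserving_act lam 1⁻¹)).trans ?_)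
    refine Filter.Eventually.of_forall fun z => ?_
    simp
  map_mul' g h := by
    refine LinearMap.ext fun f => Subtype.ext ?_
    change Lp.compMeasurePreserving _ (measurePreserving_act lam (g * h)⁻¹) f.1 =
      Lp.compMeasurePreserving _ (measurePreserving_act lam g⁻¹)
        (Lp.compMeasurePreserving _ (measurePreserving_act lam h⁻¹) f.1)
    refine Lp.ext ((Lp.coeFn_compMeasurePreserving f.1 _).trans ?_)
    refine Filter.EventuallyEq.symm ((Lp.coeFn_compMeasurePreserving _ _).trans ?_)
    refine ((measurePreserving_act lam g⁻¹).quasiMeasurePreserving.ae_eq_comp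
      (Lp.coeFn_compMeasurePreserving f.1 (measurePreserving_act lam h⁻¹))).trans ?_
    refine Filter.Eventually.of_forall fun z => ?_
    simp [mul_inv_rev, map_mul, Module.End.mul_apply]

/-- The block matrix `diag(M, 1)`. -/
def cornerMatrix {d : ℕ} (M : Matrix (Fin d) (Fin d) ℝ) : Matrix (Fin (d + 1)) (Fin (d + 1)) ℝ :=
  Matrix.reindexAlgEquiv ℝ ℝ (finSumFinEquiv (m := d) (n := 1)) (Matrix.fromBlocks M 0 0 1)

lemma cornerMatrix_one {d : ℕ} : cornerMatrix (1 : Matrix (Fin d) (Fin d) ℝ) = 1 := by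
  simp [cornerMatrix]

lemma cornerMatrix_mul {d : ℕ} (M N : Matrix (Fin d) (Fin d) ℝ) :
    cornerMatrix (M * N) = cornerMatrix M * cornerMatrix N := by
  rw [cornerMatrix, cornerMatrix, cornerMatrix, ← map_mul, Matrix.fromBlocks_multiply]
  simp

lemma cornerMatrix_transpose {d : ℕ} (M : Matrix (Fin d) (Fin d) ℝ) :
    (cornerMatrix M).transpose = cornerMatrix M.transpose := by
  simp only [cornerMatrix, Matrix.coe_reindexAlgEquiv, Matrix.transpose_reindex,
    Matrix.fromBlocks_transpose, Matrix.transpose_zero, Matrix.transpose_one]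

lemma cornerMatrix_det {d : ℕ} (M : Matrix (Fin d) (Fin d) ℝ) :
    (cornerMatrix M).det = M.det := by
  simp [cornerMatrix]

/-- The upper left corner embedding `A ↦ diag(A, 1)` of `SO(d)` into `SO(d+1)`. -/
def cornerEmbedding (d : ℕ) : SO d →* SO (d + 1) where
  toFun A := ⟨cornerMatrix (A : Matrix (Fin d) (Fin d) ℝ), by
    rw [Matrix.mem_specialOrthogonalGroup_iff]
    refine ⟨(Matrix.mem_orthogonalGroup_iff _ _).2 ?_, ?_⟩
    · rw [cornerMatrix_transpose, ← cornerMatrix_mul, SO.mul_transpose, cornerMatrix_one]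
    · rw [cornerMatrix_det]
      exact (Matrix.mem_specialOrthogonalGroup_iff.1 A.2).2⟩
  map_one' := Subtype.ext cornerMatrix_one
  map_mul' A B := Subtype.ext (cornerMatrix_mul _ _)

/-- The restriction of `π_lam` (on functions of `d+1` variables) to `SO(d) × SO(2)`. -/
def restrictedRep (d : ℕ) (lam : ℝ) :
    Representation ℂ (SO d × Circle) (bergman (d + 1) lam) :=
  (bergmanRep (d + 1) lam).comp ((cornerEmbedding d).prodMap (MonoidHom.id Circle))

/-! ## Harmonic polynomials -/

/-- The holomorphic Laplacian `∑ⱼ ∂²/∂zⱼ²` on polynomials. -/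
def laplacian (d : ℕ) : MvPolynomial (Fin d) ℂ →ₗ[ℂ] MvPolynomial (Fin d) ℂ :=
  ∑ j, (MvPolynomial.pderiv j).toLinearMap ∘ₗ (MvPolynomial.pderiv j).toLinearMap

/-- `H^r(ℂᵈ)`: the harmonic polynomials that are homogeneous of degree `r`. -/
def harmonic (d r : ℕ) : Submodule ℂ (MvPolynomial (Fin d) ℂ) :=
  MvPolynomial.homogeneousSubmodule (Fin d) ℂ r ⊓ LinearMap.ker (laplacian d)

/-- `p(z) ↦ p(M z)` for a matrix `M`. -/
def substMatrix {d : ℕ} (M : Matrix (Fin d) (Fin d) ℂ) :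
    MvPolynomial (Fin d) ℂ →ₐ[ℂ] MvPolynomial (Fin d) ℂ :=
  MvPolynomial.aeval (fun i => ∑ j, MvPolynomial.C (M i j) * MvPolynomial.X j)

lemma substMatrix_X {d : ℕ} (M : Matrix (Fin d) (Fin d) ℂ) (i : Fin d) :
    substMatrix M (MvPolynomial.X i) = ∑ j, MvPolynomial.C (M i j) * MvPolynomial.X j := by
  simp [substMatrix]

lemma substMatrix_C {d : ℕ} (M : Matrix (Fin d) (Fin d) ℂ) (c : ℂ) :
    substMatrix M (MvPolynomial.C c) = MvPolynomial.C c := by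
  simp [substMatrix]

lemma substMatrix_one {d : ℕ} (p : MvPolynomial (Fin d) ℂ) : substMatrix 1 p = p := by
  have h : substMatrix (1 : Matrix (Fin d) (Fin d) ℂ) = AlgHom.id ℂ _ := by
    refine MvPolynomial.algHom_ext fun i => ?_
    rw [substMatrix_X, Finset.sum_eq_single i]
    · simp
    · intro j _ hj
      simp [Matrix.one_apply_ne (Ne.symm hj)]
    · simp
  rw [h, AlgHom.id_apply]

lemma substMatrix_substMatrix {d : ℕ} (M N : Matrix (Fin d) (Fin d) ℂ)
    (p : MvPolynomial (Fin d) ℂ) :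
    substMatrix N (substMatrix M p) = substMatrix (M * N) p := by
  have h : (substMatrix N).comp (substMatrix M) = substMatrix (M * N) := by
    refine MvPolynomial.algHom_ext fun i => ?_
    rw [AlgHom.comp_apply, substMatrix_X, substMatrix_X, map_sum]
    simp only [map_mul, substMatrix_C, substMatrix_X, Matrix.mul_apply, map_sum, Finset.mul_sum,
      Finset.sum_mul]
    rw [Finset.sum_comm]
    simp only [mul_assoc]
  rw [← h, AlgHom.comp_apply]

lemma substMatrix_isHomogeneous {d r : ℕ} (M : Matrix (Fin d) (Fin d) ℂ)
    {p : MvPolynomial (Fin d) ℂ} (hp : p.IsHomogeneous r) :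
    (substMatrix M p).IsHomogeneous r := by
  have h := hp.aeval (R := ℂ) (n := 1) (fun i => ∑ j, MvPolynomial.C (M i j) * MvPolynomial.X j)
    (fun i => MvPolynomial.IsHomogeneous.sum _ _ _ fun j _ => by
      simpa using (MvPolynomial.isHomogeneous_C (Fin d) (M i j)).mul
        (MvPolynomial.isHomogeneous_X ℂ j))
  simpa [substMatrix] using h

lemma pderiv_substMatrix {d : ℕ} (M : Matrix (Fin d) (Fin d) ℂ) (j : Fin d)
    (p : MvPolynomial (Fin d) ℂ) :
    MvPolynomial.pderiv j (substMatrix M p) =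
      ∑ i, MvPolynomial.C (M i j) * substMatrix M (MvPolynomial.pderiv i p) := by
  induction p using MvPolynomial.induction_on with
  | C c => simp
  | add p q hp hq => simp [hp, hq, mul_add, Finset.sum_add_distrib]
  | mul_X p k hp =>
    have hX : MvPolynomial.pderiv j (substMatrix M (MvPolynomial.X k)) =
        MvPolynomial.C (M k j) := by
      rw [substMatrix_X, map_sum, Finset.sum_eq_single j]
      · simp
      · intro l _ hl
        simp [MvPolynomial.pderiv_X_of_ne hl]
      · simp
    rw [map_mul, Derivation.leibniz, hX, hp]
    have hk : ∀ i : Fin d, MvPolynomial.C (M i j) * substMatrix M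
        (MvPolynomial.pderiv i (p * MvPolynomial.X k)) =
        substMatrix M p * (if i = k then MvPolynomial.C (M k j) else 0) +
        substMatrix M (MvPolynomial.X k) *
          (MvPolynomial.C (M i j) * substMatrix M (MvPolynomial.pderiv i p)) := by
      intro i
      rw [Derivation.leibniz]
      by_cases h : i = k
      · subst h
        simp only [smul_eq_mul, MvPolynomial.pderiv_X_self, if_true, map_add, map_mul, map_one]
        ring
      · rw [MvPolynomial.pderiv_X_of_ne (Ne.symm h)]
        simp only [smul_eq_mul, h, if_false, map_add, map_mul, map_zero]
        ring
    simp only [hk, Finset.sum_add_distrib, ← Finset.mul_sum, smul_eq_mul]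
    simp

lemma laplacian_apply {d : ℕ} (p : MvPolynomial (Fin d) ℂ) :
    laplacian d p = ∑ j, MvPolynomial.pderiv j (MvPolynomial.pderiv j p) := by
  simp [laplacian]

lemma laplacian_substMatrix {d : ℕ} (M : Matrix (Fin d) (Fin d) ℂ) (hM : M * M.transpose = 1)
    (p : MvPolynomial (Fin d) ℂ) :
    laplacian d (substMatrix M p) = substMatrix M (laplacian d p) := by
  have hM' : ∀ i k : Fin d, ∑ j, M i j * M k j = if i = k then 1 else 0 := by
    intro i k
    have := congrFun (congrFun hM i) k
    simpa [Matrix.mul_apply, Matrix.one_apply] using this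
  have h1 : ∀ j : Fin d, MvPolynomial.pderiv j (MvPolynomial.pderiv j (substMatrix M p)) =
      ∑ i, ∑ k, MvPolynomial.C (M i j * M k j) *
        substMatrix M (MvPolynomial.pderiv k (MvPolynomial.pderiv i p)) := by
    intro j
    rw [pderiv_substMatrix, map_sum]
    refine Finset.sum_congr rfl fun i _ => ?_
    rw [MvPolynomial.pderiv_C_mul, pderiv_substMatrix, Finset.mul_sum]
    simp only [map_mul, mul_assoc]
  rw [laplacian_apply, laplacian_apply, map_sum]
  simp only [h1]
  rw [Finset.sum_comm]
  refine Finset.sum_congr rfl fun i _ => ?_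
  rw [Finset.sum_comm, Finset.sum_eq_single i]
  · rw [← Finset.sum_mul, ← map_sum, hM']
    simp
  · intro k _ hk
    rw [← Finset.sum_mul, ← map_sum, hM', if_neg (Ne.symm hk)]
    simp
  · simp

/-- The natural representation of `SO(d)` on `H^r(ℂᵈ)`: `(A · p)(z) = p(A⁻¹ z)`. -/
def harmonicRep (d r : ℕ) : Representation ℂ (SO d) (harmonic d r) where
  toFun A := (substMatrix (SO.toComplex A⁻¹)).toLinearMap.restrict
    (p := harmonic d r) (q := harmonic d r) (fun p hp => by
      refine ⟨substMatrix_isHomogeneous _ hp.1, ?_⟩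
      have hl : laplacian d p = 0 := hp.2
      change laplacian d (substMatrix _ p) = 0
      rw [laplacian_substMatrix _ (SO.toComplex_mul_transpose _), hl, map_zero])
  map_one' := by
    refine LinearMap.ext fun p => Subtype.ext ?_
    change substMatrix (SO.toComplex (1 : SO d)⁻¹) p.1 = p.1
    rw [inv_one, map_one, substMatrix_one]
  map_mul' A B := by
    refine LinearMap.ext fun p => Subtype.ext ?_
    change substMatrix (SO.toComplex (A * B)⁻¹) p.1 =
      substMatrix (SO.toComplex A⁻¹) (substMatrix (SO.toComplex B⁻¹) p.1)
    rw [substMatrix_substMatrix, mul_inv_rev, map_mul]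

/-- The one-dimensional representation `ℂ_m` of `SO(2)`, given by the character `t ↦ t⁻ᵐ`. -/
def charRep (m : ℕ) : Representation ℂ Circle ℂ where
  toFun t := ((t⁻¹ : Circle) : ℂ) ^ m • LinearMap.id
  map_one' := by
    refine LinearMap.ext fun z => ?_
    simp
  map_mul' s t := by
    refine LinearMap.ext fun z => ?_
    simp [mul_pow, mul_assoc]

/-- The outer tensor product `H^r(ℂᵈ) ⊗ ℂ_m`: a representation of `SO(d) × SO(2)`. -/
def harmonicTensorChar (d r m : ℕ) :
    Representation ℂ (SO d × Circle) (harmonic d r ⊗[ℂ] ℂ) :=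
  Representation.tprod ((harmonicRep d r).comp (MonoidHom.fst (SO d) Circle))
    ((charRep m).comp (MonoidHom.snd (SO d) Circle))

/-! ## Isotypic decompositions -/

/-- `k V`: the direct sum of `k` copies of a representation. -/
def copies {G W : Type*} [Group G] [AddCommMonoid W] [Module ℂ W] (k : ℕ)
    (σ : Representation ℂ G W) : Representation ℂ G (⨁ _ : Fin k, W) :=
  Representation.directSum (fun _ : Fin k => σ)

section Decomposition

variable {G E : Type*} [Group G] [NormedAddCommGroup E] [InnerProductSpace ℂ E]

/-- `E` is a Hilbert space and is the Hilbert direct sum of the closed subspaces `F j`. -/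
structure IsHilbertDirectSum {J : Type*} (F : J → Submodule ℂ E) : Prop where
  complete : CompleteSpace E
  closed : ∀ j, IsClosed (F j : Set E)
  orthogonal : OrthogonalFamily ℂ (fun j => F j) (fun j => (F j).subtypeₗᵢ)
  total : (⨆ j, F j).topologicalClosure = ⊤

/-- A closed invariant subspace is irreducible if it is non-zero and has no closed invariant
subspaces other than zero and itself. -/
structure IsIrreducibleSubspace (π : Representation ℂ G E) (V : Subrepresentation π) : Prop where
  closed : IsClosed (V : Set E)
  ne_bot : V ≠ ⊥
  eq_bot_or_eq : ∀ U : Subrepresentation π, IsClosed (U : Set E) → U ≤ V → U = ⊥ ∨ U = V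

/-- The isotypic component of type `σ`: the sum of all irreducible subspaces of `E` that are
isomorphic to `σ`. (It is applied to compact groups and unitary `π` only, whose irreducible
subspaces are finite-dimensional. Equivalent finite-dimensional irreducible unitary representations
are unitarily equivalent, so no norm enters into the notion of isomorphism.) -/
def component {W : Type*} [AddCommMonoid W] [Module ℂ W] (π : Representation ℂ G E)
    (σ : Representation ℂ G W) : Subrepresentation π where
  toSubmodule := ⨆ V ∈ {V : Subrepresentation π |
    IsIrreducibleSubspace π V ∧ Nonempty (V.toRepresentation.Equiv σ)}, V.toSubmodule
  apply_mem_toSubmodule g v hv := by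
    have h : (⨆ V ∈ {V : Subrepresentation π |
        IsIrreducibleSubspace π V ∧ Nonempty (V.toRepresentation.Equiv σ)}, V.toSubmodule) ≤
        Submodule.comap (π g) (⨆ V ∈ {V : Subrepresentation π |
          IsIrreducibleSubspace π V ∧ Nonempty (V.toRepresentation.Equiv σ)}, V.toSubmodule) :=
      iSup₂_le fun V hV w hw => Submodule.mem_comap.2
        ((le_iSup₂_of_le (f := fun (V : Subrepresentation π) (_ : V ∈ {V : Subrepresentation π |
          IsIrreducibleSubspace π V ∧ Nonempty (V.toRepresentation.Equiv σ)}) => V.toSubmodule)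
          V hV le_rfl) (V.apply_mem_toSubmodule g hw))
    exact h hv

/-- The isotypic decomposition of `π` is `E = ⨁ⱼ Eⱼ`, where the `σ j` are mutually non-isomorphic
irreducible (finite-dimensional) representations and `Eⱼ ≠ 0` is the isotypic component of
type `σ j`. -/
structure IsIsotypicDecomposition {J : Type*} {W : J → Type*} [∀ j, AddCommGroup (W j)]
    [∀ j, Module ℂ (W j)] (π : Representation ℂ G E) (σ : ∀ j, Representation ℂ G (W j)) :
    Prop where
  finiteDimensional : ∀ j, FiniteDimensional ℂ (W j)
  irreducible : ∀ j, (σ j).IsIrreducible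
  eq_of_equiv : ∀ j k, Nonempty ((σ j).Equiv (σ k)) → j = k
  component_ne_bot : ∀ j, component π (σ j) ≠ ⊥
  hilbertSum : IsHilbertDirectSum (fun j => (component π (σ j)).toSubmodule)

/-- `π` is isomorphic to the Hilbert direct sum of the finite-dimensional representations `σ j`:
`E` is the Hilbert direct sum of closed invariant subspaces, the `j`-th of which is isomorphic
to `σ j`. -/
def IsIsoHilbertSum {J : Type*} {W : J → Type*} [∀ j, AddCommMonoid (W j)]
    [∀ j, Module ℂ (W j)] (π : Representation ℂ G E) (σ : ∀ j, Representation ℂ G (W j)) : Prop :=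
  ∃ V : J → Subrepresentation π, IsHilbertDirectSum (fun j => (V j).toSubmodule) ∧
    ∀ j, Nonempty ((V j).toRepresentation.Equiv (σ j))

/-- `π` is multiplicity-free if every isotypic component is irreducible. -/
def IsMultiplicityFree (π : Representation ℂ G E) : Prop :=
  ∀ V : Subrepresentation π, IsIrreducibleSubspace π V →
    IsIrreducibleSubspace π (component π V.toRepresentation)

end Decomposition

/-- The index set of the pairs `(m, r)` with `0 ≤ r ≤ m`. -/
abbrev Index : Type := Σ m : ℕ, Fin (m + 1)

/-- The multiplicity `⌊m/2⌋ - ⌊(r + ⌊m+1⌋₂)/2⌋ + 1`, where `⌊m+1⌋₂` is the parity of `m + 1`.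
The difference is non-negative for `r ≤ m`. -/
def mult (m r : ℕ) : ℕ := m / 2 - (r + (m + 1) % 2) / 2 + 1

lemma mult_cast {m r : ℕ} (h : r ≤ m) :
    (mult m r : ℤ) = ((m / 2 : ℕ) : ℤ) - (((r + (m + 1) % 2) / 2 : ℕ) : ℤ) + 1 := by
  unfold mult; omega

end

end CartanIV

namespace CartanIV

noncomputable section

/-! ## Unitary representations and isotypic decompositions -/

section Abstract

variable {G : Type*} [Group G]

/-! Put `d = n - 1` and `Q = z_1² + ⋯ + z_d²`. The domain is balanced, so a holomorphic function on
it expands along complex lines through the origin into homogeneous polynomials. Since the measure is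
finite and circle invariant, this makes the polynomials dense in the Bergman space. It therefore
suffices to decompose the polynomials under `SO(d) × SO(2)`.

Every polynomial in `d` variables is a sum of terms `Q^j h` with `h` harmonic. The corner `SO(d)`
fixes both `Q` and the last variable, so `h ↦ z_{d+1}^a Q^j h` is an `SO(d)`-map on which the circle
acts with weight `m = a + 2j + r`, where `r` is the degree of `h`. For given `(m, r)` there is one
such embedding for each `j` with `2j ≤ m - r`. This gives `⌊(m - r)/2⌋ + 1` copies, which is the
stated multiplicity (`mult_eq`). Different `j` use different powers of the last variable, so the
embeddings are jointly injective.

The general part is `isotypic_of_intertwiningMaps`: by Schur's lemma inequivalent irreducible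
subspaces of a unitary representation are orthogonal, hence jointly injective maps from inequivalent
irreducibles with dense total range determine the isotypic components.

Irreducibility and inequivalence of the harmonic spaces come from zonal vectors. A harmonic
polynomial fixed by the stabilizer of a point of the sphere is unique up to scalars
(`exists_smul_eq_of_fixed`), while every non-zero invariant subspace contains a non-zero one, namely
the vector representing evaluation at the point. The invariant inner product needed here is pulled
back from the Bergman space.

The analytic part consists of the finiteness of the measure for `lam > n - 1`
(`lintegral_jordanDelta_lt_top`), completeness (`isClosed_bergman`) and density
(`eq_zero_of_inner_polyToBergman`). -/

lemma isIrreducible_iff {W : Type*} [AddCommGroup W] [Module ℂ W] (σ : Representation ℂ G W) :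
    σ.IsIrreducible ↔ Nontrivial W ∧ ∀ p : Submodule ℂ W, (∀ g, ∀ x ∈ p, σ g x ∈ p) →
      p = ⊥ ∨ p = ⊤ := by
  constructor
  · intro h
    refine ⟨?_, fun p hp => ?_⟩
    · by_contra hW
      rw [not_nontrivial_iff_subsingleton] at hW
      exact (bot_ne_top (α := Subrepresentation σ))
        (Subrepresentation.toSubmodule_injective (Subsingleton.elim _ _))
    · rcases h.eq_bot_or_eq_top ⟨p, hp⟩ with h1 | h1
      · exact Or.inl (congrArg Subrepresentation.toSubmodule h1)
      · exact Or.inr (congrArg Subrepresentation.toSubmodule h1)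
  · rintro ⟨hW, h⟩
    refine { exists_pair_ne := ⟨⊥, ⊤, fun h1 => ?_⟩, eq_bot_or_eq_top := fun p => ?_ }
    · exact (bot_ne_top (α := Submodule ℂ W)) (congrArg Subrepresentation.toSubmodule h1)
    · rcases h p.toSubmodule (fun g x hx => p.apply_mem_toSubmodule g hx) with h1 | h1
      · exact Or.inl (Subrepresentation.toSubmodule_injective h1)
      · exact Or.inr (Subrepresentation.toSubmodule_injective h1)

lemma isIrreducible_of_equiv {W W' : Type*} [AddCommGroup W] [Module ℂ W] [AddCommGroup W']
    [Module ℂ W'] {σ : Representation ℂ G W} {τ : Representation ℂ G W'} (e : σ.Equiv τ)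
    (h : σ.IsIrreducible) : τ.IsIrreducible := by
  rw [isIrreducible_iff] at h ⊢
  obtain ⟨hW, h⟩ := h
  refine ⟨e.toLinearEquiv.symm.toEquiv.nontrivial, fun p hp => ?_⟩
  set L : W ≃ₗ[ℂ] W' := e.toLinearEquiv with hL
  have hint : ∀ g x, L (σ g x) = τ g (L x) := fun g x =>
    LinearMap.congr_fun (e.toIntertwiningMap.isIntertwining' g) x
  clear_value L
  have h1 := h (p.comap (L : W →ₗ[ℂ] W')) (fun g x hx => by
    have h2 := hp g _ hx
    rw [Submodule.mem_comap]
    exact (hint g x).symm ▸ h2)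
  rcases h1 with h1 | h1
  · left
    rw [Submodule.eq_bot_iff] at h1 ⊢
    intro y hy
    simpa using h1 (L.symm y) (by simpa using hy)
  · right
    rw [Submodule.eq_top_iff'] at h1 ⊢
    intro y
    simpa using h1 (L.symm y)

/-- An injective intertwining map is an equivalence onto its range. -/
def equivRange {W W' : Type*} [AddCommGroup W] [Module ℂ W] [AddCommGroup W'] [Module ℂ W']
    {σ : Representation ℂ G W} {τ : Representation ℂ G W'} (f : σ.IntertwiningMap τ)
    (hf : Function.Injective f) : σ.Equiv f.range.toRepresentation :=
  Representation.Equiv.mk (LinearEquiv.ofInjective f.toLinearMap hf) (fun g => by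
    refine LinearMap.ext fun x => Subtype.ext ?_
    exact LinearMap.congr_fun (f.isIntertwining' g) x)

variable {E : Type*} [NormedAddCommGroup E] [InnerProductSpace ℂ E]

local notation "⟪" x ", " y "⟫" => inner ℂ x y

/-- Unitarity makes the orthogonal projection onto `W` equivariant. Its restriction to `U` is then
an intertwining map between irreducibles, which by Schur's lemma is bijective or zero. -/
lemma isOrtho_of_inequivalent {π : Representation ℂ G E}
    (hπ : ∀ g x y, ⟪π g x, π g y⟫ = ⟪x, y⟫) (U W : Subrepresentation π)
    [FiniteDimensional ℂ W.toSubmodule]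
    (hU : U.toRepresentation.IsIrreducible) (hW : W.toRepresentation.IsIrreducible)
    (h : ¬ Nonempty (U.toRepresentation.Equiv W.toRepresentation)) :
    U.toSubmodule ⟂ W.toSubmodule := by
  have key : ∀ g x, (W.toSubmodule.orthogonalProjectionOnto (π g x) : E) =
      π g (W.toSubmodule.orthogonalProjectionOnto x) := by
    intro g x
    refine Submodule.eq_starProjection_of_mem_of_inner_eq_zero
      (W.apply_mem_toSubmodule g (Submodule.coe_mem _)) fun w hw => ?_
    have h1 := Submodule.starProjection_inner_eq_zero (K := W.toSubmodule) x (π g⁻¹ w)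
      (W.apply_mem_toSubmodule _ hw)
    rw [← hπ g] at h1
    have h2 : π g (π g⁻¹ w) = w := by
      rw [← Module.End.mul_apply, ← map_mul, mul_inv_cancel, map_one, Module.End.one_apply]
    rw [h2, map_sub] at h1
    exact h1
  let f : U.toRepresentation.IntertwiningMap W.toRepresentation :=
    { toLinearMap := W.toSubmodule.orthogonalProjectionOnto.toLinearMap ∘ₗ U.toSubmodule.subtype
      isIntertwining' := fun g => LinearMap.ext fun x => Subtype.ext (key g x) }
  rcases Representation.IsIrreducible.bijective_or_eq_zero f with hb | hz
  · exact (h ⟨f.ofBijective hb⟩).elim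
  · rw [Submodule.isOrtho_iff_inner_eq]
    intro u hu w hw
    have h1 : (W.toSubmodule.orthogonalProjectionOnto u : E) = 0 := by
      have := congrArg (fun F : U.toRepresentation.IntertwiningMap W.toRepresentation =>
        ((F ⟨u, hu⟩ : W.toSubmodule) : E)) hz
      exact this
    have h2 := Submodule.starProjection_inner_eq_zero (K := W.toSubmodule) u w hw
    rw [Submodule.starProjection_apply, h1, sub_zero] at h2
    exact h2

/-- Algebraic irreducibility excludes all proper invariant subspaces, in particular the closed ones.
Finite dimension serves to make `V` itself closed. -/
lemma isIrreducibleSubspace_of_isIrreducible {π : Representation ℂ G E}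
    (V : Subrepresentation π) [FiniteDimensional ℂ V.toSubmodule]
    (h : V.toRepresentation.IsIrreducible) : IsIrreducibleSubspace π V := by
  rw [isIrreducible_iff] at h
  obtain ⟨hV, h⟩ := h
  refine ⟨Submodule.closed_of_finiteDimensional V.toSubmodule, ?_, fun U _ hUV => ?_⟩
  · rintro rfl
    exact not_subsingleton (⊥ : Submodule ℂ E) inferInstance
  · rcases h (U.toSubmodule.comap V.toSubmodule.subtype)
      (fun g x hx => U.apply_mem_toSubmodule g hx) with h1 | h1
    · left
      refine Subrepresentation.toSubmodule_injective ?_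
      rw [Submodule.eq_bot_iff] at h1
      refine (Submodule.eq_bot_iff _).2 fun x hx => ?_
      exact congrArg Subtype.val (h1 ⟨x, hUV hx⟩ hx)
    · right
      refine le_antisymm hUV fun x hx => ?_
      rw [Submodule.eq_top_iff'] at h1
      exact h1 ⟨x, hx⟩

lemma component_congr {W W' : Type*} [AddCommMonoid W] [Module ℂ W] [AddCommMonoid W']
    [Module ℂ W'] (π : Representation ℂ G E) {σ : Representation ℂ G W}
    {τ : Representation ℂ G W'} (e : σ.Equiv τ) : component π σ = component π τ := by
  have h : {V : Subrepresentation π |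
      IsIrreducibleSubspace π V ∧ Nonempty (V.toRepresentation.Equiv σ)} =
      {V : Subrepresentation π |
      IsIrreducibleSubspace π V ∧ Nonempty (V.toRepresentation.Equiv τ)} := by
    ext V
    exact and_congr_right fun _ => ⟨fun ⟨f⟩ => ⟨f.trans e⟩, fun ⟨f⟩ => ⟨f.trans e.symm⟩⟩
  refine Subrepresentation.toSubmodule_injective ?_
  unfold component
  simp only [h]

/-- In an orthogonal family with dense span, a vector that is orthogonal to all members but one
lies in that one. -/
lemma mem_of_forall_isOrtho {J : Type*} (V : J → Submodule ℂ E) (j : J)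
    [(V j).HasOrthogonalProjection]
    (hV : ∀ i k, i ≠ k → V i ⟂ V k) (hd : (⨆ i, V i).topologicalClosure = ⊤) {x : E}
    (hx : ∀ i, i ≠ j → ∀ y ∈ V i, ⟪x, y⟫ = 0) : x ∈ V j := by
  set p := (V j).starProjection x with hp
  have hpm : p ∈ V j := Submodule.starProjection_apply_mem _ _
  have h1 : ∀ i, ∀ y ∈ V i, ⟪x - p, y⟫ = 0 := by
    intro i y hy
    by_cases hij : i = j
    · subst hij
      exact Submodule.starProjection_inner_eq_zero _ _ hy
    · rw [inner_sub_left, hx i hij y hy, (Submodule.isOrtho_iff_inner_eq.1 (hV j i (Ne.symm hij)))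
        p hpm y hy, sub_zero]
  have h2 : x - p ∈ (⨆ i, V i)ᗮ := by
    rw [Submodule.mem_orthogonal']
    intro u hu
    induction hu using Submodule.iSup_induction' with
    | mem i y hy => exact h1 i y hy
    | zero => exact inner_zero_right _
    | add y z _ _ hy hz => rw [inner_add_right, hy, hz, add_zero]
  rw [← Submodule.orthogonal_closure, hd, Submodule.top_orthogonal_eq_bot, Submodule.mem_bot,
    sub_eq_zero] at h2
  exact h2 ▸ hpm

section Copies

variable {W : Type*} [AddCommGroup W] [Module ℂ W] {σ : Representation ℂ G W}
  {π : Representation ℂ G E}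

/-- The sum of intertwining maps, defined on a direct sum of copies. -/
def copiesMap {k : ℕ} (T : Fin k → σ.IntertwiningMap π) : (copies k σ).IntertwiningMap π where
  toLinearMap := DirectSum.toModule ℂ (Fin k) E fun i => (T i).toLinearMap
  isIntertwining' g := by
    refine DirectSum.linearMap_ext ℂ fun i => LinearMap.ext fun x => ?_
    simp only [LinearMap.comp_apply, DirectSum.toModule_lof]
    have : copies k σ g (DirectSum.lof ℂ (Fin k) (fun _ => W) i x) =
        DirectSum.lof ℂ (Fin k) (fun _ => W) i (σ g x) := by
      exact DirectSum.lmap_lof _ _ _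
    rw [this, DirectSum.toModule_lof]
    exact LinearMap.congr_fun ((T i).isIntertwining' g) x

lemma copiesMap_apply {k : ℕ} (T : Fin k → σ.IntertwiningMap π) (x : ⨁ _ : Fin k, W) :
    copiesMap T x = ∑ i, T i (x i) := by
  induction x using DirectSum.induction_on with
  | zero => simp
  | of i w =>
    rw [Finset.sum_eq_single i]
    · rw [DirectSum.of_eq_same]
      exact DirectSum.toModule_lof (M := fun _ : Fin k => W) ℂ i w
    · intro j _ hj
      rw [DirectSum.of_eq_of_ne _ _ _ hj, map_zero]
    · simp
  | add x y hx hy => simp [hx, hy, Finset.sum_add_distrib]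

lemma copiesMap_injective {k : ℕ} {T : Fin k → σ.IntertwiningMap π}
    (hT : ∀ w : Fin k → W, ∑ i, T i (w i) = 0 → w = 0) : Function.Injective (copiesMap T) := by
  rw [injective_iff_map_eq_zero]
  intro x hx
  rw [copiesMap_apply] at hx
  refine DFinsupp.ext fun i => ?_
  exact congrFun (hT (fun i => x i) hx) i

lemma copiesMap_range {k : ℕ} (T : Fin k → σ.IntertwiningMap π) :
    (copiesMap T).range.toSubmodule = ⨆ i, (T i).range.toSubmodule := by
  refine le_antisymm ?_ (iSup_le fun i => ?_)
  · rintro _ ⟨x, rfl⟩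
    change copiesMap T x ∈ _
    rw [copiesMap_apply]
    exact Submodule.sum_mem _ fun i _ => Submodule.mem_iSup_of_mem i ⟨x i, rfl⟩
  · rintro _ ⟨w, rfl⟩
    exact ⟨DirectSum.lof ℂ (Fin k) (fun _ => W) i w,
      DirectSum.toModule_lof (M := fun _ : Fin k => W) ℂ i w⟩

end Copies

section Main

variable [CompleteSpace E] {J : Type*} {W : J → Type*} [∀ j, AddCommGroup (W j)]
  [∀ j, Module ℂ (W j)] [∀ j, FiniteDimensional ℂ (W j)]

/-- Recognition of the isotypic decomposition of a unitary representation: given jointly injective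
intertwining maps from irreducible, mutually inequivalent finite-dimensional representations whose
ranges span a dense subspace, the isotypic components are the sums of the ranges. -/
theorem isotypic_of_intertwiningMaps (π : Representation ℂ G E)
    (hπ : ∀ g x y, ⟪π g x, π g y⟫ = ⟪x, y⟫) (σ : ∀ j, Representation ℂ G (W j))
    (hσ : ∀ j, (σ j).IsIrreducible) (hne : ∀ j k, Nonempty ((σ j).Equiv (σ k)) → j = k)
    (κ : J → ℕ) (hκ : ∀ j, 0 < κ j) (T : ∀ j, Fin (κ j) → (σ j).IntertwiningMap π)
    (hT : ∀ j, ∀ w : Fin (κ j) → W j, ∑ i, T j i (w i) = 0 → w = 0)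
    (hd : (⨆ j, ⨆ i, (T j i).range.toSubmodule).topologicalClosure = ⊤) :
    IsIsotypicDecomposition π σ ∧
    (∀ j, Nonempty ((component π (σ j)).toRepresentation.Equiv (copies (κ j) (σ j)))) ∧
    IsIsoHilbertSum π (fun j => copies (κ j) (σ j)) ∧
    ((∃ j, 2 ≤ κ j) → ¬ IsMultiplicityFree π) := by
  classical
  have hinj : ∀ j i, Function.Injective (T j i) := by
    intro j i
    rw [injective_iff_map_eq_zero]
    intro x hx
    have := hT j (Pi.single i x) (by
      rw [Finset.sum_eq_single i]
      · simpa using hx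
      · intro k _ hk
        rw [Pi.single_eq_of_ne hk, map_zero]
      · simp)
    simpa using congrFun this i
  have hirr : ∀ j i, (T j i).range.toRepresentation.IsIrreducible := fun j i =>
    isIrreducible_of_equiv (equivRange _ (hinj j i)) (hσ j)
  have hfd : ∀ j i, FiniteDimensional ℂ (T j i).range.toSubmodule := fun j i =>
    LinearMap.finiteDimensional_range (T j i).toLinearMap
  have hsub : ∀ j i, IsIrreducibleSubspace π (T j i).range := fun j i =>
    isIrreducibleSubspace_of_isIrreducible _ (hirr j i)
  have horth : ∀ j (U : Subrepresentation π), Nonempty (U.toRepresentation.Equiv (σ j)) →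
      ∀ k i, k ≠ j → U.toSubmodule ⟂ (T k i).range.toSubmodule := by
    rintro j U ⟨e⟩ k i hk
    refine isOrtho_of_inequivalent hπ _ _ (isIrreducible_of_equiv e.symm (hσ j)) (hirr k i) ?_
    rintro ⟨f⟩
    exact hk (hne j k ⟨(e.symm.trans f).trans (equivRange _ (hinj k i)).symm⟩).symm
  set V : J → Submodule ℂ E := fun j => ⨆ i, (T j i).range.toSubmodule with hV
  have hVfd : ∀ j, FiniteDimensional ℂ (V j) := fun j => by
    rw [hV]; infer_instance
  have hVorth : ∀ j k, j ≠ k → V j ⟂ V k := by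
    intro j k hjk
    simp only [hV, Submodule.isOrtho_iSup_left, Submodule.isOrtho_iSup_right]
    exact fun i l => horth j _ ⟨(equivRange _ (hinj j l)).symm⟩ k i (Ne.symm hjk)
  -- An irreducible subspace of type `σ j` is orthogonal to every `V k` with `k ≠ j`. Density of the
  -- total span then confines it to `V j`, although it need not be one of the ranges.
  have hcomp : ∀ j, (component π (σ j)).toSubmodule = V j := by
    intro j
    refine le_antisymm (iSup₂_le fun U hU x hx => ?_) (iSup_le fun i => ?_)
    · refine mem_of_forall_isOrtho V j hVorth hd fun k hk y hy => ?_
      have : U.toSubmodule ⟂ V k := by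
        simp only [hV, Submodule.isOrtho_iSup_right]
        exact fun i => horth j U hU.2 k i hk
      exact Submodule.isOrtho_iff_inner_eq.1 this x hx y hy
    · exact le_iSup₂_of_le (f := fun (U : Subrepresentation π) (_ : U ∈ {U : Subrepresentation π |
        IsIrreducibleSubspace π U ∧ Nonempty (U.toRepresentation.Equiv (σ j))}) => U.toSubmodule)
        (T j i).range ⟨hsub j i, ⟨(equivRange _ (hinj j i)).symm⟩⟩ le_rfl
  have hcopies : ∀ j,
      Nonempty ((component π (σ j)).toRepresentation.Equiv (copies (κ j) (σ j))) := by
    intro j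
    have h : component π (σ j) = (copiesMap (T j)).range :=
      Subrepresentation.toSubmodule_injective ((hcomp j).trans (copiesMap_range (T j)).symm)
    rw [h]
    exact ⟨(equivRange _ (copiesMap_injective (hT j))).symm⟩
  have hsum : IsHilbertDirectSum (fun j => (component π (σ j)).toSubmodule) := by
    simp only [hcomp]
    exact ⟨inferInstance, fun j => (V j).closed_of_finiteDimensional,
      OrthogonalFamily.of_pairwise fun j k hjk => hVorth j k hjk, hd⟩
  have hbot : ∀ j i, (T j i).range ≠ ⊥ := fun j i => (hsub j i).ne_bot
  have hle : ∀ j i, (T j i).range ≤ component π (σ j) := by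
    intro j i
    change (T j i).range.toSubmodule ≤ (component π (σ j)).toSubmodule
    rw [hcomp]
    exact le_iSup (fun i => (T j i).range.toSubmodule) i
  refine ⟨⟨fun j => inferInstance, hσ, hne, fun j hj => ?_, hsum⟩, hcopies,
    ⟨_, hsum, hcopies⟩, ?_⟩
  · exact hbot j ⟨0, hκ j⟩ (le_bot_iff.1 (hj ▸ hle j ⟨0, hκ j⟩))
  · rintro ⟨j, hj⟩ hfree
    let i0 : Fin (κ j) := ⟨0, hκ j⟩
    let i1 : Fin (κ j) := ⟨1, hj⟩
    have h1 := hfree _ (hsub j i0)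
    rw [component_congr π (equivRange _ (hinj j i0)).symm] at h1
    -- If the component were irreducible it would equal the range of the first embedding. The second
    -- embedding would take its values there too, against joint injectivity.
    rcases h1.eq_bot_or_eq _ (hsub j i0).closed (hle j i0) with h2 | h2
    · exact hbot j i0 h2
    · obtain ⟨hnt, -⟩ := (isIrreducible_iff _).1 (hσ j)
      obtain ⟨x, hx⟩ := exists_ne (0 : W j)
      have h3 : T j i1 x ∈ (T j i0).range := h2 ▸ hle j i1 ⟨x, rfl⟩
      obtain ⟨y, hy⟩ := h3
      have hy' : T j i0 y = T j i1 x := hy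
      have h01 : i0 ≠ i1 := by simp [i0, i1]
      have := hT j (Pi.single i1 x - Pi.single i0 y) (by
        simp only [Pi.sub_apply, map_sub, Finset.sum_sub_distrib]
        rw [Finset.sum_eq_single i1, Finset.sum_eq_single i0]
        · simp [hy']
        · intro k _ hk
          rw [Pi.single_eq_of_ne hk, map_zero]
        · simp
        · intro k _ hk
          rw [Pi.single_eq_of_ne hk, map_zero]
        · simp)
      have h4 := congrFun this i1
      rw [Pi.sub_apply, Pi.single_eq_same, Pi.single_eq_of_ne (Ne.symm h01), sub_zero] at h4
      exact hx h4

end Main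

end Abstract

/-! ## The decomposition of polynomials into harmonic polynomials -/

open MvPolynomial in
/-- The quadratic form `∑ⱼ zⱼ²` as a polynomial. -/
def quadPoly (d : ℕ) : MvPolynomial (Fin d) ℂ := ∑ j, X j ^ 2

lemma eval_quadPoly {d : ℕ} (z : Fin d → ℂ) : MvPolynomial.eval z (quadPoly d) = quad z := by
  simp [quadPoly, quad]

lemma quadPoly_isHomogeneous (d : ℕ) : (quadPoly d).IsHomogeneous 2 :=
  MvPolynomial.IsHomogeneous.sum _ _ _ fun j _ => by
    simpa using (MvPolynomial.isHomogeneous_X ℂ j).pow 2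

lemma quadPoly_ne_zero {d : ℕ} (hd : 0 < d) : quadPoly d ≠ 0 := by
  intro h
  have h1 := eval_quadPoly (d := d) (Pi.single ⟨0, hd⟩ 1)
  rw [h, map_zero, quad, Finset.sum_eq_single ⟨0, hd⟩] at h1
  · simp at h1
  · intro j _ hj
    rw [Pi.single_eq_of_ne hj]
    simp
  · simp

lemma pderiv_quadPoly {d : ℕ} (j : Fin d) :
    MvPolynomial.pderiv j (quadPoly d) = 2 * MvPolynomial.X j := by
  rw [quadPoly, map_sum, Finset.sum_eq_single j]
  · rw [Derivation.leibniz_pow]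
    simp
  · intro i _ hi
    rw [Derivation.leibniz_pow, MvPolynomial.pderiv_X_of_ne hi]
    simp
  · simp

/-- The mixed terms of the Leibniz rule are `4 X_j ∂_j p`, and Euler's identity sums them to `4 r
p`. -/
lemma laplacian_quadPoly_mul {d r : ℕ} {p : MvPolynomial (Fin d) ℂ} (hp : p.IsHomogeneous r) :
    laplacian d (quadPoly d * p) =
      ((2 * d + 4 * r : ℕ) : ℂ) • p + quadPoly d * laplacian d p := by
  have h1 : ∀ j : Fin d, MvPolynomial.pderiv j (MvPolynomial.pderiv j (quadPoly d * p)) =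
      2 * p + 4 * (MvPolynomial.X j * MvPolynomial.pderiv j p) +
        quadPoly d * MvPolynomial.pderiv j (MvPolynomial.pderiv j p) := by
    intro j
    have h2 : MvPolynomial.pderiv j (2 : MvPolynomial (Fin d) ℂ) = 0 := by
      have := (MvPolynomial.pderiv j).map_natCast (R := ℂ) (A := MvPolynomial (Fin d) ℂ) 2
      exact_mod_cast this
    simp only [Derivation.leibniz, pderiv_quadPoly, smul_eq_mul, map_add,
      MvPolynomial.pderiv_X_self, h2]
    ring
  rw [laplacian_apply, laplacian_apply]
  simp only [h1, Finset.sum_add_distrib, ← Finset.mul_sum, hp.sum_X_mul_pderiv]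
  rw [Nat.cast_smul_eq_nsmul]
  simp only [Finset.sum_const, Finset.card_univ, Fintype.card_fin, nsmul_eq_mul]
  push_cast
  ring

/-- Each further factor of the quadratic form adds a positive integer to the constant. That the
constant never vanishes is what allows the Laplacian to be inverted on products `Q^j h`. -/
lemma laplacian_quadPoly_pow_mul {d r : ℕ} (hd : 0 < d) {h : MvPolynomial (Fin d) ℂ}
    (hh : h ∈ harmonic d r) (j : ℕ) :
    ∃ c : ℕ, 0 < c ∧ laplacian d (quadPoly d ^ (j + 1) * h) = (c : ℂ) • (quadPoly d ^ j * h) := by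
  have hhom : ∀ j, (quadPoly d ^ j * h).IsHomogeneous (2 * j + r) := fun j =>
    ((quadPoly_isHomogeneous d).pow j).mul hh.1
  have hl : laplacian d h = 0 := hh.2
  induction j with
  | zero =>
    refine ⟨2 * d + 4 * r, by omega, ?_⟩
    rw [zero_add, pow_one, laplacian_quadPoly_mul hh.1, hl]
    simp
  | succ j ih =>
    obtain ⟨c, hc, h1⟩ := ih
    refine ⟨2 * d + 4 * (2 * (j + 1) + r) + c, by omega, ?_⟩
    rw [pow_succ' _ (j + 1), mul_assoc, laplacian_quadPoly_mul (hhom (j + 1)), h1,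
      mul_smul_comm, pow_succ', mul_assoc, ← add_smul, ← Nat.cast_add]

lemma laplacian_isHomogeneous {d k : ℕ} {p : MvPolynomial (Fin d) ℂ} (hp : p.IsHomogeneous k) :
    (laplacian d p).IsHomogeneous (k - 2) := by
  rw [laplacian_apply]
  exact MvPolynomial.IsHomogeneous.sum _ _ _ fun j _ => hp.pderiv.pderiv

lemma laplacian_eq_zero_of_lt_two {d k : ℕ} (hk : k < 2) {p : MvPolynomial (Fin d) ℂ}
    (hp : p.IsHomogeneous k) : laplacian d p = 0 := by
  rw [laplacian_apply]
  refine Finset.sum_eq_zero fun j _ => ?_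
  have h1 : (MvPolynomial.pderiv j p).IsHomogeneous 0 := by
    have := hp.pderiv (i := j)
    rwa [show k - 1 = 0 by omega] at this
  rw [← MvPolynomial.totalDegree_zero_iff_isHomogeneous,
    MvPolynomial.totalDegree_eq_zero_iff_eq_C] at h1
  rw [h1, MvPolynomial.pderiv_C]

/-- Every homogeneous polynomial is a combination of products of powers of the quadratic form and
harmonic polynomials. -/
theorem exists_harmonic_decomposition {d : ℕ} (hd : 0 < d) (k : ℕ) :
    ∀ p : MvPolynomial (Fin d) ℂ, p.IsHomogeneous k →
      ∃ h : ℕ → MvPolynomial (Fin d) ℂ, (∀ j, 2 * j ≤ k → h j ∈ harmonic d (k - 2 * j)) ∧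
        p = ∑ j ∈ Finset.range (k / 2 + 1), quadPoly d ^ j * h j := by
  induction k using Nat.strong_induction_on with
  | _ k ih =>
    intro p hp
    by_cases hk : k < 2
    · refine ⟨fun _ => p, fun j hj => ?_, ?_⟩
      · obtain rfl : j = 0 := by omega
        exact ⟨hp, laplacian_eq_zero_of_lt_two hk hp⟩
      · rw [show k / 2 + 1 = 1 by omega]
        simp
    · obtain ⟨h, hh, hs⟩ := ih (k - 2) (by omega) _ (laplacian_isHomogeneous hp)
      -- Outside the range of summation the value 1 is a filler, so that `c` is a total, nowhere
      -- vanishing function.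
      have hc : ∀ j, ∃ c : ℂ, c ≠ 0 ∧ (2 * j ≤ k - 2 →
          laplacian d (quadPoly d ^ (j + 1) * h j) = c • (quadPoly d ^ j * h j)) := by
        intro j
        by_cases hj : 2 * j ≤ k - 2
        · obtain ⟨c, hc, h1⟩ := laplacian_quadPoly_pow_mul hd (hh j hj) j
          exact ⟨c, by exact_mod_cast hc.ne', fun _ => h1⟩
        · exact ⟨1, one_ne_zero, fun h => absurd h hj⟩
      choose c hc0 hc using hc
      -- The induction hypothesis decomposes the Laplacian of `p`. Raising the power of the
      -- quadratic form by one and dividing by `c j` gives a preimage `s` under the Laplacian, so `p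
      -- - s` is harmonic.
      set s := ∑ j ∈ Finset.range ((k - 2) / 2 + 1),
        quadPoly d ^ (j + 1) * ((c j)⁻¹ • h j) with hsdef
      have hmem : ∀ j, 2 * j ≤ k - 2 → (c j)⁻¹ • h j ∈ harmonic d (k - 2 - 2 * j) := fun j hj =>
        Submodule.smul_mem _ _ (hh j hj)
      have hshom : s.IsHomogeneous k := by
        refine MvPolynomial.IsHomogeneous.sum _ _ _ fun j hj => ?_
        have hj' : 2 * j ≤ k - 2 := by
          have := Finset.mem_range.1 hj
          omega
        have := ((quadPoly_isHomogeneous d).pow (j + 1)).mul (hmem j hj').1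
        rwa [show 2 * (j + 1) + (k - 2 - 2 * j) = k by omega] at this
      have hls : laplacian d s = laplacian d p := by
        rw [hs, hsdef, map_sum]
        refine Finset.sum_congr rfl fun j hj => ?_
        have hj' : 2 * j ≤ k - 2 := by
          have := Finset.mem_range.1 hj
          omega
        rw [mul_smul_comm, map_smul, hc j hj', smul_smul, inv_mul_cancel₀ (hc0 j), one_smul]
      -- The harmonic remainder takes index 0 and the terms of `s` move up by one.
      refine ⟨fun j => Nat.casesOn j (p - s) fun j => (c j)⁻¹ • h j, fun j hj => ?_, ?_⟩
      · cases j with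
        | zero =>
          refine ⟨hp.sub hshom, ?_⟩
          change laplacian d (p - s) = 0
          rw [map_sub, hls, sub_self]
        | succ j =>
          have := hmem j (by omega)
          rwa [show k - 2 - 2 * j = k - 2 * (j + 1) by omega] at this
      · rw [show k / 2 + 1 = ((k - 2) / 2 + 1) + 1 by omega, Finset.sum_range_succ']
        simp [hsdef]

/-- No non-zero multiple of the quadratic form is harmonic. -/
theorem eq_zero_of_laplacian_quadPoly_mul {d k : ℕ} (hd : 0 < d) {g : MvPolynomial (Fin d) ℂ}
    (hg : g.IsHomogeneous k) (h0 : laplacian d (quadPoly d * g) = 0) : g = 0 := by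
  let H := MvPolynomial.homogeneousSubmodule (Fin d) ℂ k
  have hfin : FiniteDimensional ℂ H :=
    Module.Finite.of_fg (MvPolynomial.homogeneousSubmodule_fg (σ := Fin d) (R := ℂ) k)
  -- The map `p ↦ Δ(Qp)` preserves the degree. The products `Q^j h` span the space and are
  -- eigenvectors with non-zero eigenvalues, so the map is surjective, hence injective by finite
  -- dimension.
  let L : H →ₗ[ℂ] H := ((laplacian d) ∘ₗ (LinearMap.mulLeft ℂ (quadPoly d))).restrict
    (fun p hp => by
      have := laplacian_isHomogeneous ((quadPoly_isHomogeneous d).mul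
        ((MvPolynomial.mem_homogeneousSubmodule _ _).1 hp))
      rw [show 2 + k - 2 = k by omega] at this
      exact this)
  have hsurj : Function.Surjective L := by
    rintro ⟨p, hp⟩
    obtain ⟨h, hh, hs⟩ := exists_harmonic_decomposition hd k p hp
    have hmem : ∀ j ∈ Finset.range (k / 2 + 1), ∃ x : H, ((L x : H) : MvPolynomial (Fin d) ℂ) =
        quadPoly d ^ j * h j := by
      intro j hj
      have hj' : 2 * j ≤ k := by
        have := Finset.mem_range.1 hj
        omega
      obtain ⟨c, hc, h1⟩ := laplacian_quadPoly_pow_mul hd (hh j hj') j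
      have hc' : (c : ℂ) ≠ 0 := by exact_mod_cast hc.ne'
      have hhom : (quadPoly d ^ j * h j).IsHomogeneous k := by
        have := ((quadPoly_isHomogeneous d).pow j).mul (hh j hj').1
        rwa [show 2 * j + (k - 2 * j) = k by omega] at this
      refine ⟨(c : ℂ)⁻¹ • ⟨_, hhom⟩, ?_⟩
      change laplacian d (quadPoly d * ((c : ℂ)⁻¹ • (quadPoly d ^ j * h j))) = _
      rw [mul_smul_comm, map_smul, ← mul_assoc, ← pow_succ', h1, smul_smul, inv_mul_cancel₀ hc',
        one_smul]
    choose! x hx using hmem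
    refine ⟨∑ j ∈ Finset.range (k / 2 + 1), x j, Subtype.ext ?_⟩
    rw [map_sum, AddSubmonoidClass.coe_finsetSum, Finset.sum_congr rfl hx]
    exact hs.symm
  have hinj := LinearMap.injective_iff_surjective.2 hsurj
  have := hinj (a₁ := ⟨g, hg⟩) (a₂ := 0) (by
    rw [map_zero]
    exact Subtype.ext h0)
  exact congrArg Subtype.val this

instance finiteDimensional_harmonic (d r : ℕ) : FiniteDimensional ℂ (harmonic d r) := by
  have hfin : FiniteDimensional ℂ (MvPolynomial.homogeneousSubmodule (Fin d) ℂ r) :=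
    Module.Finite.of_fg (MvPolynomial.homogeneousSubmodule_fg (σ := Fin d) (R := ℂ) r)
  exact Submodule.finiteDimensional_of_le (inf_le_left :
    harmonic d r ≤ MvPolynomial.homogeneousSubmodule (Fin d) ℂ r)

/-! ## Evaluation of polynomials and the action of rotations -/

lemma eval_substMatrix {d : ℕ} (M : Matrix (Fin d) (Fin d) ℂ) (p : MvPolynomial (Fin d) ℂ)
    (z : Fin d → ℂ) :
    MvPolynomial.eval z (substMatrix M p) = MvPolynomial.eval (M.mulVec z) p := by
  induction p using MvPolynomial.induction_on with
  | C c => simp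
  | add p q hp hq => simp [hp, hq]
  | mul_X p k hp => simp [hp, substMatrix_X, Matrix.mulVec, dotProduct]

lemma eval_smul_of_isHomogeneous {d r : ℕ} {p : MvPolynomial (Fin d) ℂ} (hp : p.IsHomogeneous r)
    (t : ℂ) (z : Fin d → ℂ) :
    MvPolynomial.eval (t • z) p = t ^ r * MvPolynomial.eval z p := by
  rw [MvPolynomial.eval_eq', MvPolynomial.eval_eq', Finset.mul_sum]
  refine Finset.sum_congr rfl fun m hm => ?_
  have h1 : ∑ i, m i = r := by
    have := hp (MvPolynomial.mem_support_iff.1 hm)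
    rwa [Finsupp.weight_apply, Finsupp.sum_fintype _ _ (by simp),
      Finset.sum_congr rfl (fun i _ => by simp : ∀ i ∈ Finset.univ, m i • (1 : Fin d → ℕ) i = m i)]
      at this
  simp only [Pi.smul_apply, smul_eq_mul, mul_pow, Finset.prod_mul_distrib, Finset.prod_pow_eq_pow_sum,
    h1]
  ring

/-- A real vector regarded as a complex vector. -/
def realVec {d : ℕ} (x : Fin d → ℝ) : Fin d → ℂ := fun i => (x i : ℂ)

/-- The test points form a product of infinite sets. Excluding zero coordinates lets later arguments
divide by a coordinate or by the length of the vector. -/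
lemma eq_of_eval_realVec {d : ℕ} {p q : MvPolynomial (Fin d) ℂ}
    (h : ∀ x : Fin d → ℝ, (∀ i, x i ≠ 0) →
      MvPolynomial.eval (realVec x) p = MvPolynomial.eval (realVec x) q) : p = q := by
  refine MvPolynomial.funext_set (fun _ => Complex.ofReal '' {x : ℝ | x ≠ 0}) (fun _ => ?_) ?_
  · exact (Set.Finite.infinite_compl (Set.finite_singleton (0 : ℝ))).image
      Complex.ofReal_injective.injOn
  · intro z hz
    choose x hx hxz using fun i => hz i (Set.mem_univ i)
    obtain rfl : realVec x = z := funext hxz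
    exact h x hx

lemma toComplex_mulVec_realVec {d : ℕ} (A : SO d) (x : Fin d → ℝ) :
    (SO.toComplex A).mulVec (realVec x) =
      realVec ((A : Matrix (Fin d) (Fin d) ℝ).mulVec x) := by
  funext i
  simp [Matrix.mulVec, dotProduct, realVec, SO.toComplex_apply]

lemma quad_realVec {d : ℕ} (x : Fin d → ℝ) : quad (realVec x) = ((x ⬝ᵥ x : ℝ) : ℂ) := by
  simp [quad, realVec, dotProduct, sq]

lemma dotProduct_self_pos {d : ℕ} {x : Fin d → ℝ} (hx : x ≠ 0) : 0 < x ⬝ᵥ x := by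
  have h1 : 0 ≤ x ⬝ᵥ x := Finset.sum_nonneg fun i _ => mul_self_nonneg (x i)
  exact lt_of_le_of_ne h1 fun h => hx (dotProduct_self_eq_zero.1 h.symm)

/-- A homogeneous polynomial is determined by its values on the real unit sphere. -/
lemma eq_zero_of_eval_sphere {d r : ℕ} (hd : 0 < d) {p : MvPolynomial (Fin d) ℂ}
    (hp : p.IsHomogeneous r)
    (h : ∀ x : Fin d → ℝ, x ⬝ᵥ x = 1 → MvPolynomial.eval (realVec x) p = 0) : p = 0 := by
  refine eq_of_eval_realVec fun x hx => ?_
  have hx0 : x ≠ 0 := fun h0 => hx ⟨0, hd⟩ (congrFun h0 _)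
  have hpos := dotProduct_self_pos hx0
  set s := √(x ⬝ᵥ x) with hs
  have hs0 : s ≠ 0 := (Real.sqrt_pos.2 hpos).ne'
  have hss : s * s = x ⬝ᵥ x := Real.mul_self_sqrt hpos.le
  have h1 : realVec x = (s : ℂ) • realVec (s⁻¹ • x) := by
    funext i
    simp only [realVec, Pi.smul_apply, smul_eq_mul, Complex.ofReal_mul, Complex.ofReal_inv]
    rw [← mul_assoc, mul_inv_cancel₀ (by exact_mod_cast hs0), one_mul]
  rw [h1, eval_smul_of_isHomogeneous hp, h, mul_zero, map_zero]
  rw [smul_dotProduct, dotProduct_smul, ← hss, smul_eq_mul, smul_eq_mul]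
  field_simp

/-! ## Transitivity of `SO(d)` on spheres -/

/-- The reflection in the hyperplane orthogonal to `u`. -/
def householder {d : ℕ} (u : Fin d → ℝ) : Matrix (Fin d) (Fin d) ℝ :=
  1 - (2 / (u ⬝ᵥ u)) • Matrix.vecMulVec u u

lemma householder_mulVec {d : ℕ} (u x : Fin d → ℝ) :
    (householder u).mulVec x = x - (2 * (u ⬝ᵥ x) / (u ⬝ᵥ u)) • u := by
  rw [householder, Matrix.sub_mulVec, Matrix.one_mulVec, Matrix.smul_mulVec,
    Matrix.vecMulVec_mulVec, op_smul_eq_smul, smul_smul]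
  congr 2
  ring

lemma householder_mem_orthogonalGroup {d : ℕ} {u : Fin d → ℝ} (hu : u ≠ 0) :
    householder u ∈ Matrix.orthogonalGroup (Fin d) ℝ := by
  have hpos := (dotProduct_self_pos hu).ne'
  rw [Matrix.mem_orthogonalGroup_iff]
  have ht : (householder u).transpose = householder u := by
    rw [householder, Matrix.transpose_sub, Matrix.transpose_one, Matrix.transpose_smul,
      Matrix.transpose_vecMulVec]
  rw [ht]
  have : 2 / (u ⬝ᵥ u) * (u ⬝ᵥ u) = 2 := by field_simp
  simp only [householder, sub_mul, mul_sub, one_mul, mul_one, smul_mul_assoc, mul_smul_comm,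
    Matrix.vecMulVec_mul_vecMulVec]
  rw [Matrix.vecMulVec_smul, smul_smul, this, two_smul, sub_add_cancel_left, smul_neg]
  abel

/-- The determinant of a rank-one perturbation of the identity is `1 - (2 / u·u) (u·u)`. -/
lemma det_householder {d : ℕ} {u : Fin d → ℝ} (hu : u ≠ 0) : (householder u).det = -1 := by
  have hpos := (dotProduct_self_pos hu).ne'
  have h1 : householder u = 1 + Matrix.replicateCol Unit (-(2 / (u ⬝ᵥ u)) • u) *
      Matrix.replicateRow Unit u := by
    rw [householder, ← Matrix.vecMulVec_eq, Matrix.smul_vecMulVec, neg_smul, sub_eq_add_neg]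
  rw [h1, Matrix.det_one_add_replicateCol_mul_replicateRow, dotProduct_smul, smul_eq_mul]
  field_simp
  norm_num

/-- The reflection along `x - y` exchanges two vectors of equal length but has determinant `-1`.
Preceding it by the reflection along some `v ≠ 0` orthogonal to `x`, which fixes `x`, corrects the
determinant. Such a `v` requires `d ≥ 2`. -/
lemma SO.exists_mulVec_eq {d : ℕ} (hd : 2 ≤ d) (x y : Fin d → ℝ) (h : x ⬝ᵥ x = y ⬝ᵥ y) :
    ∃ A : SO d, (A : Matrix (Fin d) (Fin d) ℝ).mulVec x = y := by
  by_cases hxy : x = y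
  · exact ⟨1, by simp [hxy]⟩
  obtain ⟨v, hv, hvx⟩ : ∃ v : Fin d → ℝ, v ≠ 0 ∧ v ⬝ᵥ x = 0 := by
    let i : Fin d := ⟨0, by omega⟩
    let j : Fin d := ⟨1, by omega⟩
    have hij : i ≠ j := by simp [i, j]
    by_cases hx : x i = 0
    · exact ⟨Pi.single i 1, by simp, by simp [hx]⟩
    · refine ⟨Pi.single i (x j) - Pi.single j (x i), fun h0 => hx ?_, ?_⟩
      · have := congrFun h0 j
        simpa [Pi.single_eq_of_ne (Ne.symm hij)] using this
      · rw [sub_dotProduct, single_dotProduct, single_dotProduct]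
        ring
  have hu : x - y ≠ 0 := sub_ne_zero.2 hxy
  refine ⟨⟨householder (x - y) * householder v, Matrix.mem_specialOrthogonalGroup_iff.2
    ⟨mul_mem (householder_mem_orthogonalGroup hu) (householder_mem_orthogonalGroup hv), ?_⟩⟩, ?_⟩
  · rw [Matrix.det_mul, det_householder hu, det_householder hv]
    norm_num
  · change (householder (x - y) * householder v).mulVec x = y
    rw [← Matrix.mulVec_mulVec, householder_mulVec v, hvx, mul_zero, zero_div, zero_smul, sub_zero,
      householder_mulVec]
    have h1 : (x - y) ⬝ᵥ (x - y) = 2 * ((x - y) ⬝ᵥ x) := by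
      simp only [sub_dotProduct, dotProduct_sub, dotProduct_comm y x]
      linarith
    rw [h1, div_self (h1 ▸ (dotProduct_self_pos hu).ne'), one_smul, sub_sub_cancel]

lemma cornerMatrix_castSucc_castSucc {e : ℕ} (M : Matrix (Fin e) (Fin e) ℝ) (i j : Fin e) :
    cornerMatrix M i.castSucc j.castSucc = M i j := by
  change Matrix.fromBlocks M 0 0 1 (finSumFinEquiv.symm (Fin.castAdd 1 i))
    (finSumFinEquiv.symm (Fin.castAdd 1 j)) = _
  rw [finSumFinEquiv_symm_apply_castAdd, finSumFinEquiv_symm_apply_castAdd]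
  rfl

lemma cornerMatrix_castSucc_last {e : ℕ} (M : Matrix (Fin e) (Fin e) ℝ) (i : Fin e) :
    cornerMatrix M i.castSucc (Fin.last e) = 0 := by
  change Matrix.fromBlocks M 0 0 1 (finSumFinEquiv.symm (Fin.castAdd 1 i))
    (finSumFinEquiv.symm (Fin.natAdd e (0 : Fin 1))) = _
  rw [finSumFinEquiv_symm_apply_castAdd, finSumFinEquiv_symm_apply_natAdd]
  rfl

lemma cornerMatrix_last_castSucc {e : ℕ} (M : Matrix (Fin e) (Fin e) ℝ) (i : Fin e) :
    cornerMatrix M (Fin.last e) i.castSucc = 0 := by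
  change Matrix.fromBlocks M 0 0 1 (finSumFinEquiv.symm (Fin.natAdd e (0 : Fin 1)))
    (finSumFinEquiv.symm (Fin.castAdd 1 i)) = _
  rw [finSumFinEquiv_symm_apply_castAdd, finSumFinEquiv_symm_apply_natAdd]
  rfl

lemma cornerMatrix_last_last {e : ℕ} (M : Matrix (Fin e) (Fin e) ℝ) :
    cornerMatrix M (Fin.last e) (Fin.last e) = 1 := by
  change Matrix.fromBlocks M 0 0 1 (finSumFinEquiv.symm (Fin.natAdd e (0 : Fin 1)))
    (finSumFinEquiv.symm (Fin.natAdd e (0 : Fin 1))) = _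
  rw [finSumFinEquiv_symm_apply_natAdd]
  rfl

lemma cornerEmbedding_mulVec_snoc {e : ℕ} (A : SO e) (x : Fin e → ℝ) (t : ℝ) :
    (cornerEmbedding e A : Matrix (Fin (e + 1)) (Fin (e + 1)) ℝ).mulVec (Fin.snoc x t) =
      (Fin.snoc ((A : Matrix (Fin e) (Fin e) ℝ).mulVec x) t : Fin (e + 1) → ℝ) := by
  have h : (cornerEmbedding e A : Matrix (Fin (e + 1)) (Fin (e + 1)) ℝ) =
      cornerMatrix (A : Matrix (Fin e) (Fin e) ℝ) := rfl
  rw [h]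
  funext i
  refine Fin.lastCases ?_ (fun i => ?_) i
  · simp [Matrix.mulVec, dotProduct, Fin.sum_univ_castSucc, cornerMatrix_last_castSucc,
      cornerMatrix_last_last]
  · simp [Matrix.mulVec, dotProduct, Fin.sum_univ_castSucc, cornerMatrix_castSucc_castSucc,
      cornerMatrix_castSucc_last]

/-! ## Harmonic polynomials fixed by the stabilizer of a point -/

lemma harmonicRep_apply_coe {d r : ℕ} (A : SO d) (p : harmonic d r) :
    ((harmonicRep d r A p : harmonic d r) : MvPolynomial (Fin d) ℂ) =
      substMatrix (SO.toComplex A⁻¹) p := rfl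

lemma eval_harmonicRep {d r : ℕ} (A : SO d) (p : harmonic d r) (x : Fin d → ℝ) :
    MvPolynomial.eval (realVec x) (harmonicRep d r A p : MvPolynomial (Fin d) ℂ) =
      MvPolynomial.eval (realVec (((A⁻¹ : SO d) : Matrix (Fin d) (Fin d) ℝ).mulVec x)) p := by
  rw [harmonicRep_apply_coe, eval_substMatrix, toComplex_mulVec_realVec]

/-- An even polynomial in one variable is a polynomial in the square of the variable. -/
lemma exists_eval_eq_eval_sq {P : Polynomial ℂ} {r : ℕ} (hr : P.natDegree ≤ r)
    (hP : ∀ s : ℝ, P.eval (-(s : ℂ)) = P.eval (s : ℂ)) :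
    ∃ a : ℕ → ℂ, ∀ s : ℂ, P.eval s = ∑ j ∈ Finset.range (r / 2 + 1), a j * (s ^ 2) ^ j := by
  have h1 : P.comp (Polynomial.C (-1) * Polynomial.X) = P := by
    refine Polynomial.eq_of_infinite_eval_eq _ _ ?_
    refine (Set.infinite_range_of_injective Complex.ofReal_injective).mono ?_
    rintro _ ⟨s, rfl⟩
    simp [Polynomial.eval_comp, hP]
  have hodd : ∀ k, ¬ 2 ∣ k → P.coeff k = 0 := by
    intro k hk
    have h2 := congrArg (fun Q => Polynomial.coeff Q k) h1
    simp only [Polynomial.comp_C_mul_X_coeff] at h2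
    rw [Odd.neg_one_pow (by rw [← Nat.not_even_iff_odd, even_iff_two_dvd]; exact hk)] at h2
    have h3 : (2 : ℂ) * P.coeff k = 0 := by linear_combination -h2
    simpa using h3
  have h2 : Polynomial.expand ℂ 2 (P.contract 2) = P := by
    ext k
    rw [Polynomial.coeff_expand two_pos, Polynomial.coeff_contract two_ne_zero]
    split_ifs with h
    · rw [Nat.div_mul_cancel h]
    · exact (hodd k h).symm
  refine ⟨(P.contract 2).coeff, fun s => ?_⟩
  have h3 : (P.contract 2).natDegree < r / 2 + 1 := by
    rw [Nat.lt_succ_iff, Polynomial.natDegree_le_iff_coeff_eq_zero]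
    intro N hN
    rw [Polynomial.coeff_contract two_ne_zero]
    exact Polynomial.coeff_eq_zero_of_natDegree_lt (by omega)
  conv_lhs => rw [← h2]
  rw [Polynomial.expand_eval, Polynomial.eval_eq_sum_range' h3]

lemma realVec_snoc_smul {e : ℕ} (x : Fin e → ℝ) {t : ℝ} (ht : t ≠ 0) :
    realVec (Fin.snoc x t : Fin (e + 1) → ℝ) =
      (t : ℂ) • realVec (Fin.snoc (t⁻¹ • x) 1 : Fin (e + 1) → ℝ) := by
  have ht' : (t : ℂ) ≠ 0 := by exact_mod_cast ht
  funext i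
  refine Fin.lastCases ?_ (fun i => ?_) i
  · simp [realVec]
  · simp [realVec, mul_inv_cancel_left₀ ht']

/-- Modulo the quadratic form, a homogeneous polynomial that is invariant under the stabilizer of
the last basis vector is a multiple of a power of the last coordinate. -/
theorem quadPoly_dvd_of_fixed {e r : ℕ} (he : 2 ≤ e) {p : MvPolynomial (Fin (e + 1)) ℂ}
    (hp : p.IsHomogeneous r)
    (hfix : ∀ (A : SO e) (x : Fin (e + 1) → ℝ), MvPolynomial.eval (realVec
      ((cornerEmbedding e A : Matrix (Fin (e + 1)) (Fin (e + 1)) ℝ).mulVec x)) p =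
        MvPolynomial.eval (realVec x) p) :
    ∃ b : ℂ, quadPoly (e + 1) ∣ p - MvPolynomial.C b * MvPolynomial.X (Fin.last e) ^ r := by
  let i0 : Fin e := ⟨0, by omega⟩
  -- `P(s)` is the value of `p` at the point with first coordinate `s`, last coordinate 1 and all
  -- others 0.
  let P : Polynomial ℂ := MvPolynomial.aeval
    (Fin.snoc (Pi.single i0 Polynomial.X) 1 : Fin (e + 1) → Polynomial ℂ) p
  have hPdeg : P.natDegree ≤ r := by
    have := MvPolynomial.aeval_natDegree_le p hp.totalDegree_le
      (Fin.snoc (Pi.single i0 Polynomial.X) 1 : Fin (e + 1) → Polynomial ℂ) (n := 1) (fun i => by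
        refine Fin.lastCases ?_ (fun i => ?_) i
        · simp
        · rw [Fin.snoc_castSucc]
          by_cases h : i = i0
          · subst h; simp
          · simp [Pi.single_eq_of_ne h])
    simpa using this
  have hPeval : ∀ s : ℝ, P.eval (s : ℂ) =
      MvPolynomial.eval (realVec (Fin.snoc (Pi.single i0 s) 1 : Fin (e + 1) → ℝ)) p := by
    intro s
    have h1 : P.eval (s : ℂ) = (Polynomial.aeval (s : ℂ)) (MvPolynomial.aeval
      (Fin.snoc (Pi.single i0 Polynomial.X) 1 : Fin (e + 1) → Polynomial ℂ) p) := by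
      rw [Polynomial.coe_aeval_eq_eval]
    rw [h1, ← AlgHom.comp_apply, MvPolynomial.comp_aeval, ← MvPolynomial.aeval_eq_eval]
    congr 2
    funext i
    refine Fin.lastCases ?_ (fun i => ?_) i
    · simp [realVec]
    · by_cases h : i = i0
      · subst h; simp [realVec]
      · simp [realVec, Pi.single_eq_of_ne h]
  -- Transitivity on spheres: at a real point `(x, t)` the value of `p` depends only on `x·x` and
  -- `t`.
  have hmove : ∀ (x y : Fin e → ℝ) (t : ℝ), x ⬝ᵥ x = y ⬝ᵥ y →
      MvPolynomial.eval (realVec (Fin.snoc x t : Fin (e + 1) → ℝ)) p =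
        MvPolynomial.eval (realVec (Fin.snoc y t : Fin (e + 1) → ℝ)) p := by
    intro x y t hxy
    obtain ⟨A, hA⟩ := SO.exists_mulVec_eq he x y hxy
    rw [← hfix A (Fin.snoc x t), cornerEmbedding_mulVec_snoc, hA]
  -- The vectors with single entry `s` and `-s` have the same length, so `P` is even.
  obtain ⟨a, ha⟩ := exists_eval_eq_eval_sq hPdeg (fun s => by
    rw [← Complex.ofReal_neg, hPeval, hPeval]
    exact hmove _ _ _ (by simp))
  set X : MvPolynomial (Fin (e + 1)) ℂ := MvPolynomial.X (Fin.last e) with hX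
  -- By homogeneity `p(x, t) = t^r P(|x|/t)` for `t ≠ 0`, where `|x|²` is the full quadratic form
  -- minus `t²`. Only even powers of `|x|/t`, at most the `r`-th, occur, so the result is a
  -- polynomial.
  have hpsum : p = ∑ j ∈ Finset.range (r / 2 + 1),
      MvPolynomial.C (a j) * (quadPoly (e + 1) - X ^ 2) ^ j * X ^ (r - 2 * j) := by
    refine eq_of_eval_realVec fun z hz => ?_
    obtain ⟨x, t, rfl⟩ : ∃ (x : Fin e → ℝ) (t : ℝ), z = Fin.snoc x t :=
      ⟨Fin.init z, z (Fin.last e), (Fin.snoc_init_self z).symm⟩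
    have ht : t ≠ 0 := by simpa using hz (Fin.last e)
    have ht' : (t : ℂ) ≠ 0 := by exact_mod_cast ht
    have hxx : 0 ≤ x ⬝ᵥ x := Finset.sum_nonneg fun i _ => mul_self_nonneg (x i)
    set s := √(x ⬝ᵥ x) with hs
    have hss : s * s = x ⬝ᵥ x := Real.mul_self_sqrt hxx
    have h1 : MvPolynomial.eval (realVec (Fin.snoc x t : Fin (e + 1) → ℝ)) p =
        (t : ℂ) ^ r * P.eval ((t⁻¹ * s : ℝ) : ℂ) := by
      rw [realVec_snoc_smul x ht, eval_smul_of_isHomogeneous hp, hPeval]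
      congr 1
      refine hmove _ _ _ ?_
      rw [smul_dotProduct, dotProduct_smul, ← hss]
      simp
      ring
    have h2 : quad (realVec (Fin.snoc x t : Fin (e + 1) → ℝ)) - (t : ℂ) ^ 2 = (s : ℂ) ^ 2 := by
      rw [quad_realVec, dotProduct, Fin.sum_univ_castSucc]
      simp only [Fin.snoc_castSucc, Fin.snoc_last]
      rw [show ∑ i, x i * x i = s * s from hss.symm]
      push_cast
      ring
    have h3 : realVec (Fin.snoc x t : Fin (e + 1) → ℝ) (Fin.last e) = (t : ℂ) := by simp [realVec]
    rw [h1, ha, map_sum, Finset.mul_sum]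
    refine Finset.sum_congr rfl fun j hj => ?_
    have hj' : 2 * j ≤ r := by
      have := Finset.mem_range.1 hj
      omega
    rw [map_mul, map_mul, map_pow, map_sub, map_pow, map_pow, eval_quadPoly, hX,
      MvPolynomial.eval_X, MvPolynomial.eval_C, h3, h2]
    obtain ⟨k, rfl⟩ := Nat.exists_eq_add_of_le hj'
    rw [Nat.add_sub_cancel_left]
    rw [Complex.ofReal_mul, Complex.ofReal_inv, mul_pow, mul_pow, inv_pow, inv_pow, pow_add, pow_mul]
    field_simp
  -- Modulo the quadratic form, `(Q - X²)^j` becomes `(-1)^j X^(2j)`.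
  refine ⟨∑ j ∈ Finset.range (r / 2 + 1), a j * (-1) ^ j, ?_⟩
  rw [map_sum, Finset.sum_mul]
  conv_rhs => rw [hpsum, ← Finset.sum_sub_distrib]
  refine Finset.dvd_sum fun j hj => ?_
  have hj' : 2 * j ≤ r := by
    have := Finset.mem_range.1 hj
    omega
  have h1 : quadPoly (e + 1) ∣ (quadPoly (e + 1) - X ^ 2) ^ j - (-X ^ 2) ^ j := by
    have := sub_dvd_pow_sub_pow (quadPoly (e + 1) - X ^ 2) (-X ^ 2) j
    rwa [sub_neg_eq_add, sub_add_cancel] at this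
  have h2 : MvPolynomial.C (a j) * (quadPoly (e + 1) - X ^ 2) ^ j * X ^ (r - 2 * j) -
      MvPolynomial.C (a j * (-1) ^ j) * X ^ r = MvPolynomial.C (a j) * X ^ (r - 2 * j) *
        ((quadPoly (e + 1) - X ^ 2) ^ j - (-X ^ 2) ^ j) := by
    obtain ⟨k, rfl⟩ := Nat.exists_eq_add_of_le hj'
    rw [Nat.add_sub_cancel_left, neg_pow (X ^ 2), map_mul, map_pow, map_neg, map_one]
    ring
  rw [h2]
  exact h1.mul_left _

/-- A harmonic polynomial that is divisible by the quadratic form vanishes. -/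
lemma eq_zero_of_quadPoly_dvd {d : ℕ} (hd : 0 < d) {p : MvPolynomial (Fin d) ℂ}
    (hp : laplacian d p = 0) (h : quadPoly d ∣ p) : p = 0 := by
  obtain ⟨g, rfl⟩ := h
  suffices hg : g = 0 by rw [hg, mul_zero]
  -- Multiplication by the quadratic form followed by the Laplacian preserves degrees, so the
  -- equation splits into one for each homogeneous component of `g`.
  have h1 : ∀ k, MvPolynomial.homogeneousComponent k g = 0 := by
    intro k
    refine eq_zero_of_laplacian_quadPoly_mul hd
      (MvPolynomial.homogeneousComponent_isHomogeneous k g) ?_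
    have hk : ∀ i, laplacian d (quadPoly d * MvPolynomial.homogeneousComponent i g) ∈
        MvPolynomial.homogeneousSubmodule (Fin d) ℂ i := fun i => by
      have := laplacian_isHomogeneous ((quadPoly_isHomogeneous d).mul
        (MvPolynomial.homogeneousComponent_isHomogeneous i g))
      rwa [Nat.add_sub_cancel_left] at this
    rw [← MvPolynomial.sum_homogeneousComponent g, Finset.mul_sum, map_sum] at hp
    have h2 := congrArg (MvPolynomial.homogeneousComponent k) hp
    rw [map_sum, map_zero, Finset.sum_congr rfl
      (fun i _ => MvPolynomial.homogeneousComponent_of_mem (m := k) (hk i)),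
      Finset.sum_ite_eq] at h2
    split_ifs at h2 with h3
    · exact h2
    · rw [MvPolynomial.homogeneousComponent_eq_zero]
      · simp
      · simpa using h3
  rw [← MvPolynomial.sum_homogeneousComponent g]
  exact Finset.sum_eq_zero fun i _ => h1 i

/-- Harmonic polynomials invariant under the stabilizer of the last basis vector are proportional
to each other. -/
theorem exists_smul_eq_of_fixed {e r : ℕ} (he : 2 ≤ e) {p p' : harmonic (e + 1) r}
    (hp : ∀ A : SO e, harmonicRep (e + 1) r (cornerEmbedding e A) p = p)
    (hp' : ∀ A : SO e, harmonicRep (e + 1) r (cornerEmbedding e A) p' = p') (h0 : p ≠ 0) :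
    ∃ c : ℂ, p' = c • p := by
  have key : ∀ q : harmonic (e + 1) r,
      (∀ A : SO e, harmonicRep (e + 1) r (cornerEmbedding e A) q = q) →
      ∃ b : ℂ, quadPoly (e + 1) ∣ (q : MvPolynomial (Fin (e + 1)) ℂ) -
        MvPolynomial.C b * MvPolynomial.X (Fin.last e) ^ r := by
    intro q hq
    refine quadPoly_dvd_of_fixed he q.2.1 fun A x => ?_
    have h1 := eval_harmonicRep (cornerEmbedding e A⁻¹) q x
    rw [hq] at h1
    rw [h1, map_inv, inv_inv]
  have hpos : 0 < e + 1 := Nat.succ_pos e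
  obtain ⟨b, hb⟩ := key p hp
  obtain ⟨b', hb'⟩ := key p' hp'
  -- With `b = 0` the harmonic `p` would be divisible by the quadratic form. The same principle
  -- kills `p' - (b'/b) p`, since the powers of the last coordinate cancel.
  have hb0 : b ≠ 0 := by
    rintro rfl
    refine h0 (Subtype.ext (eq_zero_of_quadPoly_dvd hpos p.2.2 ?_))
    simpa using hb
  refine ⟨b' / b, ?_⟩
  rw [← sub_eq_zero]
  refine Subtype.ext (eq_zero_of_quadPoly_dvd hpos (p' - (b' / b) • p).2.2 ?_)
  have h1 : ((p' - (b' / b) • p : harmonic (e + 1) r) : MvPolynomial (Fin (e + 1)) ℂ) =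
      ((p' : MvPolynomial (Fin (e + 1)) ℂ) -
        MvPolynomial.C b' * MvPolynomial.X (Fin.last e) ^ r) -
      MvPolynomial.C (b' / b) * ((p : MvPolynomial (Fin (e + 1)) ℂ) -
        MvPolynomial.C b * MvPolynomial.X (Fin.last e) ^ r) := by
    rw [mul_sub, ← mul_assoc, ← map_mul, div_mul_cancel₀ _ hb0]
    rw [AddSubgroupClass.coe_sub, Submodule.coe_smul, MvPolynomial.smul_eq_C_mul]
    ring
  rw [h1]
  exact dvd_sub hb' (hb.mul_left _)

/-! ## Irreducibility and inequivalence of the spaces of harmonic polynomials -/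

section Riesz

variable {H E : Type*} [AddCommGroup H] [Module ℂ H] [NormedAddCommGroup E] [InnerProductSpace ℂ E]

/-- Riesz representation on `V` for the inner product pulled back by `T`, whose injectivity makes it
definite. `H` itself needs no norm. -/
lemma exists_inner_eq {T : H →ₗ[ℂ] E} (hT : Function.Injective T) (V : Submodule ℂ H)
    [FiniteDimensional ℂ V] (φ : H →ₗ[ℂ] ℂ) :
    ∃ Z ∈ V, ∀ v ∈ V, inner ℂ (T Z) (T v) = φ v := by
  let L : V ≃ₗ[ℂ] LinearMap.range (T ∘ₗ V.subtype) :=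
    LinearEquiv.ofInjective (T ∘ₗ V.subtype) (hT.comp Subtype.val_injective)
  have : FiniteDimensional ℂ (LinearMap.range (T ∘ₗ V.subtype)) := LinearMap.finiteDimensional_range _
  have : CompleteSpace (LinearMap.range (T ∘ₗ V.subtype)) := FiniteDimensional.complete ℂ _
  let ψ : StrongDual ℂ (LinearMap.range (T ∘ₗ V.subtype)) :=
    LinearMap.toContinuousLinearMap (φ ∘ₗ V.subtype ∘ₗ (L.symm : _ →ₗ[ℂ] V))
  let y := (InnerProductSpace.toDual ℂ (LinearMap.range (T ∘ₗ V.subtype))).symm ψ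
  refine ⟨L.symm y, (L.symm y).2, fun v hv => ?_⟩
  have h1 : inner ℂ y (L ⟨v, hv⟩) = ψ (L ⟨v, hv⟩) := InnerProductSpace.toDual_symm_apply
  have h2 : ψ (L ⟨v, hv⟩) = φ v := by
    change φ (V.subtype (L.symm (L ⟨v, hv⟩))) = φ v
    rw [LinearEquiv.symm_apply_apply]
    rfl
  have h3 : (y : E) = T (L.symm y) := congrArg Subtype.val (L.apply_symm_apply y).symm
  rw [← h2, ← h1, ← h3]
  rfl

end Riesz

/-- The last basis vector. -/
def lastVec (e : ℕ) : Fin (e + 1) → ℝ := Fin.snoc 0 1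

/-- Evaluation at the last basis vector. -/
def evalLast (e r : ℕ) : harmonic (e + 1) r →ₗ[ℂ] ℂ :=
  (MvPolynomial.aeval (realVec (lastVec e))).toLinearMap ∘ₗ (harmonic (e + 1) r).subtype

lemma evalLast_apply {e r : ℕ} (h : harmonic (e + 1) r) :
    evalLast e r h = MvPolynomial.eval (realVec (lastVec e))
      (h : MvPolynomial (Fin (e + 1)) ℂ) := by
  rw [← MvPolynomial.aeval_eq_eval]
  rfl

lemma evalLast_harmonicRep {e r : ℕ} (A : SO (e + 1)) (h : harmonic (e + 1) r) :
    evalLast e r (harmonicRep (e + 1) r A⁻¹ h) =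
      MvPolynomial.eval (realVec ((A : Matrix (Fin (e + 1)) (Fin (e + 1)) ℝ).mulVec (lastVec e)))
        (h : MvPolynomial (Fin (e + 1)) ℂ) := by
  rw [evalLast_apply, eval_harmonicRep, inv_inv]

lemma evalLast_cornerEmbedding {e r : ℕ} (A : SO e) (h : harmonic (e + 1) r) :
    evalLast e r (harmonicRep (e + 1) r (cornerEmbedding e A) h) = evalLast e r h := by
  have := evalLast_harmonicRep (cornerEmbedding e A⁻¹) h
  rw [← map_inv, inv_inv] at this
  rw [this, lastVec, cornerEmbedding_mulVec_snoc, Matrix.mulVec_zero, evalLast_apply, lastVec]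

lemma lastVec_dotProduct (e : ℕ) : lastVec e ⬝ᵥ lastVec e = 1 := by
  simp [lastVec, dotProduct, Fin.sum_univ_castSucc]

lemma exists_mulVec_lastVec {e : ℕ} (he : 1 ≤ e) {x : Fin (e + 1) → ℝ} (hx : x ⬝ᵥ x = 1) :
    ∃ A : SO (e + 1),
      (A : Matrix (Fin (e + 1)) (Fin (e + 1)) ℝ).mulVec (lastVec e) = x :=
  SO.exists_mulVec_eq (by omega) _ _ (by rw [lastVec_dotProduct, hx])

/-- If all elements of an invariant subspace vanished at one point of the real sphere, they would
vanish on the whole sphere by transitivity, hence identically by homogeneity. -/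
lemma exists_evalLast_ne_zero {e r : ℕ} (he : 1 ≤ e) (V : Submodule ℂ (harmonic (e + 1) r))
    (hV : ∀ A, ∀ h ∈ V, harmonicRep (e + 1) r A h ∈ V) (hbot : V ≠ ⊥) :
    ∃ v ∈ V, evalLast e r v ≠ 0 := by
  by_contra! hcon
  refine hbot ((Submodule.eq_bot_iff _).2 fun v hv => Subtype.ext ?_)
  refine eq_zero_of_eval_sphere (Nat.succ_pos e) v.2.1 fun x hx => ?_
  obtain ⟨A, rfl⟩ := exists_mulVec_lastVec he hx
  rw [← evalLast_harmonicRep]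
  exact hcon _ (hV _ v hv)

/-- Without harmonic polynomials of degree `r`, the power `X_i^r` would be a multiple of the
quadratic form. But at the isotropic point `e_i + √-1 e_j` the form vanishes while `X_i^r = 1`. -/
lemma harmonic_ne_bot {d : ℕ} (hd : 2 ≤ d) (r : ℕ) : harmonic d r ≠ ⊥ := by
  intro hbot
  let i : Fin d := ⟨0, by omega⟩
  let j : Fin d := ⟨1, by omega⟩
  have hij : i ≠ j := by simp [i, j]
  obtain ⟨h, hh, hs⟩ := exists_harmonic_decomposition (by omega : 0 < d) r _
    (MvPolynomial.isHomogeneous_X_pow (R := ℂ) i r)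
  have h0 : h 0 = 0 := by
    have := hh 0 (by omega)
    rw [mul_zero, Nat.sub_zero, hbot] at this
    exact this
  let z : Fin d → ℂ := Pi.single i 1 + Pi.single j Complex.I
  have hz : quad z = 0 := by
    have hzi : z i = 1 := by simp [z, Pi.single_eq_of_ne hij]
    have hzj : z j = Complex.I := by simp [z, Pi.single_eq_of_ne (Ne.symm hij)]
    rw [quad, ← Finset.sum_subset (Finset.subset_univ {i, j}), Finset.sum_pair hij, hzi, hzj]
    · simp
    · intro k _ hk
      simp only [Finset.mem_insert, Finset.mem_singleton, not_or] at hk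
      simp [z, Pi.single_eq_of_ne hk.1, Pi.single_eq_of_ne hk.2]
  have h1 := congrArg (MvPolynomial.eval z) hs
  rw [Finset.sum_range_succ', h0, mul_zero, add_zero, map_sum, Finset.sum_eq_zero] at h1
  · simp [z, Pi.single_eq_of_ne hij] at h1
  · intro k _
    rw [map_mul, map_pow, eval_quadPoly, hz, zero_pow (Nat.succ_ne_zero k), zero_mul]

section Unitary

variable {E : Type*} [NormedAddCommGroup E] [InnerProductSpace ℂ E]

/-- A functional invariant under the stabilizer is represented by an invariant vector, because the
vector representing it in `V` is unique. Applied to evaluation at the base point, this produces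
zonal polynomials. -/
lemma exists_fixed_inner_eq {e r : ℕ} {T : harmonic (e + 1) r →ₗ[ℂ] E}
    (hT : Function.Injective T)
    (hinv : ∀ A p q, inner ℂ (T (harmonicRep (e + 1) r A p)) (T (harmonicRep (e + 1) r A q)) =
      inner ℂ (T p) (T q))
    (V : Submodule ℂ (harmonic (e + 1) r))
    (hV : ∀ A, ∀ h ∈ V, harmonicRep (e + 1) r A h ∈ V) (φ : harmonic (e + 1) r →ₗ[ℂ] ℂ)
    (hφ : ∀ A h, φ (harmonicRep (e + 1) r (cornerEmbedding e A) h) = φ h) :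
    ∃ Z ∈ V, (∀ v ∈ V, inner ℂ (T Z) (T v) = φ v) ∧
      ∀ A, harmonicRep (e + 1) r (cornerEmbedding e A) Z = Z := by
  obtain ⟨Z, hZ, h⟩ := exists_inner_eq hT V φ
  refine ⟨Z, hZ, h, fun A => ?_⟩
  set g := harmonicRep (e + 1) r (cornerEmbedding e A) with hg
  have hmem : g Z - Z ∈ V := Submodule.sub_mem _ (hV _ _ hZ) hZ
  have hgg : ∀ v, g (harmonicRep (e + 1) r (cornerEmbedding e A⁻¹) v) = v := fun v => by
    rw [hg, ← Module.End.mul_apply, ← map_mul, ← map_mul, mul_inv_cancel, map_one, map_one,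
      Module.End.one_apply]
  have h1 : ∀ v ∈ V, inner ℂ (T (g Z)) (T v) = φ v := by
    intro v hv
    rw [← hgg v, hinv, h _ (hV _ _ hv), hφ, hgg]
  rw [← sub_eq_zero]
  refine hT ?_
  rw [map_zero, ← inner_self_eq_zero (𝕜 := ℂ)]
  conv_lhs => arg 2; rw [map_sub]
  rw [inner_sub_left, h1 _ hmem, h _ hmem, sub_self]

/-- A proper non-zero invariant subspace and its orthogonal complement would each contain a non-zero
vector fixed by the stabilizer. Such vectors are proportional, so one of them would be orthogonal to
itself. -/
theorem harmonicRep_isIrreducible {e r : ℕ} (he : 2 ≤ e) {T : harmonic (e + 1) r →ₗ[ℂ] E}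
    (hT : Function.Injective T)
    (hinv : ∀ A p q, inner ℂ (T (harmonicRep (e + 1) r A p)) (T (harmonicRep (e + 1) r A q)) =
      inner ℂ (T p) (T q)) : (harmonicRep (e + 1) r).IsIrreducible := by
  rw [isIrreducible_iff]
  refine ⟨Submodule.nontrivial_iff_ne_bot.2 (harmonic_ne_bot (by omega) r), fun V hV => ?_⟩
  by_contra! hcon
  obtain ⟨hbot, htop⟩ := hcon
  let V' : Submodule ℂ (harmonic (e + 1) r) :=
    { carrier := {h | ∀ v ∈ V, inner ℂ (T v) (T h) = 0}
      zero_mem' := fun v _ => by simp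
      add_mem' := fun {a b} ha hb v hv => by
        rw [map_add, inner_add_right, ha v hv, hb v hv, add_zero]
      smul_mem' := fun c a ha v hv => by rw [map_smul, inner_smul_right, ha v hv, mul_zero] }
  have hV' : ∀ A, ∀ h ∈ V', harmonicRep (e + 1) r A h ∈ V' := by
    intro A h hh v hv
    have h1 := hh _ (hV A⁻¹ v hv)
    rw [← hinv A, ← Module.End.mul_apply, ← map_mul, mul_inv_cancel, map_one,
      Module.End.one_apply] at h1
    exact h1
  -- The vector `Z ∈ V` representing `v ↦ ⟪T h, T v⟫` is the orthogonal projection of `h`, and `h -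
  -- Z` lies in the complement.
  have hbot' : V' ≠ ⊥ := by
    intro h0
    refine htop (Submodule.eq_top_iff'.2 fun h => ?_)
    obtain ⟨Z, hZ, h1⟩ := exists_inner_eq hT V ((innerₛₗ ℂ (T h)) ∘ₗ T)
    have h2 : h - Z ∈ V' := by
      intro v hv
      have h3 := h1 v hv
      rw [← inner_conj_symm, map_sub, inner_sub_left, h3]
      simp
    rw [h0, Submodule.mem_bot, sub_eq_zero] at h2
    exact h2 ▸ hZ
  have key : ∀ U : Submodule ℂ (harmonic (e + 1) r),
      (∀ A, ∀ h ∈ U, harmonicRep (e + 1) r A h ∈ U) → U ≠ ⊥ → ∃ Z ∈ U, Z ≠ 0 ∧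
        ∀ A, harmonicRep (e + 1) r (cornerEmbedding e A) Z = Z := by
    intro U hU hU0
    obtain ⟨Z, hZ, h1, h2⟩ := exists_fixed_inner_eq hT hinv U hU (evalLast e r)
      evalLast_cornerEmbedding
    obtain ⟨v, hv, hv0⟩ := exists_evalLast_ne_zero (by omega) U hU hU0
    refine ⟨Z, hZ, ?_, h2⟩
    rintro rfl
    exact hv0 (by rw [← h1 v hv, map_zero, inner_zero_left])
  obtain ⟨Z, hZ, hZ0, hfix⟩ := key V hV hbot
  obtain ⟨Z', hZ', hZ0', hfix'⟩ := key V' hV' hbot'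
  obtain ⟨c, rfl⟩ := exists_smul_eq_of_fixed he hfix hfix' hZ0
  refine hZ0' (hT ?_)
  rw [map_zero, ← inner_self_eq_zero (𝕜 := ℂ)]
  exact hZ' _ (Submodule.smul_mem _ c hZ)

/-- Evaluation at the base point, before and after `L`, is represented by fixed vectors, which are
proportional. By transitivity `L h` is then a constant multiple of `h` on the whole real sphere.
Suppose `r' > r`. If the degrees have equal parity, `L h` is the constant times a positive power of
the quadratic form times `h`, and a harmonic polynomial divisible by the form is zero. If the
parities differ, comparing `x` with `-x` makes `L h` vanish on the sphere. Both contradict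
injectivity. -/
lemma degree_le_of_equiv {e r r' : ℕ} (he : 2 ≤ e) {T : harmonic (e + 1) r →ₗ[ℂ] E}
    (hT : Function.Injective T)
    (hinv : ∀ A p q, inner ℂ (T (harmonicRep (e + 1) r A p)) (T (harmonicRep (e + 1) r A q)) =
      inner ℂ (T p) (T q)) (L : harmonic (e + 1) r ≃ₗ[ℂ] harmonic (e + 1) r')
    (hL : ∀ A h, L (harmonicRep (e + 1) r A h) = harmonicRep (e + 1) r' A (L h)) : r' ≤ r := by
  by_contra! hlt
  have hpos : 0 < e + 1 := Nat.succ_pos e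
  obtain ⟨Z, -, h1, h2⟩ := exists_fixed_inner_eq hT hinv ⊤ (fun _ _ _ => trivial) (evalLast e r)
      evalLast_cornerEmbedding
  obtain ⟨Z', -, h1', h2'⟩ := exists_fixed_inner_eq hT hinv ⊤ (fun _ _ _ => trivial)
    (evalLast e r' ∘ₗ (L : _ →ₗ[ℂ] _)) (fun A h => by
      change evalLast e r' (L _) = evalLast e r' (L h)
      rw [hL, evalLast_cornerEmbedding])
  have hnt : (⊤ : Submodule ℂ (harmonic (e + 1) r)) ≠ ⊥ := by
    have := Submodule.nontrivial_iff_ne_bot.2 (harmonic_ne_bot (by omega : 2 ≤ e + 1) r)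
    exact top_ne_bot
  obtain ⟨v, -, hv0⟩ := exists_evalLast_ne_zero (by omega) ⊤ (fun _ _ _ => trivial) hnt
  have hZ0 : Z ≠ 0 := by
    rintro rfl
    exact hv0 (by rw [← h1 v trivial, map_zero, inner_zero_left])
  obtain ⟨c, rfl⟩ := exists_smul_eq_of_fixed he h2 h2' hZ0
  have h3 : ∀ h, evalLast e r' (L h) = (starRingEnd ℂ c) * evalLast e r h := by
    intro h
    rw [← h1 h trivial, ← inner_smul_left, ← map_smul]
    exact (h1' h trivial).symm
  set c' := starRingEnd ℂ c with hc'
  have h4 : ∀ (h : harmonic (e + 1) r) (x : Fin (e + 1) → ℝ), x ⬝ᵥ x = 1 →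
      MvPolynomial.eval (realVec x) (L h : MvPolynomial (Fin (e + 1)) ℂ) =
        c' * MvPolynomial.eval (realVec x) (h : MvPolynomial (Fin (e + 1)) ℂ) := by
    intro h x hx
    obtain ⟨A, rfl⟩ := exists_mulVec_lastVec (by omega : 1 ≤ e) hx
    rw [← evalLast_harmonicRep, ← hL, h3, evalLast_harmonicRep]
  have hv : v ≠ 0 := by
    rintro rfl
    exact hv0 (map_zero _)
  have hLv : (L v : MvPolynomial (Fin (e + 1)) ℂ) ≠ 0 := fun h0 =>
    hv (L.map_eq_zero_iff.1 (Subtype.ext h0))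
  by_cases hpar : 2 ∣ r' - r
  · obtain ⟨k, hk⟩ := hpar
    have h5 : (L v : MvPolynomial (Fin (e + 1)) ℂ) -
        MvPolynomial.C c' * (quadPoly (e + 1) ^ k * (v : MvPolynomial (Fin (e + 1)) ℂ)) = 0 := by
      have hhom : (quadPoly (e + 1) ^ k * (v : MvPolynomial (Fin (e + 1)) ℂ)).IsHomogeneous r' := by
        have := ((quadPoly_isHomogeneous (e + 1)).pow k).mul v.2.1
        rwa [show 2 * k + r = r' by omega] at this
      refine eq_zero_of_eval_sphere hpos ((L v).2.1.sub (hhom.C_mul c')) fun x hx => ?_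
      rw [map_sub, h4 v x hx, map_mul, map_mul, map_pow, eval_quadPoly, quad_realVec, hx]
      simp
    rw [sub_eq_zero] at h5
    refine hLv (eq_zero_of_quadPoly_dvd hpos (L v).2.2 ?_)
    rw [h5]
    exact ((dvd_pow_self _ (by omega)).mul_right _).mul_left _
  · refine hLv (eq_zero_of_eval_sphere hpos (L v).2.1 fun x hx => ?_)
    have h5 := h4 v (-x) (by simpa using hx)
    have hneg : realVec (-x) = (-1 : ℂ) • realVec x := by
      funext i
      simp [realVec]
    rw [hneg, eval_smul_of_isHomogeneous (L v).2.1, eval_smul_of_isHomogeneous v.2.1] at h5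
    have h6 := h4 v x hx
    obtain ⟨k, hk⟩ : ∃ k, r' = r + (2 * k + 1) := ⟨(r' - r) / 2, by omega⟩
    have h7 : (-1 : ℂ) ^ r' = -(-1) ^ r := by
      rw [hk, pow_add, pow_succ, pow_mul]
      norm_num
    have h8 : ((-1 : ℂ) ^ r) ≠ 0 := pow_ne_zero _ (by norm_num)
    rw [h7] at h5
    have h9 : (-1 : ℂ) ^ r * (2 * MvPolynomial.eval (realVec x)
        (L v : MvPolynomial (Fin (e + 1)) ℂ)) = 0 := by
      linear_combination (-1 : ℂ) * h5 + (-1 : ℂ) ^ r * h6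
    simpa [h8] using h9

end Unitary

/-! ## Holomorphic functions of several variables -/

section Holomorphic

open Metric Filter Topology

variable {E : Type*} [NormedAddCommGroup E] [NormedSpace ℂ E]

/-- The ball is mapped into the disc of radius `2M` around `F z`, to which the Schwarz lemma
applies. -/
lemma norm_fderiv_le_of_norm_le {F : E → ℂ} {z : E} {r M : ℝ} (hr : 0 < r)
    (hF : DifferentiableOn ℂ F (ball z r)) (hM : ∀ w ∈ ball z r, ‖F w‖ ≤ M) :
    ‖fderiv ℂ F z‖ ≤ 2 * M / r := by
  refine Complex.norm_fderiv_le_div_of_mapsTo_ball hF (fun w hw => ?_) hr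
  rw [mem_closedBall, dist_eq_norm]
  refine (norm_sub_le _ _).trans ?_
  have h1 := hM w hw
  have h2 := hM z (mem_ball_self hr)
  linarith

/-- A uniform limit of holomorphic functions is holomorphic. -/
theorem differentiableAt_of_tendstoUniformlyOn {G : ℕ → E → ℂ} {g : E → ℂ} {z₀ : E} {r : ℝ}
    (hr : 0 < r) (hG : ∀ k, DifferentiableOn ℂ (G k) (ball z₀ r))
    (h : TendstoUniformlyOn G g atTop (ball z₀ r)) : DifferentiableAt ℂ g z₀ := by
  have hr2 : 0 < r / 2 := by positivity
  have hball : ∀ z ∈ ball z₀ (r / 2), ball z (r / 2) ⊆ ball z₀ r := fun z hz =>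
    ball_subset_ball' (by have := mem_ball.1 hz; linarith)
  have hmem : ∀ z ∈ ball z₀ (r / 2), z ∈ ball z₀ r := fun z hz =>
    hball z hz (mem_ball_self hr2)
  have hd : ∀ k, ∀ z ∈ ball z₀ (r / 2), DifferentiableAt ℂ (G k) z := fun k z hz =>
    (hG k).differentiableAt (isOpen_ball.mem_nhds (hmem z hz))
  -- The Cauchy estimate on balls of radius `r/2`, applied to differences of size at most `ε r / 8`,
  -- bounds the differences of the derivatives by `ε/2`.
  have hc : UniformCauchySeqOn (fun k => fderiv ℂ (G k)) atTop (ball z₀ (r / 2)) := by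
    rw [Metric.uniformCauchySeqOn_iff]
    intro ε hε
    obtain ⟨N, hN⟩ := Metric.uniformCauchySeqOn_iff.1 h.uniformCauchySeqOn (ε * r / 8) (by positivity)
    refine ⟨N, fun m hm n hn z hz => ?_⟩
    rw [dist_eq_norm, ← fderiv_sub (hd m z hz) (hd n z hz)]
    refine (norm_fderiv_le_of_norm_le (M := ε * r / 8) hr2
      (((hG m).sub (hG n)).mono (hball z hz)) fun w hw => ?_).trans_lt ?_
    · have := hN m hm n hn w (hball z hz hw)
      rw [dist_eq_norm] at this
      exact this.le
    · rw [div_lt_iff₀ hr2]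
      nlinarith
  choose! g' hg' using fun z (hz : z ∈ ball z₀ (r / 2)) =>
    cauchySeq_tendsto_of_complete (hc.cauchySeq hz)
  exact (hasFDerivAt_of_tendstoUniformlyOn isOpen_ball (hc.tendstoUniformlyOn_of_tendsto hg')
    (fun k z hz => (hd k z hz).hasFDerivAt) (fun z hz => h.tendsto_at (hmem z hz))
    (mem_ball_self hr2)).differentiableAt

/-- Quadratic Taylor estimate for a bounded holomorphic function. -/
lemma norm_sub_sub_fderiv_le {F : E → ℂ} {z a : E} {r M : ℝ} (hr : 0 < r)
    (hF : DifferentiableOn ℂ F (ball z r)) (hM : ∀ w ∈ ball z r, ‖F w‖ ≤ M) (ha : ‖a‖ < r) :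
    ‖F (z + a) - F z - fderiv ℂ F z a‖ ≤ 4 * M * (‖a‖ / r) ^ 2 := by
  have hz : z ∈ ball z r := mem_ball_self hr
  have hfd := norm_fderiv_le_of_norm_le hr hF hM
  -- The Schwarz lemma of order two for `F` minus its linear part. The radius `4M` adds the bounds
  -- `M` for `F w`, `2M` for the linear part and `M` for `F z`.
  have h := Complex.dist_le_mul_div_pow_of_mapsTo_ball_of_isLittleO (n := 1) (c := z) (z := z + a)
    (f := fun w => F w - fderiv ℂ F z (w - z)) (R₁ := r) (R₂ := 4 * M)
    (hF.sub ((fderiv ℂ F z).differentiable.comp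
      (differentiable_id.sub_const z)).differentiableOn)
    (fun w hw => by
      rw [mem_closedBall, dist_eq_norm]
      simp only [sub_self, map_zero, sub_zero]
      have h1 := hM w hw
      have h2 := hM z hz
      have h3 : ‖fderiv ℂ F z (w - z)‖ ≤ 2 * M := by
        refine ((fderiv ℂ F z).le_opNorm _).trans ?_
        have h4 : ‖w - z‖ ≤ r := (mem_ball_iff_norm.1 hw).le
        calc ‖fderiv ℂ F z‖ * ‖w - z‖ ≤ 2 * M / r * r :=
              mul_le_mul hfd h4 (norm_nonneg _) ((norm_nonneg _).trans hfd)
          _ = 2 * M := by field_simp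
      have h5 : ‖F w - fderiv ℂ F z (w - z) - F z‖ ≤ ‖F w‖ + ‖fderiv ℂ F z (w - z)‖ + ‖F z‖ :=
        (norm_sub_le _ _).trans (by gcongr; exact norm_sub_le _ _)
      linarith)
    (by
      have h1 := (hF.differentiableAt (isOpen_ball.mem_nhds hz)).hasFDerivAt.isLittleO
      simp only [sub_self, map_zero, sub_zero, pow_one]
      refine (h1.norm_right).congr_left fun w => ?_
      ring)
    (by simpa using ha)
  rw [dist_eq_norm] at h
  simpa [sub_right_comm] using h

/-- The directional derivatives of a holomorphic function are holomorphic. -/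
theorem differentiableOn_fderiv_apply {F : E → ℂ} {U : Set E} (hU : IsOpen U)
    (hF : DifferentiableOn ℂ F U) (v : E) : DifferentiableOn ℂ (fun z => fderiv ℂ F z v) U := by
  intro z₀ hz₀
  refine DifferentiableAt.differentiableWithinAt ?_
  have hcont := (hF.continuousOn.continuousAt (hU.mem_nhds hz₀)).norm
  obtain ⟨R, hR, hball⟩ := Metric.mem_nhds_iff.1 (inter_mem (hU.mem_nhds hz₀)
    (hcont.eventually_lt continuousAt_const (lt_add_one ‖F z₀‖)))
  set M := ‖F z₀‖ + 1 with hM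
  have hM0 : 0 ≤ M := by positivity
  have hR2 : 0 < R / 2 := by positivity
  have hsub : ∀ z ∈ ball z₀ (R / 2), ball z (R / 2) ⊆ ball z₀ R := fun z hz =>
    ball_subset_ball' (by have := mem_ball.1 hz; linarith)
  have hFR : DifferentiableOn ℂ F (ball z₀ R) := hF.mono fun z hz => (hball hz).1
  -- The derivative is the uniform limit of difference quotients with step `1/(N + k + 1)`. The
  -- offset `N` keeps every shifted point inside the larger ball, and the quadratic Taylor estimate
  -- leaves an error of order `1/(N + k + 1)`.
  obtain ⟨N, hN⟩ := exists_nat_gt (‖v‖ / (R / 2))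
  let G : ℕ → E → ℂ := fun k z => ((N + k + 1 : ℕ) : ℂ) *
    (F (z + ((N + k + 1 : ℕ) : ℂ)⁻¹ • v) - F z)
  have hpos : ∀ k : ℕ, (0 : ℝ) < ((N + k + 1 : ℕ) : ℝ) := fun k => by positivity
  have hvk : ∀ k, ‖((N + k + 1 : ℕ) : ℂ)⁻¹ • v‖ = ‖v‖ / ((N + k + 1 : ℕ) : ℝ) := fun k => by
    rw [norm_smul, norm_inv, Complex.norm_natCast, inv_mul_eq_div]
  have hvlt : ∀ k, ‖((N + k + 1 : ℕ) : ℂ)⁻¹ • v‖ < R / 2 := by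
    intro k
    rw [hvk, div_lt_iff₀ (hpos k)]
    rw [div_lt_iff₀ hR2] at hN
    have : (N : ℝ) ≤ ((N + k + 1 : ℕ) : ℝ) := by exact_mod_cast (by omega)
    nlinarith
  refine differentiableAt_of_tendstoUniformlyOn (G := G) hR2 (fun k => ?_) ?_
  · refine DifferentiableOn.const_mul (DifferentiableOn.sub ?_ ?_) _
    · refine hFR.comp (differentiable_id.add_const _).differentiableOn fun z hz => ?_
      refine hsub z hz ?_
      simpa using hvlt k
    · exact hFR.mono fun z hz => hsub z hz (mem_ball_self hR2)
  · rw [Metric.tendstoUniformlyOn_iff]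
    intro ε hε
    obtain ⟨K, hK⟩ := exists_nat_gt (4 * M * (‖v‖ / (R / 2)) ^ 2 / ε)
    filter_upwards [eventually_ge_atTop K] with k hk z hz
    have h1 := norm_sub_sub_fderiv_le hR2 (hFR.mono (hsub z hz))
      (fun w hw => (hball (hsub z hz hw)).2.le) (hvlt k)
    have hne : ((N + k + 1 : ℕ) : ℂ) ≠ 0 := Nat.cast_ne_zero.2 (Nat.succ_ne_zero _)
    have h2 : G k z - fderiv ℂ F z v = ((N + k + 1 : ℕ) : ℂ) *
        (F (z + ((N + k + 1 : ℕ) : ℂ)⁻¹ • v) - F z -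
          fderiv ℂ F z (((N + k + 1 : ℕ) : ℂ)⁻¹ • v)) := by
      rw [map_smul, smul_eq_mul, mul_sub _ _ (_ * _), mul_inv_cancel_left₀ hne]
    rw [dist_comm, dist_eq_norm, h2, norm_mul, Complex.norm_natCast]
    refine (mul_le_mul_of_nonneg_left h1 (hpos k).le).trans_lt ?_
    rw [hvk]
    rw [div_lt_iff₀ hε] at hK
    have hkk : (K : ℝ) < ((N + k + 1 : ℕ) : ℝ) := by exact_mod_cast (by omega)
    have h3 : ((N + k + 1 : ℕ) : ℝ) * (4 * M * (‖v‖ / ((N + k + 1 : ℕ) : ℝ) / (R / 2)) ^ 2) =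
        4 * M * (‖v‖ / (R / 2)) ^ 2 / ((N + k + 1 : ℕ) : ℝ) := by
      have := (hpos k).ne'
      field_simp
    rw [h3, div_lt_iff₀ (hpos k)]
    nlinarith

/-- The Taylor coefficients along complex lines through the origin of a holomorphic function are
homogeneous polynomials in the direction. -/
theorem exists_iteratedDeriv_eq_eval {n : ℕ} {U : Set (Fin n → ℂ)} (hU : IsOpen U)
    (h0 : (0 : Fin n → ℂ) ∈ U) (m : ℕ) :
    ∀ F : (Fin n → ℂ) → ℂ, DifferentiableOn ℂ F U → ∃ p : MvPolynomial (Fin n) ℂ,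
      p.IsHomogeneous m ∧
        ∀ z, iteratedDeriv m (fun ζ : ℂ => F (ζ • z)) 0 = MvPolynomial.eval z p := by
  have hnear : ∀ z : Fin n → ℂ, ∀ᶠ ζ : ℂ in 𝓝 0, ζ • z ∈ U := by
    intro z
    have hc : ContinuousAt (fun ζ : ℂ => ζ • z) 0 := by fun_prop
    exact hc.eventually_mem (by rw [zero_smul]; exact hU.mem_nhds h0)
  have hderiv : ∀ {F : (Fin n → ℂ) → ℂ}, DifferentiableOn ℂ F U → ∀ {z : Fin n → ℂ} {ζ : ℂ},
      ζ • z ∈ U → HasDerivAt (fun ζ : ℂ => F (ζ • z)) (fderiv ℂ F (ζ • z) z) ζ := by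
    intro F hF z ζ hζ
    have h1 : HasDerivAt (fun ζ : ℂ => ζ • z) z ζ := by
      simpa using (hasDerivAt_id ζ).smul_const z
    exact (hF.differentiableAt (hU.mem_nhds hζ)).hasFDerivAt.comp_hasDerivAt ζ h1
  induction m with
  | zero =>
    intro F _
    exact ⟨MvPolynomial.C (F 0), MvPolynomial.isHomogeneous_C _ _, fun z => by simp⟩
  | succ m ih =>
    intro F hF
    -- The derivative of `ζ ↦ F(ζz)` is `∑ z_j (∂_j F)(ζz)`. Taking the `m`-th coefficient
    -- polynomials of the partial derivatives gives the next one as `∑ X_j p_j`.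
    choose p hp hpe using fun j : Fin n => ih _ (differentiableOn_fderiv_apply hU hF (Pi.single j 1))
    refine ⟨∑ j, MvPolynomial.X j * p j, MvPolynomial.IsHomogeneous.sum _ _ _ fun j _ => ?_,
      fun z => ?_⟩
    · rw [add_comm]
      exact (MvPolynomial.isHomogeneous_X ℂ j).mul (hp j)
    · have h1 : deriv (fun ζ : ℂ => F (ζ • z)) =ᶠ[𝓝 0]
          fun ζ => ∑ j, z j * fderiv ℂ F (ζ • z) (Pi.single j 1) := by
        filter_upwards [hnear z] with ζ hζ
        rw [(hderiv hF hζ).deriv]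
        conv_lhs => rw [pi_eq_sum_univ' z]
        rw [map_sum]
        refine Finset.sum_congr rfl fun j _ => ?_
        rw [map_smul, smul_eq_mul]
        congr 3
        funext i
        simp [Pi.single_apply]
      rw [iteratedDeriv_succ', h1.iteratedDeriv_eq, iteratedDeriv_fun_sum, map_sum]
      · refine Finset.sum_congr rfl fun j _ => ?_
        rw [iteratedDeriv_const_mul_field, hpe, map_mul, MvPolynomial.eval_X]
      · intro j _
        have h2 : AnalyticAt ℂ (fun ζ : ℂ => fderiv ℂ F (ζ • z) (Pi.single j 1)) 0 := by
          rw [Complex.analyticAt_iff_eventually_differentiableAt]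
          filter_upwards [hnear z] with ζ hζ
          exact (hderiv (differentiableOn_fderiv_apply hU hF (Pi.single j 1)) hζ).differentiableAt
        exact contDiffAt_const.mul h2.contDiffAt

end Holomorphic

/-! ## Averages over circles -/

section CircleAverage

open Metric Filter Topology

variable {n : ℕ}

lemma circleMap_unit_mem (θ : ℝ) : ∃ t : Circle, (t : ℂ) = circleMap 0 1 θ :=
  ⟨Circle.exp θ, by simp [circleMap, Circle.coe_exp]⟩

/-- For a rotation-invariant measure, an integral does not change when the integrand is averaged
over circles. -/
theorem integral_eq_integral_circleAverage (μ : Measure (Fin n → ℂ)) [SFinite μ]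
    (hμ : ∀ t : Circle, MeasurePreserving (fun z => (t : ℂ) • z) μ μ) {G : (Fin n → ℂ) → ℂ}
    (hG : Measurable G) (hint : Integrable G μ) :
    ∫ z, G z ∂μ = ∫ z, Real.circleAverage (fun ζ : ℂ => G (ζ • z)) 0 1 ∂μ := by
  have hcomp : ∀ θ : ℝ, ∫ z, G (circleMap 0 1 θ • z) ∂μ = ∫ z, G z ∂μ ∧
      ∫ z, ‖G (circleMap 0 1 θ • z)‖ ∂μ = ∫ z, ‖G z‖ ∂μ ∧
      Integrable (fun z => G (circleMap 0 1 θ • z)) μ := by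
    intro θ
    obtain ⟨t, ht⟩ := circleMap_unit_mem θ
    rw [← ht]
    have h1 : AEStronglyMeasurable G (μ.map fun z => (t : ℂ) • z) :=
      hG.aestronglyMeasurable
    refine ⟨?_, ?_, (hμ t).integrable_comp_of_integrable hint⟩
    · rw [← integral_map (hμ t).measurable.aemeasurable h1, (hμ t).map_eq]
    · rw [← integral_map (hμ t).measurable.aemeasurable h1.norm, (hμ t).map_eq]
  have h2π : (0 : ℝ) ≤ 2 * Real.pi := by positivity
  -- The integral of `‖G‖` over `z` is the same for every angle, which gives the joint integrability
  -- required by Fubini.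
  have hjoint : Integrable (Function.uncurry fun (θ : ℝ) (z : Fin n → ℂ) => G (circleMap 0 1 θ • z))
      ((volume.restrict (Set.Ioc 0 (2 * Real.pi))).prod μ) := by
    have hmeas : Measurable (Function.uncurry
        fun (θ : ℝ) (z : Fin n → ℂ) => G (circleMap 0 1 θ • z)) := by
      refine hG.comp (Continuous.measurable ?_)
      exact ((continuous_circleMap 0 1).comp continuous_fst).smul continuous_snd
    rw [integrable_prod_iff hmeas.aestronglyMeasurable]
    refine ⟨Eventually.of_forall fun θ => (hcomp θ).2.2, ?_⟩
    simp only [Function.uncurry_apply_pair, (hcomp _).2.1]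
    exact integrable_const _
  simp only [Real.circleAverage, intervalIntegral.integral_of_le h2π]
  rw [integral_smul, ← integral_integral_swap hjoint]
  simp only [(hcomp _).1]
  rw [setIntegral_const, smul_smul]
  simp [Measure.real]
  rw [ENNReal.toReal_ofReal Real.pi_pos.le]
  field_simp

lemma measurePreserving_smul_volume (t : Circle) :
    MeasurePreserving (fun z : Fin n → ℂ => (t : ℂ) • z) volume volume := by
  have h := measurePreserving_act_volume (n := n) (1, t)
  have h1 : (act n (1, t) : (Fin n → ℂ) → Fin n → ℂ) = fun z => (t : ℂ) • z := by
    funext z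
    simp [act_apply]
  rwa [h1] at h

lemma measurable_indicator_of_continuousOn {X : Type*} [TopologicalSpace X] [MeasurableSpace X]
    [BorelSpace X] {G : X → ℂ} {s : Set X} (hs : MeasurableSet s) (hG : ContinuousOn G s) :
    Measurable (s.indicator G) := by
  classical
  rw [← Set.piecewise_eq_indicator]
  exact hG.measurable_piecewise continuousOn_const hs

/-- The mean value property of holomorphic functions on balls. -/
theorem norm_mul_volume_le {U : Set (Fin n → ℂ)} {F : (Fin n → ℂ) → ℂ}
    (hF : DifferentiableOn ℂ F U) {z₀ : Fin n → ℂ} {r : ℝ}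
    (hball : closedBall z₀ r ⊆ U) :
    ‖F z₀‖ * (volume (ball (0 : Fin n → ℂ) r)).toReal ≤ ∫ w in ball z₀ r, ‖F w‖ := by
  have hU : ∀ z ∈ closedBall (0 : Fin n → ℂ) r, z₀ + z ∈ U := fun z hz => hball (by
    simpa [dist_eq_norm] using hz)
  have hcont : ContinuousOn (fun z => F (z₀ + z)) (closedBall 0 r) :=
    hF.continuousOn.comp (by fun_prop) hU
  have hint : IntegrableOn (fun z => F (z₀ + z)) (ball 0 r) :=
    (hcont.integrableOn_compact (isCompact_closedBall _ _)).mono_set ball_subset_closedBall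
  -- The ball is invariant under unit scalars, and the one-variable mean value property on `ζ ↦ F(z₀
  -- + ζz)` replaces `F` by its value at the centre.
  have havg : ∀ z, Real.circleAverage
      (fun ζ : ℂ => (ball 0 r).indicator (fun z => F (z₀ + z)) (ζ • z)) 0 1 =
        (ball 0 r).indicator (fun _ => F z₀) z := by
    intro z
    have hiff : ∀ ζ ∈ sphere (0 : ℂ) 1, (ζ • z ∈ ball (0 : Fin n → ℂ) r ↔ z ∈ ball 0 r) := by
      intro ζ hζ
      have : ‖ζ‖ = 1 := by simpa using hζ
      simp [norm_smul, this]
    by_cases hz : z ∈ ball (0 : Fin n → ℂ) r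
    · rw [Set.indicator_of_mem hz]
      have hz' : ‖z‖ < r := by simpa using hz
      have hmem : ∀ ζ ∈ closedBall (0 : ℂ) 1, z₀ + ζ • z ∈ U := by
        intro ζ hζ
        have : ‖ζ‖ ≤ 1 := by simpa using hζ
        refine hU _ ?_
        rw [mem_closedBall_zero_iff, norm_smul]
        nlinarith [norm_nonneg z]
      have h1 : Real.circleAverage (fun ζ : ℂ => F (z₀ + ζ • z)) 0 1 = F (z₀ + (0 : ℂ) • z) := by
        refine circleAverage_of_differentiable_on_off_countable (s := ∅) Set.countable_empty ?_ ?_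
        · rw [abs_one]
          exact hF.continuousOn.comp (by fun_prop) hmem
        · rw [abs_one]
          intro ζ hζ
          have h2 : ∀ᶠ w : ℂ in 𝓝 ζ, z₀ + w • z ∈ ball z₀ r := by
            have hc : ContinuousAt (fun w : ℂ => z₀ + w • z) ζ := by fun_prop
            refine hc.eventually_mem (isOpen_ball.mem_nhds ?_)
            have h3 : ‖ζ‖ < 1 := by simpa using hζ.1
            rw [mem_ball_iff_norm, add_sub_cancel_left, norm_smul]
            nlinarith [norm_nonneg z]
          have h4 : DifferentiableAt ℂ F (z₀ + ζ • z) :=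
            (hF.mono (ball_subset_closedBall.trans hball)).differentiableAt
              (isOpen_ball.mem_nhds h2.self_of_nhds)
          exact h4.comp ζ (by fun_prop)
      rw [zero_smul, add_zero] at h1
      rw [← h1]
      refine Real.circleAverage_congr_sphere fun ζ hζ => ?_
      rw [abs_one] at hζ
      exact Set.indicator_of_mem ((hiff ζ hζ).2 hz) _
    · have h1 : Real.circleAverage (fun _ : ℂ => (0 : ℂ)) 0 1 = 0 := by simp [Real.circleAverage]
      rw [Set.indicator_of_notMem hz]
      refine Eq.trans ?_ h1
      refine Real.circleAverage_congr_sphere fun ζ hζ => ?_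
      rw [abs_one] at hζ
      exact Set.indicator_of_notMem (fun h => hz ((hiff ζ hζ).1 h)) _
  have hmain := integral_eq_integral_circleAverage volume measurePreserving_smul_volume
    (measurable_indicator_of_continuousOn measurableSet_ball
      (hcont.mono ball_subset_closedBall)) (hint.integrable_indicator measurableSet_ball)
  simp only [havg] at hmain
  rw [integral_indicator measurableSet_ball, integral_indicator measurableSet_ball,
    setIntegral_const] at hmain
  have h5 : ‖F z₀‖ * (volume (ball (0 : Fin n → ℂ) r)).toReal = ‖∫ z in ball 0 r, F (z₀ + z)‖ := by
    rw [hmain, norm_smul, mul_comm]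
    simp [Measure.real]
  rw [h5]
  refine (norm_integral_le_integral_norm _).trans (le_of_eq ?_)
  have hmp : MeasurePreserving (fun z : Fin n → ℂ => z₀ + z) volume volume :=
    measurePreserving_add_left volume z₀
  have hpre : (fun z : Fin n → ℂ => z₀ + z) ⁻¹' ball z₀ r = ball 0 r := by
    ext z
    simp
  rw [← hpre]
  exact hmp.setIntegral_preimage_emb (measurableEmbedding_addLeft z₀) (fun w => ‖F w‖) _

end CircleAverage

/-! ## Finiteness of the weighted measures -/

section Finiteness

open Set

/-- The function `(ρ - |u|²)ᵃ` on the disc `|u|² < ρ`. -/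
def discWeight (a ρ : ℝ) : ℂ → ℝ≥0∞ :=
  indicator {u | ‖u‖ ^ 2 < ρ} fun u => ENNReal.ofReal ((ρ - ‖u‖ ^ 2) ^ a)

lemma measurable_discWeight (a ρ : ℝ) : Measurable (discWeight a ρ) := by
  refine Measurable.indicator ?_ (measurableSet_lt (by fun_prop) measurable_const)
  exact ((measurable_const.sub (by fun_prop)).pow_const a).ennreal_ofReal

/-- A bound for the integral of `discWeight`. -/
def discBound (a : ℝ) : ℝ≥0∞ :=
  (∫⁻ s in Ioo (0 : ℝ) 1, ENNReal.ofReal (s ^ a)) * volume (Ioo (-Real.pi) Real.pi)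

lemma discBound_lt_top {a : ℝ} (ha : -1 < a) : discBound a < ∞ := by
  refine ENNReal.mul_lt_top ?_ (by simp)
  have h1 : IntegrableOn (fun s : ℝ => s ^ a) (Ioo 0 1) :=
    ((intervalIntegral.intervalIntegrable_rpow' ha (a := 0) (b := 1)).1).mono_set Ioo_subset_Ioc_self
  have h2 := h1.2
  rw [hasFiniteIntegral_iff_norm] at h2
  refine (lintegral_mono fun s => ?_).trans_lt h2
  exact ENNReal.ofReal_le_ofReal (le_abs_self _)

/-- In polar coordinates with `R = √ρ` one has `ρ - r² ≥ r (R - r)`. For `-1 < a ≤ 0` the radial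
integrand is therefore at most `r^(1+a) (R-r)^a ≤ (R-r)^a`, which is integrable. The point is that
the bound does not depend on `ρ`. -/
lemma lintegral_discWeight_le {a ρ : ℝ} (ha : -1 < a) (ha0 : a ≤ 0) (hρ : ρ ≤ 1) :
    ∫⁻ u, discWeight a ρ u ≤ discBound a := by
  by_cases hρ0 : ρ ≤ 0
  · have : ∀ u, discWeight a ρ u = 0 := fun u =>
      indicator_of_notMem (by rw [mem_ofPred_eq, not_lt]; exact hρ0.trans (by positivity)) _
    simp [this]
  push Not at hρ0
  set R := √ρ with hR
  have hR0 : 0 < R := Real.sqrt_pos.2 hρ0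
  have hRR : R ^ 2 = ρ := Real.sq_sqrt hρ0.le
  have hR1 : R ≤ 1 := Real.sqrt_le_one.2 hρ
  have hpt : ∀ p ∈ polarCoord.target, ENNReal.ofReal p.1 • discWeight a ρ (Complex.polarCoord.symm p) ≤
      (Ioo 0 1).indicator (fun s => ENNReal.ofReal (s ^ a)) (R - p.1) := by
    rintro ⟨r, θ⟩ hp
    have hr : 0 < r := hp.1
    have hn : ‖Complex.polarCoord.symm (r, θ)‖ = r := by
      rw [Complex.norm_polarCoord_symm, abs_of_pos hr]
    by_cases hlt : r < R
    · have hmem : R - r ∈ Ioo (0 : ℝ) 1 := ⟨by linarith, by linarith⟩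
      rw [indicator_of_mem hmem, discWeight, indicator_of_mem (by
        rw [mem_ofPred_eq, hn, ← hRR]; gcongr), hn, smul_eq_mul, ← ENNReal.ofReal_mul hr.le]
      refine ENNReal.ofReal_le_ofReal ?_
      have h1 : r * (R - r) ≤ ρ - r ^ 2 := by nlinarith
      have h2 : (ρ - r ^ 2) ^ a ≤ (r * (R - r)) ^ a :=
        Real.rpow_le_rpow_of_nonpos (mul_pos hr hmem.1) h1 ha0
      calc r * (ρ - r ^ 2) ^ a ≤ r * (r * (R - r)) ^ a := by gcongr
        _ = r ^ (1 + a) * (R - r) ^ a := by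
            rw [Real.mul_rpow hr.le hmem.1.le, Real.rpow_add hr, Real.rpow_one, mul_assoc]
        _ ≤ 1 * (R - r) ^ a := by
            refine mul_le_mul_of_nonneg_right ?_ (Real.rpow_nonneg hmem.1.le a)
            exact Real.rpow_le_one hr.le (by linarith) (by linarith)
        _ = (R - r) ^ a := one_mul _
    · rw [discWeight, indicator_of_notMem (by
        rw [mem_ofPred_eq, hn, ← hRR, not_lt]
        push Not at hlt
        gcongr), smul_zero]
      exact zero_le
  rw [← Complex.lintegral_comp_polarCoord_symm]
  refine (setLIntegral_mono' polarCoord.open_target.measurableSet hpt).trans ?_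
  have hmeas : Measurable (fun r : ℝ =>
      (Ioo (0 : ℝ) 1).indicator (fun s => ENNReal.ofReal (s ^ a)) (R - r)) := by
    have : Measurable ((Ioo (0 : ℝ) 1).indicator fun s : ℝ => ENNReal.ofReal (s ^ a)) :=
      (measurable_id.pow_const a).ennreal_ofReal.indicator measurableSet_Ioo
    exact this.comp (measurable_const.sub measurable_id)
  rw [polarCoord_target, Measure.volume_eq_prod, ← Measure.prod_restrict,
    lintegral_prod (fun p : ℝ × ℝ => (Ioo (0 : ℝ) 1).indicator (fun s => ENNReal.ofReal (s ^ a))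
      (R - p.1)) (hmeas.comp measurable_fst).aemeasurable]
  simp only [lintegral_const, Measure.restrict_apply MeasurableSet.univ, univ_inter]
  rw [lintegral_mul_const _ hmeas, discBound]
  refine mul_le_mul_left ?_ _
  refine (setLIntegral_le_lintegral _ _).trans ?_
  rw [lintegral_sub_left_eq_self (μ := volume)
    ((Ioo (0 : ℝ) 1).indicator fun s : ℝ => ENNReal.ofReal (s ^ a)) R,
    lintegral_indicator measurableSet_Ioo]

lemma norm_quad_le {n : ℕ} (z : Fin n → ℂ) : ‖quad z‖ ≤ normSq z := by
  refine (norm_sum_le _ _).trans (le_of_eq ?_)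
  simp [normSq]

lemma normSq_nonneg {n : ℕ} (z : Fin n → ℂ) : 0 ≤ normSq z :=
  Finset.sum_nonneg fun i _ => by positivity

lemma mem_closedBall_of_normSq_le {n : ℕ} {z : Fin n → ℂ} (hz : normSq z ≤ 1) :
    z ∈ Metric.closedBall (0 : Fin n → ℂ) 1 := by
  rw [mem_closedBall_zero_iff, pi_norm_le_iff_of_nonneg zero_le_one]
  intro i
  have h1 : ‖z i‖ ^ 2 ≤ normSq z :=
    Finset.single_le_sum (f := fun i => ‖z i‖ ^ 2) (fun j _ => by positivity) (Finset.mem_univ i)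
  nlinarith [norm_nonneg (z i)]

lemma volume_domain_lt_top (n : ℕ) : volume (domain n) < ∞ :=
  (measure_mono fun _ hz => mem_closedBall_of_normSq_le (le_of_lt hz.1)).trans_lt
    (isCompact_closedBall (0 : Fin n → ℂ) 1).measure_lt_top

lemma jordanDelta_pos {n : ℕ} {z : Fin n → ℂ} (hz : z ∈ domain n) : 0 < jordanDelta z := by
  have := hz.2
  unfold jordanDelta
  linarith

lemma jordanDelta_le_one {n : ℕ} {z : Fin n → ℂ} (hz : z ∈ domain n) : jordanDelta z ≤ 1 := by
  have h1 := hz.1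
  have h2 := norm_quad_le z
  have h3 := norm_nonneg (quad z)
  unfold jordanDelta
  nlinarith

variable {k : ℕ}

/-- The linear change of coordinates in which `z₀ ± i z₁` become coordinate functions. -/
def isotropicCoord (k : ℕ) : (Fin (k + 2) → ℂ) →ₗ[ℂ] (Fin (k + 2) → ℂ) where
  toFun w := Fin.cons ((w 0 + w 1) / 2) (Fin.cons ((w 0 - w 1) / (2 * Complex.I))
    (fun i => w i.succ.succ) : Fin (k + 1) → ℂ)
  map_add' w v := by
    funext i
    refine Fin.cases ?_ (fun i => Fin.cases ?_ (fun i => ?_) i) i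
    · simp; ring
    · simp; ring
    · simp
  map_smul' c w := by
    funext i
    refine Fin.cases ?_ (fun i => Fin.cases ?_ (fun i => ?_) i) i
    · simp; ring
    · simp; ring
    · simp

lemma quad_isotropicCoord (w : Fin (k + 2) → ℂ) :
    quad (isotropicCoord k w) = w 0 * w 1 + quad fun i : Fin k => w i.succ.succ := by
  simp only [quad, isotropicCoord, LinearMap.coe_mk, AddHom.coe_mk, Fin.sum_univ_succ, Fin.cons_zero,
    Fin.cons_succ]
  rw [← add_assoc]
  congr 1
  rw [div_pow, div_pow, mul_pow, Complex.I_sq]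
  ring

lemma normSq_isotropicCoord (w : Fin (k + 2) → ℂ) :
    normSq (isotropicCoord k w) = (‖w 0‖ ^ 2 + ‖w 1‖ ^ 2) / 2 +
      normSq fun i : Fin k => w i.succ.succ := by
  simp only [normSq, isotropicCoord, LinearMap.coe_mk, AddHom.coe_mk, Fin.sum_univ_succ,
    Fin.cons_zero, Fin.cons_succ]
  rw [← add_assoc]
  congr 1
  rw [norm_div, norm_div, norm_mul, Complex.norm_I, mul_one, RCLike.norm_ofNat, div_pow, div_pow]
  simp only [← Complex.normSq_eq_norm_sq, Complex.normSq_apply, Complex.add_re, Complex.add_im,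
    Complex.sub_re, Complex.sub_im]
  ring

lemma det_isotropicCoord_ne_zero : LinearMap.det ((isotropicCoord k).restrictScalars ℝ) ≠ 0 := by
  have hinj : LinearMap.ker ((isotropicCoord k).restrictScalars ℝ) = ⊥ := by
    rw [LinearMap.ker_eq_bot']
    intro w hw
    have h : isotropicCoord k w = 0 := hw
    have h0 : (w 0 + w 1) / 2 = 0 := congrFun h 0
    have h1 : (w 0 - w 1) / (2 * Complex.I) = 0 := congrFun h 1
    have h2 : ∀ i : Fin k, w i.succ.succ = 0 := fun i => congrFun h i.succ.succ
    have h0' : w 0 + w 1 = 0 := by simpa using h0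
    have h1' : w 0 - w 1 = 0 := by simpa using h1
    funext i
    refine Fin.cases ?_ (fun i => Fin.cases ?_ (fun i => ?_) i) i
    · have : 2 * w 0 = 0 := by linear_combination h0' + h1'
      simpa using this
    · have : 2 * w 1 = 0 := by linear_combination h0' - h1'
      simpa using this
    · exact h2 i
  exact ((LinearMap.isUnit_iff_ker_eq_bot _).2 hinj).map LinearMap.det |>.ne_zero

/-- The centre of the discs that are the sections of the domain in isotropic coordinates. -/
def sectionCenter (w : Fin (k + 1) → ℂ) : ℂ :=
  (starRingEnd ℂ (w 0) * quad fun i : Fin k => w i.succ) / ((1 - ‖w 0‖ ^ 2 : ℝ) : ℂ)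

/-- The squared radius of the discs that are the sections of the domain in isotropic
coordinates. -/
def sectionRadiusSq (w : Fin (k + 1) → ℂ) : ℝ :=
  1 - 2 * (normSq fun i : Fin k => w i.succ) / (1 - ‖w 0‖ ^ 2) +
    ‖quad fun i : Fin k => w i.succ‖ ^ 2 / (1 - ‖w 0‖ ^ 2) ^ 2

/-- Completing the square: in isotropic coordinates `Δ` is quadratic in `w 0` with leading term `-(1
- |w 1|²) |w 0|²`, so its positivity sets over fixed remaining coordinates are discs. -/
lemma jordanDelta_isotropicCoord (w : Fin (k + 2) → ℂ) (hw : ‖w 1‖ ^ 2 < 1) :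
    jordanDelta (isotropicCoord k w) = (1 - ‖w 1‖ ^ 2) *
      (sectionRadiusSq (Fin.tail w) - ‖w 0 - sectionCenter (Fin.tail w)‖ ^ 2) := by
  have hb : (1 - ‖w 1‖ ^ 2) ≠ 0 := by linarith
  have h1 : Fin.tail w 0 = w 1 := rfl
  have h2 : ∀ i : Fin k, Fin.tail w i.succ = w i.succ.succ := fun i => rfl
  rw [jordanDelta, quad_isotropicCoord, normSq_isotropicCoord, sectionRadiusSq, sectionCenter]
  simp only [h1, h2]
  set p := normSq fun i : Fin k => w i.succ.succ
  set q := quad fun i : Fin k => w i.succ.succ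
  set b := 1 - ‖w 1‖ ^ 2 with hbdef
  have hb1 : ‖w 1‖ ^ 2 = 1 - b := by rw [hbdef]; ring
  have h3 : ‖w 0 - starRingEnd ℂ (w 1) * q / (b : ℂ)‖ ^ 2 = ‖w 0‖ ^ 2 -
      2 * ((w 0 * (w 1 * starRingEnd ℂ q)).re) / b + (1 - b) * ‖q‖ ^ 2 / b ^ 2 := by
    rw [← hb1]
    simp only [← Complex.normSq_eq_norm_sq, Complex.normSq_apply, Complex.sub_re, Complex.sub_im,
      Complex.div_ofReal_re, Complex.div_ofReal_im, Complex.mul_re, Complex.mul_im, Complex.conj_re,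
      Complex.conj_im]
    field_simp
    ring
  have h4 : ‖w 0 * w 1 + q‖ ^ 2 = ‖w 0‖ ^ 2 * (1 - b) + ‖q‖ ^ 2 +
      2 * ((w 0 * (w 1 * starRingEnd ℂ q)).re) := by
    rw [← hb1]
    simp only [← Complex.normSq_eq_norm_sq, Complex.normSq_apply, Complex.add_re, Complex.add_im,
      Complex.mul_re, Complex.mul_im, Complex.conj_re, Complex.conj_im]
    ring
  rw [h3, h4, hb1]
  field_simp
  ring

/-- With `α = |w 0|`, `β = |w 1|` and `p` the squared norm of the rest, the conditions give `|α - β|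
< 1 - αβ - p`. Hence `p < (1-α)(1+β)` and `p < (1+α)(1-β)`. The second yields `β < 1`, and the
smaller of the two bounds is at most `1 - β²`. -/
lemma normSq_tail_lt_of_mem_domain {w : Fin (k + 2) → ℂ} (hw : isotropicCoord k w ∈ domain (k + 2)) :
    ‖w 1‖ < 1 ∧ (normSq fun i : Fin k => w i.succ.succ) < 1 - ‖w 1‖ ^ 2 := by
  obtain ⟨h1, h2⟩ := hw
  rw [normSq_isotropicCoord] at h1 h2
  rw [quad_isotropicCoord] at h2
  have h3 := norm_quad_le fun i : Fin k => w i.succ.succ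
  have hp := normSq_nonneg fun i : Fin k => w i.succ.succ
  have h4 : ‖w 0 * w 1 + quad fun i : Fin k => w i.succ.succ‖ ≤
      ‖w 0‖ * ‖w 1‖ + normSq fun i : Fin k => w i.succ.succ :=
    (norm_add_le _ _).trans (by rw [norm_mul]; gcongr)
  set p := normSq fun i : Fin k => w i.succ.succ
  set α := ‖w 0‖
  set β := ‖w 1‖
  have hα : 0 ≤ α := norm_nonneg _
  have hβ : 0 ≤ β := norm_nonneg _
  have h5 := pow_le_pow_left₀ (norm_nonneg _) h4 2
  have h6 : (α - β) ^ 2 < (1 - α * β - p) ^ 2 := by nlinarith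
  have h7 : 0 < 1 - α * β - p := by nlinarith [sq_nonneg (α - β)]
  have h8 := abs_lt_of_sq_lt_sq h6 h7.le
  obtain ⟨h9, h10⟩ := abs_lt.1 h8
  have hβ1 : β < 1 := by nlinarith
  refine ⟨hβ1, ?_⟩
  rcases le_total α β with h | h
  · nlinarith
  · nlinarith

/-- The majorant is a product suited to integration over `w 0` first. On the domain the squared
radius is at most 1; the minimum with 1 makes the uniform disc bound available for all values of the
other coordinates. -/
lemma indicator_domain_le (a : ℝ) (w : Fin (k + 2) → ℂ) :
    (domain (k + 2)).indicator (fun z => ENNReal.ofReal (jordanDelta z ^ a)) (isotropicCoord k w) ≤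
      discWeight a (min (sectionRadiusSq (Fin.tail w)) 1) (w 0 - sectionCenter (Fin.tail w)) *
        (discWeight a 1 (w 1) *
          (Metric.closedBall 0 1).indicator 1 (fun i : Fin k => w i.succ.succ)) := by
  by_cases hw : isotropicCoord k w ∈ domain (k + 2)
  · obtain ⟨hβ, hp⟩ := normSq_tail_lt_of_mem_domain hw
    have hβ2 : ‖w 1‖ ^ 2 < 1 := by nlinarith [norm_nonneg (w 1)]
    have hb : 0 < 1 - ‖w 1‖ ^ 2 := by linarith
    have hΔ := jordanDelta_isotropicCoord w hβ2
    have hpos := jordanDelta_pos hw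
    rw [hΔ] at hpos
    have hpos2 : 0 < sectionRadiusSq (Fin.tail w) - ‖w 0 - sectionCenter (Fin.tail w)‖ ^ 2 :=
      (mul_pos_iff_of_pos_left hb).1 hpos
    have hp0 := normSq_nonneg fun i : Fin k => w i.succ.succ
    have hρ : sectionRadiusSq (Fin.tail w) ≤ 1 := by
      have hq := norm_quad_le fun i : Fin k => w i.succ.succ
      have hq0 := norm_nonneg (quad fun i : Fin k => w i.succ.succ)
      have h1 : sectionRadiusSq (Fin.tail w) =
          1 - 2 * (normSq fun i : Fin k => w i.succ.succ) / (1 - ‖w 1‖ ^ 2) +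
          ‖quad fun i : Fin k => w i.succ.succ‖ ^ 2 / (1 - ‖w 1‖ ^ 2) ^ 2 := rfl
      rw [h1]
      set p := normSq fun i : Fin k => w i.succ.succ
      set b := 1 - ‖w 1‖ ^ 2
      have h2 : ‖quad fun i : Fin k => w i.succ.succ‖ ^ 2 / b ^ 2 ≤ 2 * p / b := by
        rw [div_le_div_iff₀ (by positivity) hb]
        have h5 : ‖quad fun i : Fin k => w i.succ.succ‖ ^ 2 ≤ p ^ 2 := by gcongr
        have h6 : p ^ 2 ≤ 2 * p * b := by nlinarith
        calc _ ≤ (2 * p * b) * b := by gcongr; exact h5.trans h6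
          _ = 2 * p * b ^ 2 := by ring
      linarith
    rw [indicator_of_mem hw, min_eq_left hρ, discWeight, discWeight,
      indicator_of_mem (by rw [mem_ofPred_eq]; linarith), indicator_of_mem (by exact hβ2),
      indicator_of_mem (mem_closedBall_of_normSq_le (by nlinarith [sq_nonneg ‖w 1‖])), hΔ,
      Pi.one_apply, mul_one, Real.mul_rpow hb.le hpos2.le, mul_comm,
      ENNReal.ofReal_mul (Real.rpow_nonneg hpos2.le a)]
  · rw [indicator_of_notMem hw]
    exact zero_le

lemma lintegral_piFinSucc {m : ℕ} {f : (Fin (m + 1) → ℂ) → ℝ≥0∞} (hf : Measurable f) :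
    ∫⁻ w, f w = ∫⁻ v : Fin m → ℂ, ∫⁻ u : ℂ, f (Fin.cons u v) := by
  have h := (volume_preserving_piFinSuccAbove (fun _ : Fin (m + 1) => ℂ) 0).symm
  rw [← h.lintegral_comp hf, Measure.volume_eq_prod, lintegral_prod_symm]
  · simp [MeasurableEquiv.piFinSuccAbove_symm_apply, Fin.insertNthEquiv]
  · exact (hf.comp h.measurable).aemeasurable

lemma measurable_density (n : ℕ) (a : ℝ) :
    Measurable (fun z : Fin n → ℂ => ENNReal.ofReal (jordanDelta z ^ a)) :=
  (continuous_jordanDelta.measurable.pow_const _).ennreal_ofReal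

/-- For `a ≥ 0` the integrand is at most 1 on a set of finite volume. For `a ≤ 0`, in isotropic
coordinates, the integral over `w 0` is bounded uniformly after a translation, that over `w 1` is a
disc integral, and the other coordinates stay in a ball. The change of coordinates contributes a
non-zero constant factor. -/
theorem lintegral_jordanDelta_lt_top {a : ℝ} (ha : -1 < a) :
    ∫⁻ z in domain (k + 2), ENNReal.ofReal (jordanDelta z ^ a) < ∞ := by
  have hD : MeasurableSet (domain (k + 2)) := (isOpen_domain _).measurableSet
  rcases le_total 0 a with ha0 | ha0
  · calc ∫⁻ z in domain (k + 2), ENNReal.ofReal (jordanDelta z ^ a)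
        ≤ ∫⁻ z in domain (k + 2), 1 := setLIntegral_mono' hD fun z hz => by
          rw [← ENNReal.ofReal_one]
          exact ENNReal.ofReal_le_ofReal
            (Real.rpow_le_one (jordanDelta_pos hz).le (jordanDelta_le_one hz) ha0)
      _ < ∞ := by simpa using volume_domain_lt_top (k + 2)
  set g : (Fin (k + 2) → ℂ) → ℝ≥0∞ :=
    (domain (k + 2)).indicator fun z => ENNReal.ofReal (jordanDelta z ^ a) with hg
  have hgm : Measurable g := (measurable_density _ a).indicator hD
  set L := (isotropicCoord k).restrictScalars ℝ with hL
  have hLm : Measurable L := (LinearMap.continuous_of_finiteDimensional L).measurable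
  have h1 : ∫⁻ w, g (L w) < ∞ := by
    have hB : MeasurableSet (Metric.closedBall (0 : Fin k → ℂ) 1) :=
      Metric.isClosed_closedBall.measurableSet
    have hm2 : Measurable fun w : Fin (k + 1) → ℂ => discWeight a 1 (w 0) *
        (Metric.closedBall (0 : Fin k → ℂ) 1).indicator 1 (fun i : Fin k => w i.succ) := by
      refine ((measurable_discWeight a 1).comp (measurable_pi_apply 0)).mul ?_
      exact (measurable_one.indicator hB).comp
        (measurable_pi_lambda _ fun i => measurable_pi_apply _)
    rw [lintegral_piFinSucc (f := fun w => g (L w)) (hgm.comp hLm)]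
    calc ∫⁻ v : Fin (k + 1) → ℂ, ∫⁻ u : ℂ, g (L (Fin.cons u v))
        ≤ ∫⁻ v : Fin (k + 1) → ℂ, discBound a * (discWeight a 1 (v 0) *
          (Metric.closedBall (0 : Fin k → ℂ) 1).indicator 1 (fun i : Fin k => v i.succ)) := by
          refine lintegral_mono fun v => ?_
          calc ∫⁻ u : ℂ, g (L (Fin.cons u v))
              ≤ ∫⁻ u : ℂ, discWeight a (min (sectionRadiusSq v) 1) (u - sectionCenter v) *
                (discWeight a 1 (v 0) * (Metric.closedBall (0 : Fin k → ℂ) 1).indicator 1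
                  (fun i : Fin k => v i.succ)) := lintegral_mono fun u =>
                    indicator_domain_le a (Fin.cons u v)
            _ = (∫⁻ u : ℂ, discWeight a (min (sectionRadiusSq v) 1) u) *
                (discWeight a 1 (v 0) * (Metric.closedBall (0 : Fin k → ℂ) 1).indicator 1
                  (fun i : Fin k => v i.succ)) := by
                have hm : Measurable fun u => discWeight a (min (sectionRadiusSq v) 1)
                    (u - sectionCenter v) :=
                  (measurable_discWeight _ _).comp (measurable_id.sub_const _)
                rw [lintegral_mul_const _ hm,
                  lintegral_sub_right_eq_self (discWeight a (min (sectionRadiusSq v) 1))]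
            _ ≤ _ := by
                gcongr
                exact lintegral_discWeight_le ha ha0 (min_le_right _ _)
      _ < ∞ := by
          rw [lintegral_const_mul _ hm2, lintegral_piFinSucc hm2]
          refine ENNReal.mul_lt_top (discBound_lt_top ha) ?_
          simp only [Fin.cons_zero, Fin.cons_succ]
          simp_rw [lintegral_mul_const _ (measurable_discWeight a 1)]
          rw [lintegral_const_mul _ (measurable_one.indicator hB), lintegral_indicator_one hB]
          exact ENNReal.mul_lt_top
            ((lintegral_discWeight_le ha ha0 le_rfl).trans_lt (discBound_lt_top ha))
            (isCompact_closedBall (0 : Fin k → ℂ) 1).measure_lt_top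
  rw [← lintegral_indicator hD]
  have h2 := Measure.map_linearMap_addHaar_eq_smul_addHaar
    (μ := (volume : Measure (Fin (k + 2) → ℂ))) (det_isotropicCoord_ne_zero (k := k))
  have h3 : ∫⁻ w, g (L w) = ENNReal.ofReal |(LinearMap.det L)⁻¹| * ∫⁻ z, g z := by
    rw [← lintegral_map hgm hLm, hL, h2, lintegral_smul_measure, smul_eq_mul]
  rw [h3] at h1
  have h4 : ENNReal.ofReal |(LinearMap.det L)⁻¹| ≠ 0 := by
    simpa using det_isotropicCoord_ne_zero (k := k)
  exact (ENNReal.mul_lt_top_iff.1 h1).elim (fun h => h.2) fun h => h.elim (fun h => absurd h h4)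
    fun h => h ▸ ENNReal.zero_lt_top

end Finiteness

/-! ## The weighted Bergman spaces -/

section Bergman

open Metric Filter Topology Set

variable {n : ℕ} {lam : ℝ}

lemma zero_mem_domain (n : ℕ) : (0 : Fin n → ℂ) ∈ domain n := by
  simp [domain, normSq, quad]

lemma measurableSet_domain (n : ℕ) : MeasurableSet (domain n) := (isOpen_domain n).measurableSet

lemma preMeasure_univ (n : ℕ) (lam : ℝ) : preMeasure n lam univ =
    ∫⁻ z in domain n, ENNReal.ofReal (jordanDelta z ^ (lam - (n : ℝ))) := by
  rw [preMeasure, withDensity_apply _ MeasurableSet.univ, Measure.restrict_univ]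

lemma preMeasure_univ_ne_top (hn : 2 ≤ n) (hlam : (n : ℝ) - 1 < lam) :
    preMeasure n lam univ ≠ ∞ := by
  obtain ⟨k, rfl⟩ := Nat.exists_eq_add_of_le' hn
  rw [preMeasure_univ]
  exact (lintegral_jordanDelta_lt_top (by linarith)).ne

lemma restrict_absolutelyContinuous_preMeasure (n : ℕ) (lam : ℝ) :
    volume.restrict (domain n) ≪ preMeasure n lam := by
  refine withDensity_absolutelyContinuous' (measurable_density n _).aemeasurable ?_
  filter_upwards [ae_restrict_mem (measurableSet_domain n)] with z hz
  rw [Ne, ENNReal.ofReal_eq_zero, not_le]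
  exact Real.rpow_pos_of_pos (jordanDelta_pos hz) _

lemma preMeasure_univ_ne_zero (n : ℕ) (lam : ℝ) : preMeasure n lam univ ≠ 0 := by
  intro h
  have h1 := restrict_absolutelyContinuous_preMeasure n lam h
  rw [Measure.restrict_apply_univ] at h1
  exact ((isOpen_domain n).measure_pos volume ⟨0, zero_mem_domain n⟩).ne' h1

theorem isProbabilityMeasure_weightedMeasure (hn : 2 ≤ n) (hlam : (n : ℝ) - 1 < lam) :
    IsProbabilityMeasure (weightedMeasure n lam) := by
  refine ⟨?_⟩
  rw [weightedMeasure, Measure.smul_apply, smul_eq_mul]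
  exact ENNReal.inv_mul_cancel (preMeasure_univ_ne_zero n lam) (preMeasure_univ_ne_top hn hlam)

lemma ae_mem_domain (n : ℕ) (lam : ℝ) : ∀ᵐ z ∂weightedMeasure n lam, z ∈ domain n := by
  have h : weightedMeasure n lam ≪ volume.restrict (domain n) :=
    (Measure.smul_absolutelyContinuous).trans (withDensity_absolutelyContinuous _ _)
  exact h.ae_le (ae_restrict_mem (measurableSet_domain n))

variable [IsProbabilityMeasure (weightedMeasure n lam)]

lemma preMeasure_univ_ne_top' : preMeasure n lam univ ≠ ∞ := by
  intro h
  have := IsProbabilityMeasure.measure_univ (μ := weightedMeasure n lam)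
  rw [weightedMeasure, h, ENNReal.inv_top, zero_smul] at this
  simp at this

lemma restrict_absolutelyContinuous_weightedMeasure :
    volume.restrict (domain n) ≪ weightedMeasure n lam := by
  refine (restrict_absolutelyContinuous_preMeasure n lam).trans ?_
  exact Measure.absolutelyContinuous_smul (ENNReal.inv_ne_zero.2 preMeasure_univ_ne_top')

/-- On compact subsets of the domain, Lebesgue measure is bounded by the weighted measure. -/
lemma exists_restrict_le_smul_weightedMeasure {K : Set (Fin n → ℂ)} (hK : IsCompact K)
    (hKD : K ⊆ domain n) :
    ∃ C : ℝ≥0∞, C ≠ ∞ ∧ volume.restrict K ≤ C • weightedMeasure n lam := by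
  rcases K.eq_empty_or_nonempty with rfl | hne
  · exact ⟨0, by simp, by simp⟩
  have hcont : ContinuousOn (fun z : Fin n → ℂ => jordanDelta z ^ (lam - (n : ℝ))) K :=
    continuous_jordanDelta.continuousOn.rpow_const fun z hz =>
      Or.inl (jordanDelta_pos (hKD hz)).ne'
  obtain ⟨z₁, hz₁, hmin⟩ := hK.exists_isMinOn hne hcont
  set δ := jordanDelta z₁ ^ (lam - (n : ℝ)) with hδ
  have hδ0 : 0 < δ := Real.rpow_pos_of_pos (jordanDelta_pos (hKD hz₁)) _
  have hT0 := preMeasure_univ_ne_zero n lam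
  have hT : preMeasure n lam univ ≠ ∞ := preMeasure_univ_ne_top'
  have hδe : ENNReal.ofReal δ ≠ 0 := by simpa using hδ0
  refine ⟨(ENNReal.ofReal δ)⁻¹ * preMeasure n lam univ,
    ENNReal.mul_ne_top (ENNReal.inv_ne_top.2 hδe) hT, ?_⟩
  have h1 : (ENNReal.ofReal δ) • volume.restrict K ≤ preMeasure n lam := by
    refine Measure.le_iff.2 fun s hs => ?_
    rw [Measure.smul_apply, smul_eq_mul, Measure.restrict_apply hs, preMeasure,
      withDensity_apply _ hs, Measure.restrict_restrict hs]
    calc ENNReal.ofReal δ * volume (s ∩ K) = ∫⁻ _ in s ∩ K, ENNReal.ofReal δ := by simp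
      _ ≤ ∫⁻ z in s ∩ K, ENNReal.ofReal (jordanDelta z ^ (lam - (n : ℝ))) :=
          setLIntegral_mono' (hs.inter hK.measurableSet) fun z hz =>
            ENNReal.ofReal_le_ofReal (hmin hz.2)
      _ ≤ _ := lintegral_mono_set (inter_subset_inter_right s hKD)
  have h2 : preMeasure n lam = preMeasure n lam univ • weightedMeasure n lam := by
    rw [weightedMeasure, smul_smul, ENNReal.mul_inv_cancel hT0 hT, one_smul]
  have h3 : volume.restrict K =
      (ENNReal.ofReal δ)⁻¹ • ((ENNReal.ofReal δ) • volume.restrict K) := by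
    rw [smul_smul, ENNReal.inv_mul_cancel hδe ENNReal.ofReal_ne_top, one_smul]
  rw [h3, ← smul_smul, ← h2]
  refine Measure.le_iff.2 fun s hs => ?_
  simp only [Measure.smul_apply _ (preMeasure n lam), Measure.smul_apply _ (ENNReal.ofReal δ • _)]
  exact mul_le_mul_right (h1 s) _

/-- Point evaluations are locally uniformly bounded on the Bergman space. -/
theorem exists_norm_le_mul_norm {z₀ : Fin n → ℂ} (hz₀ : z₀ ∈ domain n) :
    ∃ r > 0, ∃ C : ℝ, 0 ≤ C ∧ ball z₀ r ⊆ domain n ∧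
      ∀ F : (Fin n → ℂ) → ℂ, DifferentiableOn ℂ F (domain n) →
      ∀ f : Lp ℂ 2 (weightedMeasure n lam), f =ᵐ[weightedMeasure n lam] F →
        ∀ z ∈ ball z₀ r, ‖F z‖ ≤ C * ‖f‖ := by
  obtain ⟨R, hR, hball⟩ := Metric.nhds_basis_closedBall.mem_iff.1
    ((isOpen_domain n).mem_nhds hz₀)
  obtain ⟨C, hC, hle⟩ := exists_restrict_le_smul_weightedMeasure (lam := lam)
    (isCompact_closedBall z₀ R) hball
  have hR2 : 0 < R / 2 := by positivity
  set V := (volume (ball (0 : Fin n → ℂ) (R / 2))).toReal with hV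
  have hV0 : 0 < V := ENNReal.toReal_pos (measure_ball_pos _ _ hR2).ne' measure_ball_lt_top.ne
  refine ⟨R / 2, hR2, C.toReal / V, by positivity,
    (ball_subset_closedBall.trans (closedBall_subset_closedBall (by linarith))).trans hball,
    fun F hF f hf z hz => ?_⟩
  have hsub : closedBall z (R / 2) ⊆ closedBall z₀ R :=
    closedBall_subset_closedBall' (by have := mem_ball.1 hz; linarith)
  have h1 := norm_mul_volume_le hF (hsub.trans hball)
  -- Lebesgue measure on the compact ball is dominated by the weighted measure, and for a
  -- probability measure the `L¹` norm is at most the `L²` norm.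
  have h2 : ∫ w in ball z (R / 2), ‖F w‖ ≤ C.toReal * ‖f‖ := by
    rw [integral_norm_eq_lintegral_enorm ((hF.continuousOn.mono
      (ball_subset_closedBall.trans (hsub.trans hball))).aestronglyMeasurable measurableSet_ball),
      Lp.norm_def, ← ENNReal.toReal_mul]
    refine ENNReal.toReal_mono (ENNReal.mul_ne_top hC (Lp.eLpNorm_ne_top f)) ?_
    calc ∫⁻ w in ball z (R / 2), ‖F w‖ₑ ≤ ∫⁻ w in closedBall z₀ R, ‖F w‖ₑ :=
          lintegral_mono_set (ball_subset_closedBall.trans hsub)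
      _ ≤ ∫⁻ w, ‖F w‖ₑ ∂(C • weightedMeasure n lam) := lintegral_mono' hle le_rfl
      _ = C * ∫⁻ w, ‖f w‖ₑ ∂weightedMeasure n lam := by
          rw [lintegral_smul_measure, smul_eq_mul]
          congr 1
          exact lintegral_congr_ae (hf.mono fun w hw => by simp only [hw])
      _ ≤ C * eLpNorm f 2 (weightedMeasure n lam) := by
          rw [← eLpNorm_one_eq_lintegral_enorm]
          gcongr
          exact eLpNorm_le_eLpNorm_of_exponent_le one_le_two (Lp.aestronglyMeasurable f)
  rw [div_mul_eq_mul_div, le_div_iff₀ hV0]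
  exact h1.trans h2

/-- The local bound on point evaluations turns `L²` convergence into locally uniform convergence of
the holomorphic representatives. Their limit is holomorphic and, along a subsequence converging
almost everywhere, agrees with the `L²` limit. -/
theorem isClosed_bergman : IsClosed (bergman n lam : Set (Lp ℂ 2 (weightedMeasure n lam))) := by
  refine isClosed_of_closure_subset fun f hf => ?_
  obtain ⟨u, hu, hlim⟩ := mem_closure_iff_seq_limit.1 hf
  choose F hF huF using hu
  have hdiff : ∀ k l, ((u k - u l : Lp ℂ 2 (weightedMeasure n lam)) : (Fin n → ℂ) → ℂ)
      =ᵐ[weightedMeasure n lam] F k - F l := fun k l =>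
    (Lp.coeFn_sub _ _).trans ((huF k).sub (huF l))
  have huc : ∀ z₀ ∈ domain n, ∃ r > 0, ball z₀ r ⊆ domain n ∧
      UniformCauchySeqOn F atTop (ball z₀ r) := by
    intro z₀ hz₀
    obtain ⟨r, hr, C, hC, hsub, hbound⟩ := exists_norm_le_mul_norm (lam := lam) hz₀
    refine ⟨r, hr, hsub, Metric.uniformCauchySeqOn_iff.2 fun ε hε => ?_⟩
    obtain ⟨N, hN⟩ := Metric.cauchySeq_iff.1 hlim.cauchySeq (ε / (C + 1)) (by positivity)
    refine ⟨N, fun k hk l hl z hz => ?_⟩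
    have h1 := hbound _ ((hF k).sub (hF l)) _ (hdiff k l) z hz
    have h2 := hN k hk l hl
    rw [dist_eq_norm, lt_div_iff₀ (by positivity)] at h2
    rw [dist_eq_norm]
    refine lt_of_le_of_lt h1 ?_
    nlinarith [norm_nonneg (u k - u l)]
  have hpt : ∀ z, ∃ w, z ∈ domain n → Tendsto (fun k => F k z) atTop (𝓝 w) := by
    intro z
    by_cases hz : z ∈ domain n
    · obtain ⟨r, hr, -, h⟩ := huc z hz
      obtain ⟨w, hw⟩ := cauchySeq_tendsto_of_complete (h.cauchySeq (mem_ball_self hr))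
      exact ⟨w, fun _ => hw⟩
    · exact ⟨0, fun h => absurd h hz⟩
  choose g hg using hpt
  refine ⟨g, fun z₀ hz₀ => ?_, ?_⟩
  · obtain ⟨r, hr, hsub, h⟩ := huc z₀ hz₀
    exact (differentiableAt_of_tendstoUniformlyOn hr (fun k => (hF k).mono hsub)
      (h.tendstoUniformlyOn_of_tendsto fun z hz => hg z (hsub hz))).differentiableWithinAt
  · obtain ⟨ns, hns, hae⟩ := (tendstoInMeasure_of_tendsto_Lp hlim).exists_seq_tendsto_ae
    have hall : ∀ᵐ z ∂weightedMeasure n lam, ∀ k, u k z = F k z := ae_all_iff.2 huF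
    filter_upwards [hae, hall, ae_mem_domain n lam] with z h1 h2 h3
    have h4 : Tendsto (fun i => F (ns i) z) atTop (𝓝 (f z)) :=
      h1.congr fun i => h2 (ns i)
    exact tendsto_nhds_unique h4 ((hg z h3).comp hns.tendsto_atTop)

instance completeSpace_bergman : CompleteSpace (bergman n lam) :=
  (isClosed_bergman (n := n) (lam := lam)).completeSpace_coe

/-! ## Polynomials in the Bergman space -/

lemma continuous_eval (p : MvPolynomial (Fin n) ℂ) :
    Continuous fun z => MvPolynomial.eval z p :=
  MvPolynomial.continuous_eval p

lemma memLp_eval (p : MvPolynomial (Fin n) ℂ) :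
    MemLp (fun z => MvPolynomial.eval z p) 2 (weightedMeasure n lam) := by
  obtain ⟨C, hC⟩ := (isCompact_closedBall (0 : Fin n → ℂ) 1).exists_bound_of_continuousOn
    (continuous_eval p).continuousOn
  refine MemLp.of_bound (continuous_eval p).aestronglyMeasurable C ?_
  filter_upwards [ae_mem_domain n lam] with z hz
  exact hC z (mem_closedBall_of_normSq_le hz.1.le)

variable (n lam) in
/-- The embedding of the polynomials into the Bergman space. -/
def polyToBergman : MvPolynomial (Fin n) ℂ →ₗ[ℂ] bergman n lam where
  toFun p := ⟨(memLp_eval p).toLp _, fun z => MvPolynomial.eval z p,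
    (by
      have h : Differentiable ℂ fun z : Fin n → ℂ => MvPolynomial.eval z p := by
        induction p using MvPolynomial.induction_on with
        | C c => simp
        | add p q hp hq => simpa only [map_add] using hp.fun_add hq
        | mul_X p i hp => simpa only [map_mul, MvPolynomial.eval_X] using hp.fun_mul (differentiable_apply i)
      exact h.differentiableOn), (memLp_eval p).coeFn_toLp⟩
  map_add' p q := Subtype.ext <|
    (MemLp.toLp_congr (memLp_eval (p + q)) ((memLp_eval p).add (memLp_eval q))
      (Eventually.of_forall fun z => by simp)).trans
        (MemLp.toLp_add (memLp_eval p) (memLp_eval q))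
  map_smul' c p := Subtype.ext <|
    (MemLp.toLp_congr (memLp_eval (c • p)) ((memLp_eval p).const_smul c)
      (Eventually.of_forall fun z => by simp)).trans (MemLp.toLp_const_smul c (memLp_eval p))

lemma coeFn_polyToBergman (p : MvPolynomial (Fin n) ℂ) :
    ((polyToBergman n lam p : Lp ℂ 2 (weightedMeasure n lam)) : (Fin n → ℂ) → ℂ)
      =ᵐ[weightedMeasure n lam] fun z => MvPolynomial.eval z p :=
  (memLp_eval p).coeFn_toLp

/-- Lebesgue measure on the domain is absolutely continuous with respect to the weighted one, so the
polynomial vanishes on the open domain, which contains a polydisc around 0. -/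
theorem polyToBergman_injective : Function.Injective (polyToBergman n lam) := by
  rw [injective_iff_map_eq_zero]
  intro p hp
  have h1 : (fun z => MvPolynomial.eval z p) =ᵐ[weightedMeasure n lam] fun _ => (0 : ℂ) := by
    refine (coeFn_polyToBergman p).symm.trans ?_
    rw [hp]
    exact Lp.coeFn_zero _ _ _
  have h2 : (fun z => MvPolynomial.eval z p) =ᵐ[volume.restrict (domain n)] fun _ => (0 : ℂ) :=
    restrict_absolutelyContinuous_weightedMeasure.ae_le h1
  have h3 : Set.EqOn (fun z => MvPolynomial.eval z p) (fun _ => (0 : ℂ)) (domain n) :=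
    Measure.eqOn_open_of_ae_eq h2 (isOpen_domain n) (continuous_eval p).continuousOn
      continuousOn_const
  obtain ⟨r, hr, hball⟩ := Metric.isOpen_iff.1 (isOpen_domain n) 0 (zero_mem_domain n)
  refine MvPolynomial.funext_set (fun _ => ball (0 : ℂ) r) (fun _ => ?_) fun z hz => ?_
  · exact infinite_of_mem_nhds 0 (ball_mem_nhds 0 hr)
  · rw [map_zero]
    refine h3 (hball ?_)
    rw [mem_ball_zero_iff, pi_norm_lt_iff hr]
    intro i
    simpa using hz i (mem_univ i)

end Bergman

/-! ## Density of the polynomials -/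

section Density

open Metric Filter Topology Set

variable {n : ℕ} {lam : ℝ}

lemma normSq_smul (c : ℂ) (z : Fin n → ℂ) : normSq (c • z) = ‖c‖ ^ 2 * normSq z := by
  simp [normSq, mul_pow, Finset.mul_sum]

lemma quad_smul (c : ℂ) (z : Fin n → ℂ) : quad (c • z) = c ^ 2 * quad z := by
  simp [quad, mul_pow, Finset.mul_sum]

/-- With `t = |c|²`, replacing `z` by `c z` increases `1 - 2|z|² + |zᵀz|²` by `(1 - t)(2|z|² - (1 +
t)|zᵀz|²)`, which is non-negative because `|zᵀz|² ≤ |z|²` on the domain. -/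
lemma smul_mem_domain {z : Fin n → ℂ} (hz : z ∈ domain n) {c : ℂ} (hc : ‖c‖ ≤ 1) :
    c • z ∈ domain n := by
  obtain ⟨h1, h2⟩ := hz
  have h3 := norm_quad_le z
  have h4 := normSq_nonneg z
  have h5 := norm_nonneg (quad z)
  have h6 := norm_nonneg c
  have ht : ‖c‖ ^ 2 ≤ 1 := by nlinarith
  have ht0 : 0 ≤ ‖c‖ ^ 2 := by positivity
  have hQ : ‖quad z‖ ^ 2 ≤ normSq z := by nlinarith
  rw [domain, mem_ofPred_eq, normSq_smul, quad_smul, norm_mul, norm_pow, mul_pow]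
  set t := ‖c‖ ^ 2
  refine ⟨by nlinarith, ?_⟩
  have h7 : 0 ≤ (1 - t) * (2 * normSq z - ‖quad z‖ ^ 2 * (1 + t)) :=
    mul_nonneg (by linarith) (by nlinarith [sq_nonneg ‖quad z‖])
  nlinarith

/-- The radius exceeds 1 so that the Taylor series of `ζ ↦ F(ζz)` can be evaluated at `ζ = 1`. -/
lemma exists_one_lt_forall_smul_mem_domain {z : Fin n → ℂ} (hz : z ∈ domain n) :
    ∃ R : ℝ, 1 < R ∧ ∀ ζ ∈ ball (0 : ℂ) R, ζ • z ∈ domain n := by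
  have hc : ContinuousAt (fun t : ℝ => (t : ℂ) • z) 1 :=
    (Complex.continuous_ofReal.smul continuous_const).continuousAt
  have hev : ∀ᶠ t : ℝ in 𝓝 1, (t : ℂ) • z ∈ domain n :=
    hc.eventually_mem (by simpa using (isOpen_domain n).mem_nhds hz)
  obtain ⟨ε, hε, h⟩ := Metric.eventually_nhds_iff.1 hev
  have hR : (((1 + ε / 2 : ℝ) : ℝ) : ℂ) • z ∈ domain n := h (by
    rw [Real.dist_eq, add_sub_cancel_left, abs_of_pos (by positivity)]
    linarith)
  refine ⟨1 + ε / 2, by linarith, fun ζ hζ => ?_⟩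
  have hpos : (0 : ℝ) < 1 + ε / 2 := by positivity
  have hne : (((1 + ε / 2 : ℝ) : ℝ) : ℂ) ≠ 0 := by exact_mod_cast hpos.ne'
  have h1 := smul_mem_domain hR (c := ζ / ((1 + ε / 2 : ℝ) : ℂ)) (by
    rw [norm_div, Complex.norm_real, Real.norm_of_nonneg hpos.le, div_le_one hpos]
    exact (mem_ball_zero_iff.1 hζ).le)
  rwa [smul_smul, div_mul_cancel₀ _ hne] at h1

lemma differentiableOn_comp_smul {F : (Fin n → ℂ) → ℂ} (hF : DifferentiableOn ℂ F (domain n))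
    {z : Fin n → ℂ} {s : Set ℂ} (hs : ∀ ζ ∈ s, ζ • z ∈ domain n) :
    DifferentiableOn ℂ (fun ζ : ℂ => F (ζ • z)) s :=
  hF.comp (differentiable_id.smul_const z).differentiableOn hs

/-- The Fourier coefficients along circles of a holomorphic function are its Taylor
coefficients. -/
lemma circleAverage_mul_conj_eval {F : (Fin n → ℂ) → ℂ} (hF : DifferentiableOn ℂ F (domain n))
    {m : ℕ} {p : MvPolynomial (Fin n) ℂ} (hp : p.IsHomogeneous m)
    {z : Fin n → ℂ} (hpz : iteratedDeriv m (fun ζ : ℂ => F (ζ • z)) 0 = MvPolynomial.eval z p)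
    (hz : z ∈ domain n) :
    Real.circleAverage (fun ζ : ℂ => F (ζ • z) *
      starRingEnd ℂ (MvPolynomial.eval (ζ • z) p)) 0 1 =
      (((m.factorial : ℝ)⁻¹ * ‖MvPolynomial.eval z p‖ ^ 2 : ℝ) : ℂ) := by
  rw [Real.circleAverage_eq_circleIntegral one_ne_zero]
  have h1 : (∮ ζ in C(0, 1), (ζ - 0)⁻¹ • (F (ζ • z) *
      starRingEnd ℂ (MvPolynomial.eval (ζ • z) p))) =
      ∮ ζ in C(0, 1), starRingEnd ℂ (MvPolynomial.eval z p) *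
        ((1 / (ζ - 0) ^ (m + 1)) • F (ζ • z)) := by
    refine circleIntegral.integral_congr zero_le_one fun ζ hζ => ?_
    have hn : ‖ζ‖ = 1 := by simpa using hζ
    have h0 : ζ ≠ 0 := by
      rintro rfl
      simp at hn
    have hc : starRingEnd ℂ ζ = ζ⁻¹ := by
      rw [Complex.inv_def, Complex.normSq_eq_norm_sq, hn]
      simp
    simp only [eval_smul_of_isHomogeneous hp, map_mul, map_pow, hc, sub_zero, smul_eq_mul,
      one_div, pow_succ, mul_inv, inv_pow]
    ring
  have h2 := DifferentiableOn.circleIntegral_one_div_sub_center_pow_smul (c := 0) one_pos m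
    (differentiableOn_comp_smul hF (z := z) (s := closedBall 0 1) fun ζ hζ =>
      smul_mem_domain hz (by simpa using hζ))
  rw [h1, circleIntegral.integral_const_mul, h2, hpz, smul_eq_mul, smul_eq_mul]
  have h3 : (2 * Real.pi * Complex.I : ℂ) ≠ 0 := Complex.two_pi_I_ne_zero
  have h4 : (m.factorial : ℂ) ≠ 0 := by exact_mod_cast m.factorial_ne_zero
  push_cast
  rw [← Complex.conj_mul']
  field_simp

lemma measurePreserving_smul_weightedMeasure (n : ℕ) (lam : ℝ) (t : Circle) :
    MeasurePreserving (fun z : Fin n → ℂ => (t : ℂ) • z) (weightedMeasure n lam)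
      (weightedMeasure n lam) := by
  have h := measurePreserving_act (n := n) lam (1, t)
  have h1 : (act n (1, t) : (Fin n → ℂ) → Fin n → ℂ) = fun z => (t : ℂ) • z := by
    funext z
    simp [act_apply]
  rwa [h1] at h

lemma inner_bergmanRep (g : SO n × Circle) (x y : bergman n lam) :
    inner ℂ (bergmanRep n lam g x) (bergmanRep n lam g y) = inner ℂ x y :=
  (Lp.compMeasurePreservingₗᵢ ℂ (act n g⁻¹) (measurePreserving_act lam g⁻¹)).inner_map_map
    (x : Lp ℂ 2 (weightedMeasure n lam)) (y : Lp ℂ 2 (weightedMeasure n lam))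

variable [IsProbabilityMeasure (weightedMeasure n lam)]

/-- An element of the Bergman space that is orthogonal to the polynomials vanishes. -/
theorem eq_zero_of_inner_polyToBergman {f : bergman n lam}
    (h : ∀ p, inner ℂ (polyToBergman n lam p) f = 0) : f = 0 := by
  obtain ⟨F, hF, hfF⟩ := f.2
  have hcoef : ∀ m, ∀ᵐ z ∂weightedMeasure n lam,
      iteratedDeriv m (fun ζ : ℂ => F (ζ • z)) 0 = 0 := by
    intro m
    -- The test polynomial is the `m`-th Taylor polynomial of `F` itself (up to `m!`). Averaging
    -- over circles turns its inner product with `f` into `∫ |p|² / m!`, so `p` vanishes almost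
    -- everywhere.
    obtain ⟨p, hp, hpz⟩ := exists_iteratedDeriv_eq_eval (isOpen_domain n) (zero_mem_domain n) m F hF
    -- `F` is arbitrary off the domain; the indicator restores measurability.
    set G : (Fin n → ℂ) → ℂ :=
      (domain n).indicator fun z => F z * starRingEnd ℂ (MvPolynomial.eval z p) with hG
    have hGm : Measurable G := measurable_indicator_of_continuousOn (measurableSet_domain n)
      (hF.continuousOn.mul ((Complex.continuous_conj.comp (continuous_eval p)).continuousOn))
    have hGae : (fun z => inner ℂ
        ((polyToBergman n lam p : Lp ℂ 2 (weightedMeasure n lam)) z)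
        ((f : Lp ℂ 2 (weightedMeasure n lam)) z)) =ᵐ[weightedMeasure n lam] G := by
      filter_upwards [coeFn_polyToBergman p, hfF, ae_mem_domain n lam] with z h1 h2 h3
      rw [h1, h2, hG, indicator_of_mem h3, RCLike.inner_apply]
    have hGint : Integrable G (weightedMeasure n lam) :=
      (L2.integrable_inner (𝕜 := ℂ) (polyToBergman n lam p : Lp ℂ 2 (weightedMeasure n lam))
        (f : Lp ℂ 2 (weightedMeasure n lam))).congr hGae
    have hG0 : ∫ z, G z ∂weightedMeasure n lam = 0 := by
      rw [← integral_congr_ae hGae]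
      exact h p
    rw [integral_eq_integral_circleAverage _ (measurePreserving_smul_weightedMeasure n lam) hGm
      hGint] at hG0
    have havg : (fun z => Real.circleAverage (fun ζ : ℂ => G (ζ • z)) 0 1)
        =ᵐ[weightedMeasure n lam]
        fun z => (((m.factorial : ℝ)⁻¹ * ‖MvPolynomial.eval z p‖ ^ 2 : ℝ) : ℂ) := by
      filter_upwards [ae_mem_domain n lam] with z hz
      rw [← circleAverage_mul_conj_eval hF hp (hpz z) hz]
      refine Real.circleAverage_congr_sphere fun ζ hζ => ?_
      have hn : ‖ζ‖ = 1 := by simpa using hζ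
      exact indicator_of_mem (smul_mem_domain hz hn.le) _
    rw [integral_congr_ae havg, integral_complex_ofReal, Complex.ofReal_eq_zero,
      integral_const_mul, mul_eq_zero] at hG0
    have h5 : ∫ z, ‖MvPolynomial.eval z p‖ ^ 2 ∂weightedMeasure n lam = 0 :=
      hG0.resolve_left (inv_ne_zero (by exact_mod_cast m.factorial_ne_zero))
    rw [integral_eq_zero_iff_of_nonneg (fun z => by positivity)
      ((memLp_two_iff_integrable_sq_norm (memLp_eval p).1).1 (memLp_eval p))] at h5
    filter_upwards [h5] with z hz
    rw [hpz]
    simpa using hz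
  refine Subtype.ext (Lp.ext ?_)
  filter_upwards [ae_all_iff.2 hcoef, hfF, ae_mem_domain n lam,
    Lp.coeFn_zero ℂ 2 (weightedMeasure n lam)] with z h1 h2 h3 h4
  obtain ⟨R, hR, hball⟩ := exists_one_lt_forall_smul_mem_domain h3
  have h5 := Complex.hasSum_taylorSeries_on_ball (differentiableOn_comp_smul hF hball)
    (z := 1) (by simpa using hR)
  simp only [h1, smul_zero, one_smul] at h5
  rw [h2, h5.unique hasSum_zero]
  exact h4.symm

theorem topologicalClosure_range_polyToBergman :
    (LinearMap.range (polyToBergman n lam)).topologicalClosure = ⊤ := by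
  rw [Submodule.topologicalClosure_eq_top_iff, Submodule.eq_bot_iff]
  intro f hf
  exact eq_zero_of_inner_polyToBergman fun p => hf _ ⟨p, rfl⟩

lemma bergmanRep_polyToBergman (g : SO n × Circle) {p q : MvPolynomial (Fin n) ℂ}
    (h : ∀ z, MvPolynomial.eval (act n g⁻¹ z) p = MvPolynomial.eval z q) :
    bergmanRep n lam g (polyToBergman n lam p) = polyToBergman n lam q := by
  refine Subtype.ext (Lp.ext ?_)
  refine (Lp.coeFn_compMeasurePreserving _ (measurePreserving_act lam g⁻¹)).trans ?_
  refine ((measurePreserving_act lam g⁻¹).quasiMeasurePreserving.ae_eq_comp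
    (coeFn_polyToBergman p)).trans ?_
  refine EventuallyEq.trans (Eventually.of_forall fun z => ?_) (coeFn_polyToBergman q).symm
  exact h z

end Density

/-! ## Separation of the last variable -/

section LastVariable

variable {d : ℕ}

/-- Polynomials in `d + 1` variables as polynomials in the last variable. -/
def lastVariableEquiv (d : ℕ) :
    Polynomial (MvPolynomial (Fin d) ℂ) ≃ₐ[ℂ] MvPolynomial (Fin (d + 1)) ℂ :=
  (MvPolynomial.optionEquivLeft ℂ (Fin d)).symm.trans
    (MvPolynomial.renameEquiv ℂ finSuccEquivLast.symm)

lemma eval_lastVariableEquiv_monomial (a : ℕ) (p : MvPolynomial (Fin d) ℂ)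
    (z : Fin (d + 1) → ℂ) :
    MvPolynomial.eval z (lastVariableEquiv d (Polynomial.monomial a p)) =
      z (Fin.last d) ^ a * MvPolynomial.eval (fun i => z i.castSucc) p := by
  have hX : lastVariableEquiv d Polynomial.X = MvPolynomial.X (Fin.last d) := by
    simp [lastVariableEquiv, MvPolynomial.optionEquivLeft_symm_apply]
  have hC : lastVariableEquiv d (Polynomial.C p) = MvPolynomial.rename Fin.castSucc p := by
    simp only [lastVariableEquiv, AlgEquiv.trans_apply, MvPolynomial.optionEquivLeft_symm_apply,
      MvPolynomial.renameEquiv_apply, Polynomial.aevalTower_C, MvPolynomial.rename_rename]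
    refine congrArg (fun f => MvPolynomial.rename f p) (funext fun i => ?_)
    simp
  rw [← Polynomial.C_mul_X_pow_eq_monomial, map_mul, map_pow, hX, hC, map_mul, map_pow,
    MvPolynomial.eval_X, MvPolynomial.eval_rename, mul_comm]
  rfl

lemma toComplex_cornerEmbedding_mulVec_castSucc (A : SO d) (z : Fin (d + 1) → ℂ) (i : Fin d) :
    (SO.toComplex (cornerEmbedding d A)).mulVec z i.castSucc =
      (SO.toComplex A).mulVec (fun j => z j.castSucc) i := by
  have h : (cornerEmbedding d A : Matrix (Fin (d + 1)) (Fin (d + 1)) ℝ) =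
      cornerMatrix (A : Matrix (Fin d) (Fin d) ℝ) := rfl
  simp [Matrix.mulVec, dotProduct, Fin.sum_univ_castSucc, SO.toComplex_apply, h,
    cornerMatrix_castSucc_castSucc, cornerMatrix_castSucc_last]

lemma toComplex_cornerEmbedding_mulVec_last (A : SO d) (z : Fin (d + 1) → ℂ) :
    (SO.toComplex (cornerEmbedding d A)).mulVec z (Fin.last d) = z (Fin.last d) := by
  have h : (cornerEmbedding d A : Matrix (Fin (d + 1)) (Fin (d + 1)) ℝ) =
      cornerMatrix (A : Matrix (Fin d) (Fin d) ℝ) := rfl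
  simp [Matrix.mulVec, dotProduct, Fin.sum_univ_castSucc, SO.toComplex_apply, h,
    cornerMatrix_last_castSucc, cornerMatrix_last_last]

lemma quad_toComplex_mulVec (A : SO d) (z : Fin d → ℂ) :
    quad ((SO.toComplex A).mulVec z) = quad z := by
  simpa [act_apply] using quad_act (A, (1 : Circle)) z

/-- The polynomials `z_{d+1}^a (z_1² + ⋯ + z_d²)^j h(z_1, …, z_d)`, where `h` is harmonic. -/
def harmonicTimes (d r a j : ℕ) : harmonic d r →ₗ[ℂ] MvPolynomial (Fin (d + 1)) ℂ :=
  (lastVariableEquiv d).toLinearMap ∘ₗ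
    (Polynomial.monomial (R := MvPolynomial (Fin d) ℂ) a).restrictScalars ℂ ∘ₗ
      LinearMap.mulLeft ℂ (quadPoly d ^ j) ∘ₗ (harmonic d r).subtype

lemma harmonicTimes_apply (d r a j : ℕ) (h : harmonic d r) :
    harmonicTimes d r a j h = lastVariableEquiv d
      (Polynomial.monomial a (quadPoly d ^ j * (h : MvPolynomial (Fin d) ℂ))) := rfl

lemma eval_harmonicTimes {r a j : ℕ} (h : harmonic d r) (z : Fin (d + 1) → ℂ) :
    MvPolynomial.eval z (harmonicTimes d r a j h) = z (Fin.last d) ^ a *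
      (quad (fun i : Fin d => z i.castSucc) ^ j *
        MvPolynomial.eval (fun i => z i.castSucc) (h : MvPolynomial (Fin d) ℂ)) := by
  rw [harmonicTimes_apply, eval_lastVariableEquiv_monomial, map_mul, map_pow, eval_quadPoly]

/-- The corner `SO(d)` fixes the last variable and the quadratic form, so it acts on the harmonic
factor alone. The circle sees only the total degree `a + 2j + r`. -/
lemma eval_act_harmonicTimes {r a j : ℕ} (A : SO d) (t : Circle) (h : harmonic d r)
    (z : Fin (d + 1) → ℂ) :
    MvPolynomial.eval (act (d + 1) (cornerEmbedding d A, t)⁻¹ z) (harmonicTimes d r a j h) =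
      MvPolynomial.eval z (harmonicTimes d r a j
        (((t⁻¹ : Circle) : ℂ) ^ (a + 2 * j + r) • harmonicRep d r A h)) := by
  have hlast : act (d + 1) (cornerEmbedding d A, t)⁻¹ z (Fin.last d) =
      ((t⁻¹ : Circle) : ℂ) * z (Fin.last d) := by
    rw [Prod.inv_mk, ← map_inv, act_apply, Pi.smul_apply, smul_eq_mul,
      toComplex_cornerEmbedding_mulVec_last]
  have hcast : (fun i : Fin d => act (d + 1) (cornerEmbedding d A, t)⁻¹ z i.castSucc) =
      ((t⁻¹ : Circle) : ℂ) • (SO.toComplex A⁻¹).mulVec (fun i => z i.castSucc) := by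
    funext i
    rw [Prod.inv_mk, ← map_inv, act_apply, Pi.smul_apply, Pi.smul_apply,
      toComplex_cornerEmbedding_mulVec_castSucc]
  rw [eval_harmonicTimes, map_smul, ← smul_eq_mul, MvPolynomial.smul_eval, eval_harmonicTimes,
    harmonicRep_apply_coe, eval_substMatrix, hlast, hcast, eval_smul_of_isHomogeneous h.2.1,
    quad_smul, quad_toComplex_mulVec, smul_eq_mul]
  ring

/-- The summands carry distinct powers of the last variable and are separated by comparing
coefficients. The bound `hk` keeps the truncated exponents `m - r - 2j` distinct. -/
lemma eq_zero_of_sum_harmonicTimes (hd : 0 < d) {k m r : ℕ} (hk : ∀ j < k, 2 * j + r ≤ m)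
    {w : Fin k → harmonic d r}
    (hw : ∑ j : Fin k, harmonicTimes d r (m - r - 2 * j) j (w j) = 0) : w = 0 := by
  simp only [harmonicTimes_apply] at hw
  rw [← map_sum, EmbeddingLike.map_eq_zero_iff] at hw
  funext i
  have h1 := congrArg (fun P => Polynomial.coeff P (m - r - 2 * i)) hw
  simp only [Polynomial.finsetSum_coeff, Polynomial.coeff_monomial, Polynomial.coeff_zero] at h1
  rw [Finset.sum_eq_single i, if_pos rfl] at h1
  · exact Subtype.ext ((mul_eq_zero.1 h1).resolve_left (pow_ne_zero _ (quadPoly_ne_zero hd)))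
  · intro j _ hj
    have h2 := hk i i.2
    have h3 := hk j j.2
    have h4 : (j : ℕ) ≠ i := fun h => hj (Fin.ext h)
    exact if_neg (by omega)
  · simp

lemma harmonicTimes_injective (hd : 0 < d) (r a j : ℕ) :
    Function.Injective (harmonicTimes d r a j) := by
  rw [injective_iff_map_eq_zero]
  intro h h0
  rw [harmonicTimes_apply, EmbeddingLike.map_eq_zero_iff, Polynomial.monomial_eq_zero_iff] at h0
  exact Subtype.ext ((mul_eq_zero.1 h0).resolve_left (pow_ne_zero _ (quadPoly_ne_zero hd)))

/-- Every polynomial is a sum of products of powers of the last variable, powers of the quadratic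
form of the other variables and harmonic polynomials of the other variables. -/
lemma iSup_range_harmonicTimes (hd : 0 < d) :
    ⨆ x : ℕ × ℕ × ℕ, LinearMap.range (harmonicTimes d x.1 x.2.1 x.2.2) = ⊤ := by
  rw [eq_top_iff]
  intro p _
  obtain ⟨P, rfl⟩ := (lastVariableEquiv d).surjective p
  induction P using Polynomial.induction_on' with
  | add P Q hP hQ =>
    rw [map_add]
    exact Submodule.add_mem _ (hP trivial) (hQ trivial)
  | monomial a p =>
    rw [← MvPolynomial.sum_homogeneousComponent p, map_sum, map_sum]
    refine Submodule.sum_mem _ fun k _ => ?_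
    obtain ⟨h, hh, hp⟩ := exists_harmonic_decomposition hd k _
      (MvPolynomial.homogeneousComponent_isHomogeneous k p)
    rw [hp, map_sum, map_sum]
    refine Submodule.sum_mem _ fun j hj => ?_
    have hj' : 2 * j ≤ k := by
      have := Finset.mem_range.1 hj
      omega
    exact Submodule.mem_iSup_of_mem (k - 2 * j, a, j) ⟨⟨h j, hh j hj'⟩, rfl⟩

end LastVariable

/-- In this form the multiplicity counts the `j` with `2j ≤ m - r`. -/
lemma mult_eq {m r : ℕ} (h : r ≤ m) : mult m r = (m - r) / 2 + 1 := by
  unfold mult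
  omega

/-! ## The types of the decomposition -/

section Types

variable {d r m : ℕ}

lemma rid_harmonicTensorChar (A : SO d) (t : Circle) (x : harmonic d r ⊗[ℂ] ℂ) :
    TensorProduct.rid ℂ _ (harmonicTensorChar d r m (A, t) x) =
      ((t⁻¹ : Circle) : ℂ) ^ m • harmonicRep d r A (TensorProduct.rid ℂ _ x) := by
  induction x with
  | zero => simp
  | add x y hx hy => rw [map_add, map_add, hx, hy, map_add, map_add, smul_add]
  | tmul h c =>
    change TensorProduct.rid ℂ _ (harmonicRep d r A h ⊗ₜ[ℂ] (((t⁻¹ : Circle) : ℂ) ^ m • c)) = _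
    rw [TensorProduct.rid_tmul, TensorProduct.rid_tmul, map_smul, smul_smul, smul_eq_mul]

/-- The second factor is one-dimensional, so invariance under the elements `(A, 1)` already reduces
the claim to the harmonic space. -/
lemma harmonicTensorChar_isIrreducible (h : (harmonicRep d r).IsIrreducible) :
    Representation.IsIrreducible (V := harmonic d r ⊗[ℂ] ℂ) (harmonicTensorChar d r m) := by
  rw [isIrreducible_iff] at h ⊢
  obtain ⟨hnt, h⟩ := h
  set e := TensorProduct.rid ℂ (harmonic d r) with he
  refine ⟨e.toEquiv.nontrivial, fun p hp => ?_⟩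
  have h1 := h (p.comap (e.symm : harmonic d r →ₗ[ℂ] harmonic d r ⊗[ℂ] ℂ)) (fun A x hx => by
    have h2 := hp (A, 1) _ hx
    rw [Submodule.mem_comap]
    convert h2
    rw [LinearEquiv.coe_coe, LinearEquiv.symm_apply_eq, he, rid_harmonicTensorChar]
    simp)
  have hmem : ∀ x, e x ∈ p.comap (e.symm : harmonic d r →ₗ[ℂ] harmonic d r ⊗[ℂ] ℂ) ↔ x ∈ p :=
    fun x => by rw [Submodule.mem_comap, LinearEquiv.coe_coe, LinearEquiv.symm_apply_apply]
  rcases h1 with h1 | h1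
  · refine Or.inl ((Submodule.eq_bot_iff _).2 fun x hx => ?_)
    rw [← hmem, h1, Submodule.mem_bot] at hx
    exact e.map_eq_zero_iff.1 hx
  · refine Or.inr (Submodule.eq_top_iff'.2 fun x => ?_)
    rw [← hmem, h1]
    trivial

/-- The characters `t ↦ t⁻ᵐ` of the circle are distinct. -/
lemma eq_of_forall_circle_pow_eq {m m' : ℕ}
    (h : ∀ t : Circle, ((t⁻¹ : Circle) : ℂ) ^ m = ((t⁻¹ : Circle) : ℂ) ^ m') : m = m' := by
  -- At `t = e^i`, an element of infinite order, equal powers with different exponents would make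
  -- `π` rational.
  have h1 := h (Circle.exp 1)
  rw [← Circle.exp_neg, Circle.coe_exp, ← Complex.exp_nat_mul, ← Complex.exp_nat_mul,
    Complex.exp_eq_exp_iff_exists_int] at h1
  obtain ⟨k, hk⟩ := h1
  have h2 : ((m' : ℝ) - m : ℝ) = k * (2 * Real.pi) := by
    have h3 := congrArg Complex.im hk
    simp at h3
    linarith
  by_cases hk0 : k = 0
  · rw [hk0] at h2
    have h3 : (m' : ℝ) = m := by simpa [sub_eq_zero] using h2
    exact_mod_cast h3.symm
  · exfalso
    refine irrational_pi ⟨(((m' : ℚ) - m) / (2 * k)), ?_⟩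
    have hk1 : (k : ℝ) ≠ 0 := by exact_mod_cast hk0
    push_cast
    rw [h2]
    field_simp

/-- The types `H^r(ℂᵈ) ⊗ ℂ_m` are mutually inequivalent if the representations on the spaces
`H^r(ℂᵈ)` are. -/
lemma eq_of_harmonicTensorChar_equiv {m' r' : ℕ} [Nontrivial (harmonic d r)]
    (hr : ∀ L : harmonic d r ≃ₗ[ℂ] harmonic d r',
      (∀ A h, L (harmonicRep d r A h) = harmonicRep d r' A (L h)) → r = r')
    (e : (harmonicTensorChar d r m).Equiv (harmonicTensorChar d r' m')) : m = m' ∧ r = r' := by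
  set L : harmonic d r ≃ₗ[ℂ] harmonic d r' := (TensorProduct.rid ℂ (harmonic d r)).symm.trans
    (e.toLinearEquiv.trans (TensorProduct.rid ℂ (harmonic d r'))) with hL
  have hint : ∀ (A : SO d) (t : Circle) (h : harmonic d r),
      ((t⁻¹ : Circle) : ℂ) ^ m • L (harmonicRep d r A h) =
        ((t⁻¹ : Circle) : ℂ) ^ m' • harmonicRep d r' A (L h) := by
    intro A t h
    have h1 : ((t⁻¹ : Circle) : ℂ) ^ m • harmonicRep d r A h = TensorProduct.rid ℂ _
        (harmonicTensorChar d r m (A, t) ((TensorProduct.rid ℂ _).symm h)) := by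
      rw [rid_harmonicTensorChar, LinearEquiv.apply_symm_apply]
    have h2 : ∀ x, e.toLinearEquiv (harmonicTensorChar d r m (A, t) x) =
        harmonicTensorChar d r' m' (A, t) (e.toLinearEquiv x) := fun x =>
      LinearMap.congr_fun (e.toIntertwiningMap.isIntertwining' (A, t)) x
    rw [← map_smul, h1, hL]
    simp only [LinearEquiv.trans_apply]
    rw [LinearEquiv.symm_apply_apply, h2, rid_harmonicTensorChar]
  clear_value L
  -- The elements `(1, t)` compare the characters, and the elements `(A, 1)` make `L` an
  -- `SO(d)`-equivalence.
  refine ⟨eq_of_forall_circle_pow_eq fun t => ?_, hr L fun A h => ?_⟩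
  · obtain ⟨h, h0⟩ := exists_ne (0 : harmonic d r)
    have h1 := hint 1 t h
    rw [map_one, map_one, Module.End.one_apply, Module.End.one_apply] at h1
    exact smul_left_injective ℂ (fun h2 => h0 (L.map_eq_zero_iff.1 h2)) h1
  · simpa using hint A 1 h

end Types

/-! ### Embeddings of the types into the Bergman space -/

section Decomposition

variable {d : ℕ} {lam : ℝ}

lemma inner_restrictedRep (g : SO d × Circle) (x y : bergman (d + 1) lam) :
    inner ℂ (restrictedRep d lam g x) (restrictedRep d lam g y) = inner ℂ x y :=
  inner_bergmanRep _ x y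

variable [IsProbabilityMeasure (weightedMeasure (d + 1) lam)]

lemma bergmanRep_polyToBergman_harmonicTimes {r a j : ℕ} (A : SO d) (t : Circle)
    (h : harmonic d r) :
    restrictedRep d lam (A, t) (polyToBergman (d + 1) lam (harmonicTimes d r a j h)) =
      polyToBergman (d + 1) lam (harmonicTimes d r a j
        (((t⁻¹ : Circle) : ℂ) ^ (a + 2 * j + r) • harmonicRep d r A h)) :=
  bergmanRep_polyToBergman _ (eval_act_harmonicTimes A t h)

/-- The harmonic polynomials as elements of the Bergman space. -/
def harmonicToBergman (d r : ℕ) (lam : ℝ) [IsProbabilityMeasure (weightedMeasure (d + 1) lam)] :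
    harmonic d r →ₗ[ℂ] bergman (d + 1) lam :=
  polyToBergman (d + 1) lam ∘ₗ harmonicTimes d r 0 0

lemma harmonicToBergman_injective (hd : 0 < d) (r : ℕ) :
    Function.Injective (harmonicToBergman d r lam) :=
  polyToBergman_injective.comp (harmonicTimes_injective hd r 0 0)

/-- This supplies the `SO(d)`-invariant inner product on harmonic polynomials that the
irreducibility and inequivalence arguments require. -/
lemma inner_harmonicToBergman {r : ℕ} (A : SO d) (p q : harmonic d r) :
    inner ℂ (harmonicToBergman d r lam (harmonicRep d r A p))
      (harmonicToBergman d r lam (harmonicRep d r A q)) =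
      inner ℂ (harmonicToBergman d r lam p) (harmonicToBergman d r lam q) := by
  have h : ∀ p, harmonicToBergman d r lam (harmonicRep d r A p) =
      restrictedRep d lam (A, 1) (harmonicToBergman d r lam p) := fun p => by
    rw [harmonicToBergman, LinearMap.comp_apply, LinearMap.comp_apply,
      bergmanRep_polyToBergman_harmonicTimes]
    simp
  rw [h, h, inner_restrictedRep]

/-- The embeddings `h ↦ z_{d+1}^(m-r-2j) (z_1² + ⋯ + z_d²)^j h` of `H^r(ℂᵈ) ⊗ ℂ_m` into the Bergman
space. -/
def typeEmbedding (lam : ℝ) [IsProbabilityMeasure (weightedMeasure (d + 1) lam)] {m r j : ℕ}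
    (hj : 2 * j + r ≤ m) :
    (harmonicTensorChar d r m).IntertwiningMap (restrictedRep d lam) where
  toLinearMap := polyToBergman (d + 1) lam ∘ₗ harmonicTimes d r (m - r - 2 * j) j ∘ₗ
    (TensorProduct.rid ℂ (harmonic d r)).toLinearMap
  isIntertwining' := by
    rintro ⟨A, t⟩
    refine LinearMap.ext fun x => ?_
    simp only [LinearMap.comp_apply, LinearEquiv.coe_coe, rid_harmonicTensorChar,
      bergmanRep_polyToBergman_harmonicTimes]
    rw [show m - r - 2 * j + 2 * j + r = m by omega]

lemma typeEmbedding_apply {m r j : ℕ} (hj : 2 * j + r ≤ m) (x : harmonic d r ⊗[ℂ] ℂ) :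
    typeEmbedding lam hj x = polyToBergman (d + 1) lam
      (harmonicTimes d r (m - r - 2 * j) j (TensorProduct.rid ℂ _ x)) := rfl

lemma two_mul_add_le {p : Index} (i : Fin (mult p.1 p.2)) : 2 * (i : ℕ) + p.2 ≤ p.1 := by
  have h1 := mult_eq (Nat.lt_succ_iff.1 p.2.2)
  have h2 := i.2
  have h3 := p.2.2
  omega

lemma eq_zero_of_sum_typeEmbedding (hd : 0 < d) (p : Index)
    (w : Fin (mult p.1 p.2) → harmonic d p.2 ⊗[ℂ] ℂ)
    (hw : ∑ i, typeEmbedding lam (two_mul_add_le i) (w i) = 0) : w = 0 := by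
  simp only [typeEmbedding_apply] at hw
  rw [← map_sum] at hw
  have h1 := eq_zero_of_sum_harmonicTimes hd (k := mult p.1 p.2) (m := p.1)
    (fun j hj => two_mul_add_le ⟨j, hj⟩)
    ((map_eq_zero_iff _ polyToBergman_injective).1 hw)
  funext i
  exact (TensorProduct.rid ℂ (harmonic d p.2)).map_eq_zero_iff.1 (congrFun h1 i)

/-- Each product `z_{d+1}^a Q^j h` with `h` of degree `r` belongs to type `(a + 2j + r, r)` with
index `j`. These products span all polynomials, which are dense. -/
lemma topologicalClosure_eq_top_of_typeEmbedding_mem (hd : 0 < d)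
    {S : Submodule ℂ (bergman (d + 1) lam)}
    (hS : ∀ (p : Index) (i : Fin (mult p.1 p.2)) (x : harmonic d p.2 ⊗[ℂ] ℂ),
      typeEmbedding lam (two_mul_add_le i) x ∈ S) : S.topologicalClosure = ⊤ := by
  rw [eq_top_iff, ← topologicalClosure_range_polyToBergman]
  refine Submodule.topologicalClosure_mono ?_
  rw [LinearMap.range_eq_map, ← iSup_range_harmonicTimes hd, Submodule.map_iSup]
  refine iSup_le ?_
  rintro ⟨r, a, j⟩ _ ⟨_, ⟨h, rfl⟩, rfl⟩
  have hj : j < mult (a + 2 * j + r) r := by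
    rw [mult_eq (by omega)]
    omega
  have h1 := hS ⟨a + 2 * j + r, ⟨r, by omega⟩⟩ ⟨j, hj⟩ (h ⊗ₜ 1)
  rw [typeEmbedding_apply, TensorProduct.rid_tmul, one_smul] at h1
  dsimp only at h1
  rwa [show a + 2 * j + r - r - 2 * j = a by omega] at h1

end Decomposition

end

end CartanIV

/-- The dimension is `n = d + 1 ≥ 4` and `lam > n - 1`. -/
theorem proposition3p6 (d : ℕ) (hd : 4 ≤ d + 1) (lam : ℝ) (hlam : ((d + 1 : ℕ) : ℝ) - 1 < lam) :
    -- the `H^r(ℂ^(n-1)) ⊗ ℂ_m`, `r ≤ m`, are the types of the isotypic decomposition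
    CartanIV.IsIsotypicDecomposition (CartanIV.restrictedRep d lam)
      (W := fun p : CartanIV.Index => CartanIV.harmonic d p.2 ⊗[ℂ] ℂ)
      (fun p => CartanIV.harmonicTensorChar d p.2 p.1) ∧
    -- each isotypic component consists of the stated number of copies
    (∀ p : CartanIV.Index,
      Nonempty ((CartanIV.component (CartanIV.restrictedRep d lam)
        (CartanIV.harmonicTensorChar d p.2 p.1)).toRepresentation.Equiv
          (CartanIV.copies (CartanIV.mult p.1 p.2) (CartanIV.harmonicTensorChar d p.2 p.1)))) ∧
    -- the Bergman space is isomorphic to the Hilbert direct sum of these multiples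
    CartanIV.IsIsoHilbertSum (CartanIV.restrictedRep d lam)
      (fun p : CartanIV.Index =>
        CartanIV.copies (CartanIV.mult p.1 p.2) (CartanIV.harmonicTensorChar d p.2 p.1)) ∧
    -- the isotypic decomposition is not multiplicity-free
    ¬ CartanIV.IsMultiplicityFree (CartanIV.restrictedRep d lam) := by
  have := CartanIV.isProbabilityMeasure_weightedMeasure (n := d + 1) (lam := lam) (by omega) hlam
  -- The stabilizer of the base point is `SO(e)`. The assumption `n ≥ 4` enters as `e ≥ 2`, which
  -- makes `SO(e)` transitive on the spheres of `ℝ^e`.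
  obtain ⟨e, rfl, he⟩ : ∃ e, d = e + 1 ∧ 2 ≤ e := ⟨d - 1, by omega, by omega⟩
  have := fun r => Submodule.nontrivial_iff_ne_bot.2
    (CartanIV.harmonic_ne_bot (d := e + 1) (by omega) r)
  have hinj := fun r => CartanIV.harmonicToBergman_injective (lam := lam) (d := e + 1) (by omega) r
  have hirr : ∀ p : CartanIV.Index, Representation.IsIrreducible
      (V := CartanIV.harmonic (e + 1) p.2 ⊗[ℂ] ℂ)
      (CartanIV.harmonicTensorChar (e + 1) p.2 p.1) := fun p =>
    CartanIV.harmonicTensorChar_isIrreducible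
      (CartanIV.harmonicRep_isIrreducible he (hinj p.2) CartanIV.inner_harmonicToBergman)
  have hne : ∀ p q : CartanIV.Index, Nonempty ((CartanIV.harmonicTensorChar (e + 1) p.2 p.1).Equiv
      (CartanIV.harmonicTensorChar (e + 1) q.2 q.1)) → p = q := by
    rintro ⟨m, r⟩ ⟨m', r'⟩ ⟨f⟩
    -- The degree inequality for an equivalence and for its inverse gives equality.
    obtain ⟨h1, h2⟩ := CartanIV.eq_of_harmonicTensorChar_equiv (fun L hL => le_antisymm
      (CartanIV.degree_le_of_equiv he (hinj r') CartanIV.inner_harmonicToBergman L.symm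
        fun A h => by rw [LinearEquiv.symm_apply_eq, hL, LinearEquiv.apply_symm_apply])
      (CartanIV.degree_le_of_equiv he (hinj r) CartanIV.inner_harmonicToBergman L hL)) f
    dsimp only at h1 h2
    subst h1
    rw [Fin.ext h2]
  have h := CartanIV.isotypic_of_intertwiningMaps (CartanIV.restrictedRep (e + 1) lam)
    CartanIV.inner_restrictedRep
    (W := fun p : CartanIV.Index => CartanIV.harmonic (e + 1) p.2 ⊗[ℂ] ℂ)
    (fun p => CartanIV.harmonicTensorChar (e + 1) p.2 p.1) hirr hne
    (fun p => CartanIV.mult p.1 p.2) (fun p => Nat.succ_pos _)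
    (fun p i => CartanIV.typeEmbedding lam (CartanIV.two_mul_add_le i))
    (CartanIV.eq_zero_of_sum_typeEmbedding (by omega))
    (CartanIV.topologicalClosure_eq_top_of_typeEmbedding_mem (by omega) fun p i x =>
      Submodule.mem_iSup_of_mem p (Submodule.mem_iSup_of_mem i ⟨x, rfl⟩))
  -- The type `m = 2`, `r = 0` has multiplicity 2, realized by `z_{d+1}²` and `z_1² + ⋯ + z_d²`.
  exact ⟨h.1, h.2.1, h.2.2.1, h.2.2.2 ⟨⟨2, 0⟩, le_rfl⟩⟩
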